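/- **Setting.** Let $k$ be a field and $B$ a finite-dimensional Hopf algebra over $k$ with antipode $S$. Let ${}^B_B\mathcal{YD}$ be the category of left-left Yetter–Drinfeld modules over $B$, that is, of left $B$-modules and left $B$-comodules $V$, $v\mapsto\sum v_{(-1)}\otimes v_{(0)}$, with $\sum b_1v_{(-1)}\otimes b_2\cdot v_{(0)}=\sum (b_1\cdot v)_{(-1)}b_2\otimes (b_1\cdot v)_{(0)}$. Its braiding is $C_{V,W}(v\otimes w)=\sum v_{(-1)}\cdot w\otimes v_{(0)}$. In composites, an object denotes its identity map. Let $H$ and $H^d$ be braided Hopf algebras in ${}^B_B\mathcal{YD}$ and let $\langle\,,\rangle:H^d\otimes H\to k$ be a morphism in ${}^B_B\mathcal{YD}$ such that: * $H^d$ is a quasi-dual of $H$ under $\langle\,,\rangle$: $\langle\,,\rangle(H^d\otimes m_H)=(\langle\,,\rangle\otimes\langle\,,\rangle)(H^d\otimes C_{H^d,H}\otimes H)(\Delta_{H^d}\otimes H\otimes H)$, $\langle\,,\rangle(m_{H^d}\otimes H)=(\langle\,,\rangle\otimes\langle\,,\rangle)(H^d\otimes C_{H^d,H}\otimes H)(H^d\otimes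 H^d\otimes\Delta_H)$, $\langle f,1\rangle=\epsilon(f)$, $\langle 1,x\rangle=\epsilon(x)$, and $\langle S_{H^d}(f),x\rangle=\langle f,S_H(x)\rangle$; * $\langle b\cdot f,x\rangle=\langle f,S(b)\cdot x\rangle$ and $\sum\langle f_{(0)},x\rangle f_{(-1)}=\sum\langle f,x_{(0)}\rangle S^{-1}(x_{(-1)})$ for all $b\in B$, $f\in H^d$, $x\in H$; * $\langle\,,\rangle$ is left faithful: $\langle f,H\rangle=0$ implies $f=0$. Assume that $C_{H,H}=C_{H,H}^{-1}$ and that the antipodes of $H$ and of $H^d$ are bijective. Let $H^d$ act on $H$ by $\rightharpoonup\;=(H\otimes\langle\,,\rangle)(C_{H^d,H}\otimes H)(H^d\otimes\Delta)$. Define linear maps $\lambda:H\otimes H^d\to\operatorname{End}_kH$ and $\rho:H^d\otimes H\to\operatorname{End}_kH$ by $$\lambda(h\otimes f)(x)=(m\otimes\langle\,,\rangle)(H\otimes C_{H^d,H}\otimes H)(H\otimes H^d\otimes\Delta)(h\otimes f\otimes x),$$ $$\rho(f\otimes h)(x)=(\langle\,,\rangle\otimes m)(H^d\otimes H\otimes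 C_{H,H})(H^d\otimes C_{H,H}\otimes H)(H^d\otimes H\otimes\Delta)(f\otimes h\otimes x),$$ and assume the $RL$-condition $\rho(H^d\otimes 1)\subseteq\lambda(H\otimes H^d)$. Let $R$ be a right $H^d$-comodule algebra in ${}^B_B\mathcal{YD}$ with coaction $\psi:R\to R\otimes H^d$ (a morphism in ${}^B_B\mathcal{YD}$, and an algebra map into the braided tensor product). For a left $K$-module algebra $A$ in ${}^B_B\mathcal{YD}$ with action $\alpha$, where $K$ is a braided Hopf algebra, the smash product $A\#K$ is $A\otimes K$ with product $(m_A\otimes m_K)(A\otimes\alpha\otimes K\otimes K)(A\otimes K\otimes C_{K,A}\otimes K)(A\otimes\Delta\otimes A\otimes K)$. The tensor product $A\otimes D$ of two algebras in ${}^B_B\mathcal{YD}$ has the product $(m_A\otimes m_D)(A\otimes C_{D,A}\otimes D)$. **Theorem 2.4.** The map $(R\otimes\langle\,,\rangle)(R\otimes C_{H,H^d})(C_{H,R}\otimes H^d)(H\otimes\psi)$ makes $R$ an $H$-module algebra, $\rightharpoonup$ makes $H$ an $H^d$-module algebra, and $(R\otimes\rightharpoonup)(C_{H^d,R}\otimes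 H)$ (the action that is trivial on $R$ and $\rightharpoonup$ on $H$) makes $R\#H$ an $H^d$-module algebra, all in ${}^B_B\mathcal{YD}$. With these actions $(R\#H)\#H^d$ and $R\otimes(H\#H^d)$ are algebras in ${}^B_B\mathcal{YD}$, and $$(R\#H)\#H^d\;\cong\;R\otimes(H\#H^d)$$ as $k$-algebras. Moreover, if $B$ is commutative and cocommutative, then this isomorphism is one of algebras in ${}^B_B\mathcal{YD}$. -/

import Mathlib

open scoped TensorProduct

section YetterDrinfeld

variable (k B : Type*) [Field k] [Ring B] [HopfAlgebra k B]

/-- The data of a left action `b · v` and a left coaction `v ↦ ∑ v₍₋₁₎ ⊗ v₍₀₎` of `B` on `V`. -/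
class YDStruct (V : Type*) [AddCommMonoid V] [Module k V] where
  /-- The action of `B`. -/
  act : B →ₗ[k] V →ₗ[k] V
  /-- The coaction of `B`. -/
  coact : V →ₗ[k] B ⊗[k] V

section Maps

variable (V W : Type*) [AddCommMonoid V] [Module k V] [YDStruct k B V]
  [AddCommMonoid W] [Module k W] [YDStruct k B W]

/-- The action as a map `B ⊗ V → V`. -/
noncomputable def ydAct : B ⊗[k] V →ₗ[k] V :=
  TensorProduct.lift (YDStruct.act (k := k) (B := B) (V := V))

/-- The coaction `V → B ⊗ V`. -/
noncomputable def ydCoact : V →ₗ[k] B ⊗[k] V := YDStruct.coact (k := k) (B := B) (V := V)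

/-- `b ⊗ v ↦ ∑ b₁ v₍₋₁₎ ⊗ b₂ · v₍₀₎`. -/
noncomputable def ydCompatLeft : B ⊗[k] V →ₗ[k] B ⊗[k] V :=
  TensorProduct.map (LinearMap.mul' k B) (ydAct k B V)
    ∘ₗ (TensorProduct.tensorTensorTensorComm k B B B V).toLinearMap
    ∘ₗ TensorProduct.map (Coalgebra.comul (R := k) (A := B)) (ydCoact k B V)

/-- `b ⊗ v ↦ ∑ (b₁ · v)₍₋₁₎ b₂ ⊗ (b₁ · v)₍₀₎`. -/
noncomputable def ydCompatRight : B ⊗[k] V →ₗ[k] B ⊗[k] V :=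
  (LinearMap.mul' k B).rTensor V
    ∘ₗ (TensorProduct.comm k B B).toLinearMap.rTensor V
    ∘ₗ (TensorProduct.assoc k B B V).symm.toLinearMap
    ∘ₗ (ydCoact k B V ∘ₗ ydAct k B V).lTensor B
    ∘ₗ (TensorProduct.assoc k B B V).toLinearMap
    ∘ₗ (TensorProduct.comm k B B).toLinearMap.rTensor V
    ∘ₗ (Coalgebra.comul (R := k) (A := B)).rTensor V

/-- The braiding `C_{V,W} : V ⊗ W → W ⊗ V`, `v ⊗ w ↦ ∑ v₍₋₁₎ · w ⊗ v₍₀₎`. -/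
noncomputable def ydBraiding : V ⊗[k] W →ₗ[k] W ⊗[k] V :=
  (ydAct k B W).rTensor V
    ∘ₗ (TensorProduct.rightComm k B V W).toLinearMap
    ∘ₗ (ydCoact k B V).rTensor W

end Maps

/-- Left-left Yetter–Drinfeld modules over `B`. -/
class YDModule (V : Type*) [AddCommMonoid V] [Module k V] extends YDStruct k B V where
  one_act : act 1 = LinearMap.id
  mul_act : ∀ a b : B, act (a * b) = act a ∘ₗ act b
  counit_coact : (TensorProduct.lid k V).toLinearMap
    ∘ₗ (Coalgebra.counit (R := k) (A := B)).rTensor V ∘ₗ coact = LinearMap.id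
  coassoc_coact : (TensorProduct.assoc k B B V).toLinearMap
    ∘ₗ (Coalgebra.comul (R := k) (A := B)).rTensor V ∘ₗ coact = coact.lTensor B ∘ₗ coact
  compat : ydCompatLeft k B V = ydCompatRight k B V

/-- The unit object `k`: `b · c = ε(b) c` and `c ↦ 1 ⊗ c`. -/
noncomputable instance ydStructUnit : YDStruct k B k where
  act := (Coalgebra.counit (R := k) (A := B)).smulRight LinearMap.id
  coact := TensorProduct.mk k B k 1

/-- The tensor product: `b · (v ⊗ w) = ∑ b₁ · v ⊗ b₂ · w` and
`v ⊗ w ↦ ∑ v₍₋₁₎ w₍₋₁₎ ⊗ (v₍₀₎ ⊗ w₍₀₎)`. -/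
noncomputable instance ydStructTensor (V W : Type*) [AddCommMonoid V] [Module k V]
    [YDStruct k B V] [AddCommMonoid W] [Module k W] [YDStruct k B W] :
    YDStruct k B (V ⊗[k] W) where
  act := TensorProduct.homTensorHomMap (RingHom.id k) V W V W
    ∘ₗ TensorProduct.map (YDStruct.act (k := k) (B := B) (V := V))
      (YDStruct.act (k := k) (B := B) (V := W))
    ∘ₗ Coalgebra.comul (R := k) (A := B)
  coact := (LinearMap.mul' k B).rTensor (V ⊗[k] W)
    ∘ₗ (TensorProduct.tensorTensorTensorComm k B V B W).toLinearMap
    ∘ₗ TensorProduct.map (ydCoact k B V) (ydCoact k B W)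

/-- Morphisms of Yetter–Drinfeld modules: `B`-linear and `B`-colinear maps. -/
structure IsYDHom {V W : Type*} [AddCommMonoid V] [Module k V] [YDStruct k B V]
    [AddCommMonoid W] [Module k W] [YDStruct k B W] (f : V →ₗ[k] W) : Prop where
  act : f ∘ₗ ydAct k B V = ydAct k B W ∘ₗ f.lTensor B
  coact : f.lTensor B ∘ₗ ydCoact k B V = ydCoact k B W ∘ₗ f

end YetterDrinfeld

section Algebras

variable {k : Type*} [Field k] {A D : Type*} [AddCommMonoid A] [Module k A]
  [AddCommMonoid D] [Module k D]

/-- The product `(a ⊗ d) (a' ⊗ d') = a σ(d ⊗ a') d'` on `A ⊗ D`, that is,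
`(m_A ⊗ m_D) (A ⊗ σ ⊗ D)`, for a map `σ : D ⊗ A → A ⊗ D`. -/
noncomputable def twistedMul (mA : A ⊗[k] A →ₗ[k] A) (mD : D ⊗[k] D →ₗ[k] D)
    (σ : D ⊗[k] A →ₗ[k] A ⊗[k] D) : (A ⊗[k] D) ⊗[k] (A ⊗[k] D) →ₗ[k] A ⊗[k] D :=
  TensorProduct.map mA mD
    ∘ₗ (TensorProduct.assoc k A A (D ⊗[k] D)).symm.toLinearMap
    ∘ₗ ((TensorProduct.assoc k A D D).toLinearMap
        ∘ₗ σ.rTensor D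
        ∘ₗ (TensorProduct.assoc k D A D).symm.toLinearMap).lTensor A
    ∘ₗ (TensorProduct.assoc k A D (A ⊗[k] D)).toLinearMap

variable (B : Type*) [Ring B] [HopfAlgebra k B]

/-- The product `(m_A ⊗ m_D) (A ⊗ C_{D,A} ⊗ D)` of the tensor product `A ⊗ D` of two algebras
in the Yetter–Drinfeld category. -/
noncomputable def braidedTensorMul [YDStruct k B A] [YDStruct k B D]
    (mA : A ⊗[k] A →ₗ[k] A) (mD : D ⊗[k] D →ₗ[k] D) :
    (A ⊗[k] D) ⊗[k] (A ⊗[k] D) →ₗ[k] A ⊗[k] D :=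
  twistedMul mA mD (ydBraiding k B D A)

/-- The product `m` and the element `u` make `A` an associative unital `k`-algebra
in the Yetter–Drinfeld category. -/
structure IsYDAlgebra [YDStruct k B A] (m : A ⊗[k] A →ₗ[k] A) (u : A) : Prop where
  assoc : ∀ x y z : A, m (m (x ⊗ₜ y) ⊗ₜ z) = m (x ⊗ₜ m (y ⊗ₜ z))
  one_mul : ∀ x : A, m (u ⊗ₜ x) = x
  mul_one : ∀ x : A, m (x ⊗ₜ u) = x
  isYDHom_mul : IsYDHom k B m
  isYDHom_unit : IsYDHom k B (LinearMap.toSpanSingleton k A u)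

end Algebras

section Hopf

variable (k B : Type*) [Field k] [Ring B] [HopfAlgebra k B]

/-- Braided Hopf algebras in the category of Yetter–Drinfeld modules over `B`. -/
class BraidedHopfAlgebra (H : Type*) [Ring H] [Algebra k H] [Coalgebra k H]
    [YDModule k B H] where
  isYDAlgebra : IsYDAlgebra B (LinearMap.mul' k H) 1
  isYDHom_comul : IsYDHom k B (Coalgebra.comul (R := k) (A := H))
  isYDHom_counit : IsYDHom k B (Coalgebra.counit (R := k) (A := H))
  comul_one : Coalgebra.comul (R := k) (1 : H) = 1 ⊗ₜ 1
  comul_mul : ∀ x y : H, Coalgebra.comul (R := k) (x * y) =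
    braidedTensorMul B (LinearMap.mul' k H) (LinearMap.mul' k H)
      (Coalgebra.comul (R := k) x ⊗ₜ Coalgebra.comul (R := k) y)
  counit_one : Coalgebra.counit (R := k) (1 : H) = 1
  counit_mul : ∀ x y : H, Coalgebra.counit (R := k) (x * y) =
    Coalgebra.counit (R := k) x * Coalgebra.counit (R := k) y
  /-- The antipode `S`. -/
  antipode : H →ₗ[k] H
  isYDHom_antipode : IsYDHom k B antipode
  mul_antipode_rTensor_comul : LinearMap.mul' k H ∘ₗ antipode.rTensor H ∘ₗ
    Coalgebra.comul (R := k) (A := H) = Algebra.linearMap k H ∘ₗ Coalgebra.counit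
  mul_antipode_lTensor_comul : LinearMap.mul' k H ∘ₗ antipode.lTensor H ∘ₗ
    Coalgebra.comul (R := k) (A := H) = Algebra.linearMap k H ∘ₗ Coalgebra.counit

/-- The antipode of a braided Hopf algebra. -/
noncomputable def braidedAntipode (H : Type*) [Ring H] [Algebra k H] [Coalgebra k H]
    [YDModule k B H] [BraidedHopfAlgebra k B H] : H →ₗ[k] H :=
  BraidedHopfAlgebra.antipode (k := k) (B := B) (H := H)

section Smash

variable {k}
variable {H : Type*} [Ring H] [Algebra k H] [Coalgebra k H] [YDStruct k B H]
  {A : Type*} [AddCommMonoid A] [Module k A] [YDStruct k B A]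

/-- `(A, m, u)` is a left `H`-module algebra in the Yetter–Drinfeld category under `α`. -/
structure IsYDModuleAlgebra (m : A ⊗[k] A →ₗ[k] A) (u : A) (α : H ⊗[k] A →ₗ[k] A) : Prop where
  isYDAlgebra : IsYDAlgebra B m u
  isYDHom : IsYDHom k B α
  one_act : ∀ a : A, α (1 ⊗ₜ a) = a
  mul_act : ∀ (g h : H) (a : A), α ((g * h) ⊗ₜ a) = α (g ⊗ₜ α (h ⊗ₜ a))
  act_one : ∀ h : H, α (h ⊗ₜ u) = Coalgebra.counit (R := k) h • u
  act_mul : α ∘ₗ m.lTensor H = m ∘ₗ TensorProduct.map α α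
    ∘ₗ (TensorProduct.assoc k H A (H ⊗[k] A)).symm.toLinearMap
    ∘ₗ ((TensorProduct.assoc k A H A).toLinearMap
        ∘ₗ (ydBraiding k B H A).rTensor A
        ∘ₗ (TensorProduct.assoc k H A A).symm.toLinearMap).lTensor H
    ∘ₗ (TensorProduct.assoc k H H (A ⊗[k] A)).toLinearMap
    ∘ₗ (Coalgebra.comul (R := k) (A := H)).rTensor (A ⊗[k] A)

/-- The product of the smash product `A # H`:
`(m_A ⊗ m_H) (A ⊗ α ⊗ H ⊗ H) (A ⊗ H ⊗ C_{H,A} ⊗ H) (A ⊗ Δ ⊗ A ⊗ H)`. -/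
noncomputable def smashMul (mA : A ⊗[k] A →ₗ[k] A) (α : H ⊗[k] A →ₗ[k] A) :
    (A ⊗[k] H) ⊗[k] (A ⊗[k] H) →ₗ[k] A ⊗[k] H :=
  twistedMul mA (LinearMap.mul' k H)
    (α.rTensor H
      ∘ₗ (TensorProduct.assoc k H A H).symm.toLinearMap
      ∘ₗ (ydBraiding k B H A).lTensor H
      ∘ₗ (TensorProduct.assoc k H H A).toLinearMap
      ∘ₗ (Coalgebra.comul (R := k) (A := H)).rTensor A)

end Smash

section QuasiDual

variable {k}
variable {H H' R : Type*} [Ring H] [Algebra k H] [Coalgebra k H] [YDModule k B H]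
  [Ring H'] [Algebra k H'] [Coalgebra k H'] [YDModule k B H']

/-- The pairing `(p ⊗ p) (H' ⊗ C_{H',H} ⊗ H)` of two-fold tensors,
`(f ⊗ g) ⊗ (x ⊗ y) ↦ ∑ ⟨f, g₍₋₁₎ · x⟩ ⟨g₍₀₎, y⟩`. -/
noncomputable def pairTwo (p : H' ⊗[k] H →ₗ[k] k) :
    (H' ⊗[k] H') ⊗[k] (H ⊗[k] H) →ₗ[k] k :=
  LinearMap.mul' k k ∘ₗ TensorProduct.map p p
    ∘ₗ (TensorProduct.assoc k H' H (H' ⊗[k] H)).symm.toLinearMap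
    ∘ₗ ((TensorProduct.assoc k H H' H).toLinearMap
        ∘ₗ (ydBraiding k B H' H).rTensor H
        ∘ₗ (TensorProduct.assoc k H' H H).symm.toLinearMap).lTensor H'
    ∘ₗ (TensorProduct.assoc k H' H' (H ⊗[k] H)).toLinearMap

/-- `H'` is a quasi-dual of `H` under the pairing `p = ⟨ , ⟩ : H' ⊗ H → k`. -/
structure IsQuasiDual [BraidedHopfAlgebra k B H] [BraidedHopfAlgebra k B H']
    (p : H' ⊗[k] H →ₗ[k] k) : Prop where
  isYDHom : IsYDHom k B p
  pair_mul_right : ∀ (f : H') (x y : H), p (f ⊗ₜ (x * y)) =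
    pairTwo B p (Coalgebra.comul (R := k) f ⊗ₜ (x ⊗ₜ y))
  pair_one_right : ∀ f : H', p (f ⊗ₜ 1) = Coalgebra.counit (R := k) f
  pair_mul_left : ∀ (f g : H') (x : H), p ((f * g) ⊗ₜ x) =
    pairTwo B p ((f ⊗ₜ g) ⊗ₜ Coalgebra.comul (R := k) x)
  pair_one_left : ∀ x : H, p (1 ⊗ₜ x) = Coalgebra.counit (R := k) x
  pair_antipode : ∀ (f : H') (x : H),
    p (braidedAntipode k B H' f ⊗ₜ x) = p (f ⊗ₜ braidedAntipode k B H x)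

/-- The pairing is compatible with the structures over `B`: `⟨b · f, x⟩ = ⟨f, S(b) · x⟩`, and
`∑ ⟨f₍₀₎, x⟩ f₍₋₁₎ = ∑ ⟨f, x₍₀₎⟩ S⁻¹(x₍₋₁₎)`; the latter is written with the antipode `S` of `B`
(bijective when `B` is finite-dimensional) moved to the other side. -/
structure IsCompatiblePairing (p : H' ⊗[k] H →ₗ[k] k) : Prop where
  act : ∀ (b : B) (f : H') (x : H),
    p (ydAct k B H' (b ⊗ₜ f) ⊗ₜ x) = p (f ⊗ₜ ydAct k B H (HopfAlgebra.antipode k b ⊗ₜ x))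
  coact : ∀ (f : H') (x : H),
    HopfAlgebra.antipode k
      (TensorProduct.rid k B ((p ∘ₗ (TensorProduct.mk k H' H).flip x).lTensor B
        (ydCoact k B H' f))) =
    TensorProduct.rid k B ((p ∘ₗ TensorProduct.mk k H' H f).lTensor B (ydCoact k B H x))

/-- `⟨f, H⟩ = 0` implies `f = 0`. -/
def IsLeftFaithful (p : H' ⊗[k] H →ₗ[k] k) : Prop :=
  ∀ f : H', (∀ x : H, p (f ⊗ₜ x) = 0) → f = 0

/-- The action `⇀ = (H ⊗ ⟨ , ⟩) (C_{H',H} ⊗ H) (H' ⊗ Δ)` of `H'` on `H`. -/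
noncomputable def dualAct (p : H' ⊗[k] H →ₗ[k] k) : H' ⊗[k] H →ₗ[k] H :=
  (TensorProduct.rid k H).toLinearMap
    ∘ₗ p.lTensor H
    ∘ₗ (TensorProduct.assoc k H H' H).toLinearMap
    ∘ₗ (ydBraiding k B H' H).rTensor H
    ∘ₗ (TensorProduct.assoc k H' H H).symm.toLinearMap
    ∘ₗ (Coalgebra.comul (R := k) (A := H)).lTensor H'

/-- `λ : H # H' → End H`, `λ(h # f)(x) = h (f ⇀ x)`, that is, the map corresponding to
`(m ⊗ ⟨ , ⟩) (H ⊗ C_{H',H} ⊗ H) (H ⊗ H' ⊗ Δ)`. -/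
noncomputable def lamMap (p : H' ⊗[k] H →ₗ[k] k) : H ⊗[k] H' →ₗ[k] Module.End k H :=
  TensorProduct.curry
    (LinearMap.mul' k H ∘ₗ (dualAct B p).lTensor H ∘ₗ (TensorProduct.assoc k H H' H).toLinearMap)

/-- `ρ : H' # H → End H`, the map corresponding to
`(⟨ , ⟩ ⊗ m) (H' ⊗ H ⊗ C_{H,H}) (H' ⊗ C_{H,H} ⊗ H) (H' ⊗ H ⊗ Δ)`. -/
noncomputable def rhoMap (p : H' ⊗[k] H →ₗ[k] k) : H' ⊗[k] H →ₗ[k] Module.End k H :=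
  TensorProduct.curry
    ((TensorProduct.lid k H).toLinearMap
      ∘ₗ TensorProduct.map p (LinearMap.mul' k H)
      ∘ₗ (TensorProduct.assoc k H' H (H ⊗[k] H)).symm.toLinearMap
      ∘ₗ ((ydBraiding k B H H).lTensor H
          ∘ₗ (TensorProduct.assoc k H H H).toLinearMap
          ∘ₗ (ydBraiding k B H H).rTensor H
          ∘ₗ (TensorProduct.assoc k H H H).symm.toLinearMap
          ∘ₗ (Coalgebra.comul (R := k) (A := H)).lTensor H).lTensor H'
      ∘ₗ (TensorProduct.assoc k H' H H).toLinearMap)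

/-- The `RL`-condition: `ρ(H' # 1) ⊆ λ(H # H')`. -/
def RLCondition (p : H' ⊗[k] H →ₗ[k] k) : Prop :=
  ∀ f : H', rhoMap B p (f ⊗ₜ 1) ∈ LinearMap.range (lamMap B p)

variable [Ring R] [Algebra k R] [YDModule k B R]

/-- `R` is a right `H'`-comodule algebra in the Yetter–Drinfeld category under
`ψ : R → R ⊗ H'`. -/
structure IsYDComoduleAlgebra (ψ : R →ₗ[k] R ⊗[k] H') : Prop where
  isYDAlgebra : IsYDAlgebra B (LinearMap.mul' k R) 1
  isYDHom : IsYDHom k B ψ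
  counit : (TensorProduct.rid k R).toLinearMap
    ∘ₗ (Coalgebra.counit (R := k) (A := H')).lTensor R ∘ₗ ψ = LinearMap.id
  coassoc : (TensorProduct.assoc k R H' H').toLinearMap ∘ₗ ψ.rTensor H' ∘ₗ ψ =
    (Coalgebra.comul (R := k) (A := H')).lTensor R ∘ₗ ψ
  map_one : ψ 1 = 1 ⊗ₜ 1
  map_mul : ∀ r s : R, ψ (r * s) =
    braidedTensorMul B (LinearMap.mul' k R) (LinearMap.mul' k H') (ψ r ⊗ₜ ψ s)

/-- The action `α = (R ⊗ ⟨ , ⟩) (R ⊗ C_{H,H'}) (C_{H,R} ⊗ H') (H ⊗ ψ)` of `H` on an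
`H'`-comodule algebra `R`. -/
noncomputable def coactToAct (p : H' ⊗[k] H →ₗ[k] k) (ψ : R →ₗ[k] R ⊗[k] H') :
    H ⊗[k] R →ₗ[k] R :=
  (TensorProduct.rid k R).toLinearMap
    ∘ₗ (p ∘ₗ ydBraiding k B H H').lTensor R
    ∘ₗ (TensorProduct.assoc k R H H').toLinearMap
    ∘ₗ (ydBraiding k B H R).rTensor H'
    ∘ₗ (TensorProduct.assoc k H R H').symm.toLinearMap
    ∘ₗ ψ.lTensor H

variable (R) in
/-- The action `(R ⊗ ⇀) (C_{H',R} ⊗ H)` of `H'` on `R # H`: trivial on `R`, and `⇀` on `H`. -/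
noncomputable def dualActSmash (p : H' ⊗[k] H →ₗ[k] k) :
    H' ⊗[k] (R ⊗[k] H) →ₗ[k] R ⊗[k] H :=
  (dualAct B p).lTensor R
    ∘ₗ (TensorProduct.assoc k R H' H).toLinearMap
    ∘ₗ (ydBraiding k B H' R).rTensor H
    ∘ₗ (TensorProduct.assoc k H' R H).symm.toLinearMap

/-- The product of `R # H`. -/
noncomputable def smashOneMul (p : H' ⊗[k] H →ₗ[k] k) (ψ : R →ₗ[k] R ⊗[k] H') :
    (R ⊗[k] H) ⊗[k] (R ⊗[k] H) →ₗ[k] R ⊗[k] H :=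
  smashMul B (LinearMap.mul' k R) (coactToAct B p ψ)

/-- The product of `(R # H) # H'`. -/
noncomputable def smashTwoMul (p : H' ⊗[k] H →ₗ[k] k) (ψ : R →ₗ[k] R ⊗[k] H') :
    ((R ⊗[k] H) ⊗[k] H') ⊗[k] ((R ⊗[k] H) ⊗[k] H') →ₗ[k] (R ⊗[k] H) ⊗[k] H' :=
  smashMul B (smashOneMul B p ψ) (dualActSmash B R p)

variable (R) in
/-- The product of `R ⊗ (H # H')`. -/
noncomputable def tensorSmashMul (p : H' ⊗[k] H →ₗ[k] k) :
    (R ⊗[k] (H ⊗[k] H')) ⊗[k] (R ⊗[k] (H ⊗[k] H')) →ₗ[k] R ⊗[k] (H ⊗[k] H') :=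
  braidedTensorMul B (LinearMap.mul' k R) (smashMul B (LinearMap.mul' k H) (dualAct B p))

end QuasiDual

end Hopf

/-!
Write `F` for `H^d` and `C` for the braiding. The proof compares two algebras by faithful
representations on `R ⊗ H`.

The smash product `H # F` acts on `H` by `λ(h ⊗ f)(x) = h (f ⇀ x)`. This representation is faithful
(`lamAct_faithful`): with `∑ y ⊗ z = C(S⁻¹(x₁) ⊗ x₂)` one has `∑ λ(h ⊗ f)(y) z = ⟨f, x⟩ h`
(`pairAct_word`), and the pairing is left faithful. On the other side there are the operators
`ρ_u(x) = ∑ ⟨u, x₁⟩ x₂`. Up to the braiding, `u ↦ ρ_u` is antimultiplicative (`rightAct_mul`),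
`ρ_u` commutes with the action of `F` (`rightAct_dualAct`) and acts on products through the coproduct
of `u` (`mul_rightAct'`). Moreover `ρ` has a convolution inverse `ρ'`, given by the pairing
`⟨u, S⁻¹(x)⟩` (`rightAct_inv_left`, `rightAct_inv_right`).

By the `RL`-condition and faithfulness of `λ`, the families `ρ` and `ρ'` lift to linear maps
`w, w' : F → H # F`, which are morphisms in the Yetter–Drinfeld category (`exists_lift_lamAct`).
Linearity over `B` follows from faithfulness of `λ`. For colinearity one needs that an element of
`B ⊗ (H ⊗ F)` is determined by its action on `H` twisted by the coaction of `H`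
(`eq_of_coactShift_lamAct`); this is where the compatibility of the pairing with the coactions enters.

The isomorphism is `Φ((r ⊗ h) ⊗ f) = ∑ r₍₀₎ ⊗ w'(r₍₁₎) (h ⊗ f)`, with inverse given by `w`; as a
composite of morphisms it is a morphism. It is multiplicative for the following reason. The algebra
`(R # H) # F` acts on `R # H`, the algebra `R ⊗ (H # F)` acts faithfully on `R ⊗ H`
(`tensorRep_faithful`), and the bijection `Θ(r ⊗ x) = ∑ r₍₀₎ ⊗ ρ_{r₍₁₎}(x)` satisfies
`Θ(Φ(a) · z) = a · Θ(z)` (`coactMap_tensorRep`).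

The symmetry `C_{H,H} = C_{H,H}⁻¹` passes to `H` and `F` by faithfulness of the pairing: `C_{H,F}` and
`C_{F,H}` are inverse to each other (`symm_left`, `symm_right`). All further identities are identities
of string diagrams. They are proved in a calculus of words, which act on multilinear maps by
precomposition: each letter is one of the structure maps, on some of the strands. Letters on disjoint
strands commute (by `simp`), morphisms slide through crossings (`braid_o21`, `o21_braid`, …), and an
identity of words can be applied at any position (`wh22`, …).
-/

namespace YD

/-! ### Precomposition of multilinear maps -/

section Words

variable {k : Type*} [Field k]
variable {V W X Y Z Z' U : Type*}
  {_ : AddCommMonoid V} {_ : Module k V} {_ : AddCommMonoid W} {_ : Module k W}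
  {_ : AddCommMonoid X} {_ : Module k X} {_ : AddCommMonoid Y} {_ : Module k Y}
  {_ : AddCommMonoid Z} {_ : Module k Z} {_ : AddCommMonoid Z'} {_ : Module k Z'}

theorem lift_add (γ γ' : X →ₗ[k] Y →ₗ[k] Z) (t : X ⊗[k] Y) :
    TensorProduct.lift (γ + γ') t = TensorProduct.lift γ t + TensorProduct.lift γ' t :=
  DFunLike.congr_fun (map_add (TensorProduct.uncurry (.id k) X Y Z) γ γ') t

theorem lift_smul (c : k) (γ : X →ₗ[k] Y →ₗ[k] Z) (t : X ⊗[k] Y) :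
    TensorProduct.lift (c • γ) t = c • TensorProduct.lift γ t :=
  DFunLike.congr_fun (map_smul (TensorProduct.uncurry (.id k) X Y Z) c γ) t

@[simp] theorem lift_zero (t : X ⊗[k] Y) :
    TensorProduct.lift (0 : X →ₗ[k] Y →ₗ[k] Z) t = 0 :=
  DFunLike.congr_fun (map_zero (TensorProduct.uncurry (.id k) X Y Z)) t

/-- Precomposition of a bilinear map with `f`. In the names `pull22`, `pull21`, …, `pull01`, the
digits are the numbers of tensor factors in the source and the target of the map. -/
noncomputable def pull22 (f : V ⊗[k] W →ₗ[k] X ⊗[k] Y) :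
    (X →ₗ[k] Y →ₗ[k] Z) →ₗ[k] V →ₗ[k] W →ₗ[k] Z where
  toFun γ := TensorProduct.curry (TensorProduct.lift γ ∘ₗ f)
  map_add' γ γ' := by ext; simp [lift_add]
  map_smul' c γ := by ext; simp [lift_smul]

/-- Precomposition of a linear map with a bilinear operation. -/
noncomputable def pull21 (f : V ⊗[k] W →ₗ[k] X) : (X →ₗ[k] Z) →ₗ[k] V →ₗ[k] W →ₗ[k] Z where
  toFun γ := TensorProduct.curry (γ ∘ₗ f)
  map_add' γ γ' := by ext; simp
  map_smul' c γ := by ext; simp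

/-- Precomposition of a bilinear map with a map to a tensor product. -/
noncomputable def pull12 (f : V →ₗ[k] X ⊗[k] Y) : (X →ₗ[k] Y →ₗ[k] Z) →ₗ[k] V →ₗ[k] Z where
  toFun γ := TensorProduct.lift γ ∘ₗ f
  map_add' γ γ' := by ext; simp [lift_add]
  map_smul' c γ := by ext; simp [lift_smul]

/-- Two new arguments, which only enter through the scalar `p(v ⊗ w)`. -/
noncomputable def pull20 (p : V ⊗[k] W →ₗ[k] k) : Z →ₗ[k] V →ₗ[k] W →ₗ[k] Z where
  toFun z := TensorProduct.curry (p.smulRight z)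
  map_add' γ γ' := by ext; simp
  map_smul' c γ := by ext; exact smul_comm _ _ _

/-- Precomposition of a linear map with a linear map. -/
noncomputable def pull11 (f : V →ₗ[k] X) : (X →ₗ[k] Z) →ₗ[k] V →ₗ[k] Z := LinearMap.lcomp k Z f

/-- A new argument, which only enters through the scalar `e(v)`. -/
noncomputable def pull10 (e : V →ₗ[k] k) : Z →ₗ[k] V →ₗ[k] Z where
  toFun z := e.smulRight z
  map_add' γ γ' := by ext; simp
  map_smul' c γ := by ext; exact smul_comm _ _ _

/-- Evaluation at the fixed element `u`. -/
noncomputable def pull01 (k : Type*) [Field k] {X Z : Type*} {_ : AddCommMonoid X} {_ : Module k X}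
    {_ : AddCommMonoid Z} {_ : Module k Z} (u : X) : (X →ₗ[k] Z) →ₗ[k] Z := LinearMap.applyₗ u

/-- An operation `d` applied after the first argument is fixed. -/
noncomputable def under (d : Z →ₗ[k] Z') : (V →ₗ[k] Z) →ₗ[k] V →ₗ[k] Z' := LinearMap.compRight k d

/-- The exchange of the first two arguments. -/
noncomputable def tw : (W →ₗ[k] V →ₗ[k] Z) →ₗ[k] V →ₗ[k] W →ₗ[k] Z where
  toFun γ := γ.flip
  map_add' _ _ := rfl
  map_smul' _ _ := rfl

@[simp] theorem tw_apply (γ : W →ₗ[k] V →ₗ[k] Z) (v : V) (w : W) : tw γ v w = γ w v := rfl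
@[simp] theorem pull22_apply (f : V ⊗[k] W →ₗ[k] X ⊗[k] Y) (γ : X →ₗ[k] Y →ₗ[k] Z) (v : V) (w : W) :
    pull22 f γ v w = TensorProduct.lift γ (f (v ⊗ₜ w)) := rfl
@[simp] theorem pull21_apply (f : V ⊗[k] W →ₗ[k] X) (γ : X →ₗ[k] Z) (v : V) (w : W) :
    pull21 f γ v w = γ (f (v ⊗ₜ w)) := rfl
@[simp] theorem pull12_apply (f : V →ₗ[k] X ⊗[k] Y) (γ : X →ₗ[k] Y →ₗ[k] Z) (v : V) :
    pull12 f γ v = TensorProduct.lift γ (f v) := rfl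
@[simp] theorem pull20_apply (f : V ⊗[k] W →ₗ[k] k) (γ : Z) (v : V) (w : W) :
    pull20 f γ v w = f (v ⊗ₜ w) • γ := rfl
@[simp] theorem pull11_apply (f : V →ₗ[k] X) (γ : X →ₗ[k] Z) (v : V) : pull11 f γ v = γ (f v) := rfl
@[simp] theorem pull10_apply (f : V →ₗ[k] k) (γ : Z) (v : V) : pull10 f γ v = f v • γ := rfl
@[simp] theorem pull01_apply (u : X) (γ : X →ₗ[k] Z) : pull01 k u γ = γ u := rfl
@[simp] theorem under_apply (d : Z →ₗ[k] Z') (γ : V →ₗ[k] Z) (v : V) : under d γ v = d (γ v) := rfl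

theorem lift_comp (d : Z →ₗ[k] Z') (γ : X →ₗ[k] Y →ₗ[k] Z) (t : X ⊗[k] Y) :
    TensorProduct.lift (under (under d) γ) t = d (TensorProduct.lift γ t) := by
  induction t with
  | zero => simp
  | tmul x y => simp
  | add x y hx hy => simp [hx, hy]

theorem pull22_under (f : V ⊗[k] W →ₗ[k] X ⊗[k] Y) (d : Z →ₗ[k] Z') (γ : X →ₗ[k] Y →ₗ[k] Z) :
    pull22 f (under (under d) γ) = under (under d) (pull22 f γ) := by
  ext v w; exact lift_comp d γ _
theorem pull12_under (f : V →ₗ[k] X ⊗[k] Y) (d : Z →ₗ[k] Z') (γ : X →ₗ[k] Y →ₗ[k] Z) :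
    pull12 f (under (under d) γ) = under d (pull12 f γ) := by
  ext v; exact lift_comp d γ _
theorem pull20_under (f : V ⊗[k] W →ₗ[k] k) (d : Z →ₗ[k] Z') (γ : Z) :
    pull20 f (d γ) = under (under d) (pull20 f γ) := by ext; simp
theorem pull10_under (f : V →ₗ[k] k) (d : Z →ₗ[k] Z') (γ : Z) :
    pull10 f (d γ) = under d (pull10 f γ) := by ext; simp
/-- Two elements of a tensor product agree as soon as all bilinear maps agree on them. -/
theorem eq_of_lift {s t : X ⊗[k] Y}
    (h : TensorProduct.lift (TensorProduct.mk k X Y) s =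
      TensorProduct.lift (TensorProduct.mk k X Y) t) : s = t := by
  rwa [TensorProduct.lift_mk] at h

end Words

/-! ### Modules with a coaction and the hexagon identities -/

section Act

variable (k B : Type*) [Field k] [Ring B] [HopfAlgebra k B]

/-- The module and comodule axioms, without the compatibility of the action and the coaction. These
are all that naturality of the braiding and the hexagon identities need, and they are inherited by
tensor products; the compatibility is only used for the braiding to be a morphism. -/
class IsModuleComodule (V : Type*) [AddCommMonoid V] [Module k V] [YDStruct k B V] : Prop where
  one_act : ∀ v : V, YDStruct.act (k := k) (1 : B) v = v
  mul_act : ∀ (a b : B) (v : V), YDStruct.act (k := k) (a * b) v =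
    YDStruct.act (k := k) a (YDStruct.act (k := k) b v)
  counit_coact : (TensorProduct.lid k V).toLinearMap
    ∘ₗ (Coalgebra.counit (R := k) (A := B)).rTensor V ∘ₗ ydCoact k B V = LinearMap.id
  coassoc_coact : (TensorProduct.assoc k B B V).toLinearMap
    ∘ₗ (Coalgebra.comul (R := k) (A := B)).rTensor V ∘ₗ ydCoact k B V =
      (ydCoact k B V).lTensor B ∘ₗ ydCoact k B V

instance (V : Type*) [AddCommMonoid V] [Module k V] [h : YDModule k B V] :
    IsModuleComodule k B V where
  one_act v := by rw [h.one_act]; rfl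
  mul_act a b v := by rw [h.mul_act]; rfl
  counit_coact := h.counit_coact
  coassoc_coact := h.coassoc_coact

instance : IsModuleComodule k B k where
  one_act v := by simp [YDStruct.act]
  mul_act a b v := by simp [YDStruct.act, mul_assoc]
  counit_coact := by ext; simp [ydCoact, YDStruct.coact]
  coassoc_coact := by ext; simp [ydCoact, YDStruct.coact, Algebra.TensorProduct.one_def]

variable {k B}
variable {V W X Y Z Z' U : Type*} [AddCommMonoid V] [Module k V] [AddCommMonoid W] [Module k W]
  [AddCommMonoid X] [Module k X] [AddCommMonoid Y] [Module k Y] [AddCommMonoid Z] [Module k Z]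
  [AddCommMonoid Z'] [Module k Z'] [AddCommMonoid U] [Module k U]
  [YDStruct k B V] [YDStruct k B W] [YDStruct k B X] [YDStruct k B Y] [YDStruct k B U]

local notation "χ" => pull22 (ydBraiding k B _ _)
local notation "actB" => YDStruct.act (k := k) (B := B)

@[simp] theorem ydAct_tmul (b : B) (v : V) : ydAct k B V (b ⊗ₜ v) = actB b v := rfl

theorem act_tensor (b : B) (v : V) (w : W) : actB b (v ⊗ₜ[k] w) =
    TensorProduct.map (YDStruct.act.flip v) (YDStruct.act.flip w)
      (Coalgebra.comul (R := k) b) := by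
  have : actB b (v ⊗ₜ[k] w) = TensorProduct.homTensorHomMap (RingHom.id k) V W V W
    (TensorProduct.map (YDStruct.act (k := k) (B := B) (V := V))
      (YDStruct.act (k := k) (B := B) (V := W)) (Coalgebra.comul (R := k) b)) (v ⊗ₜ w) := rfl
  rw [this]
  induction Coalgebra.comul (R := k) b with
  | zero => simp
  | tmul x y => simp
  | add x y hx hy => simp only [map_add, LinearMap.add_apply, hx, hy]

theorem coact_tensor (v : V) (w : W) : ydCoact k B (V ⊗[k] W) (v ⊗ₜ w) =
    (LinearMap.mul' k B).rTensor (V ⊗[k] W) (TensorProduct.tensorTensorTensorComm k B V B W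
      (ydCoact k B V v ⊗ₜ ydCoact k B W w)) := rfl

/-- `C(v ⊗ w) = ∑ v₍₋₁₎ · w ⊗ v₍₀₎`, evaluated by a bilinear map `γ`. -/
theorem braid_apply (γ : W →ₗ[k] V →ₗ[k] Z) (v : V) (w : W) :
    TensorProduct.lift γ (ydBraiding k B V W (v ⊗ₜ w)) =
      TensorProduct.lift (γ ∘ₗ YDStruct.act.flip w) (ydCoact k B V v) := by
  simp only [ydBraiding, LinearMap.comp_apply, LinearMap.rTensor_tmul]
  induction ydCoact k B V v with
  | zero => simp
  | tmul x y => simp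
  | add x y hx hy => simp only [TensorProduct.add_tmul, map_add, hx, hy]

/-- Coassociativity of the coaction, in terms of trilinear maps. -/
theorem coassoc_apply [IsModuleComodule k B V] (γ : B →ₗ[k] B →ₗ[k] V →ₗ[k] Z) :
    pull12 (ydCoact k B V) (pull12 (Coalgebra.comul (R := k) (A := B)) γ) =
      pull12 (ydCoact k B V) (under (pull12 (ydCoact k B V)) γ) := by
  ext v
  have := congrArg (TensorProduct.lift (under (TensorProduct.uncurry (.id k) B V Z) γ))
    (DFunLike.congr_fun (IsModuleComodule.coassoc_coact (k := k) (B := B) (V := V)) v)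
  simp only [LinearMap.comp_apply] at this
  simp only [pull12_apply]
  convert this using 1
  · induction ydCoact k B V v with
    | zero => simp
    | tmul x y =>
      simp only [TensorProduct.lift.tmul, pull12_apply, LinearMap.rTensor_tmul]
      induction Coalgebra.comul (R := k) x with
      | zero => simp
      | tmul x y => simp
      | add x y hx hy => simp only [TensorProduct.add_tmul, map_add, hx, hy, LinearMap.add_apply]
    | add x y hx hy => simp only [map_add, hx, hy]
  · induction ydCoact k B V v with
    | zero => simp
    | tmul x y => simp; rfl
    | add x y hx hy => simp only [map_add, hx, hy]

/-- Counitality of the coaction, in terms of linear maps. -/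
theorem counit_apply [IsModuleComodule k B V] (γ : V →ₗ[k] Z) :
    pull12 (ydCoact k B V) (pull10 (Coalgebra.counit (R := k) (A := B)) γ) = γ := by
  ext v
  have := congrArg γ
    (DFunLike.congr_fun (IsModuleComodule.counit_coact (k := k) (B := B) (V := V)) v)
  simp only [LinearMap.comp_apply, LinearMap.id_apply] at this
  rw [← this, pull12_apply]
  induction ydCoact k B V v with
  | zero => simp
  | tmul x y => simp
  | add x y hx hy => simp only [map_add, hx, hy]

/-- `C_{V ⊗ W, U}` is `C_{V, U}` after `C_{W, U}`. -/
theorem hexagon_over [IsModuleComodule k B U] (γ : U →ₗ[k] V →ₗ[k] W →ₗ[k] Z) (v : V) (w : W)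
    (u : U) :
    χ (under (TensorProduct.uncurry (.id k) V W Z) γ) (v ⊗ₜ[k] w) u = under χ (χ γ) v w u := by
  simp only [pull22_apply, under_apply, braid_apply, coact_tensor]
  induction ydCoact k B W w with
  | zero => simp
  | tmul x y =>
    simp only [TensorProduct.lift.tmul, LinearMap.comp_apply, pull22_apply, braid_apply]
    induction ydCoact k B V v with
    | zero => simp
    | tmul x' y' => simp [IsModuleComodule.mul_act]
    | add x y hx hy => simp only [TensorProduct.add_tmul, map_add, hx, hy, LinearMap.add_apply]
  | add x y hx hy => simp only [TensorProduct.tmul_add, map_add, hx, hy]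

/-- `C_{V, W ⊗ U}` is `C_{V, U}` after `C_{V, W}`. -/
theorem hexagon_under [IsModuleComodule k B V] (γ : W →ₗ[k] U →ₗ[k] V →ₗ[k] Z) (v : V) (w : W)
    (u : U) : χ (TensorProduct.lift γ) v (w ⊗ₜ[k] u) = χ (under χ γ) v w u := by
  have h := DFunLike.congr_fun (coassoc_apply (k := k) (B := B) (V := V)
    (under (pull11 (YDStruct.act.flip u)) (pull11 (YDStruct.act.flip w) γ))) v
  simp only [pull22_apply, braid_apply, pull12_apply] at h ⊢
  convert h using 1
  · induction ydCoact k B V v with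
    | zero => simp
    | tmul x y =>
      simp only [TensorProduct.lift.tmul, LinearMap.comp_apply, LinearMap.flip_apply, act_tensor,
        pull12_apply]
      induction Coalgebra.comul (R := k) x with
      | zero => simp
      | tmul x' y' => simp
      | add x y hx hy => simp only [map_add, LinearMap.add_apply, hx, hy]
    | add x y hx hy => simp only [map_add, hx, hy]
  · induction ydCoact k B V v with
    | zero => simp
    | tmul x y =>
      simp only [TensorProduct.lift.tmul, LinearMap.comp_apply, LinearMap.flip_apply, under_apply,
        pull12_apply, pull11_apply, pull22_apply, braid_apply]
      rfl
    | add x y hx hy => simp only [map_add, LinearMap.add_apply, hx, hy]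

instance [IsModuleComodule k B V] [IsModuleComodule k B W] : IsModuleComodule k B (V ⊗[k] W) where
  one_act t := by
    induction t with
    | zero => simp
    | tmul v w => simp [act_tensor, Algebra.TensorProduct.one_def, IsModuleComodule.one_act]
    | add x y hx hy => simp only [map_add, hx, hy]
  mul_act a b t := by
    induction t with
    | zero => simp
    | tmul v w =>
      simp only [act_tensor, Bialgebra.comul_mul]
      induction Coalgebra.comul (R := k) b with
      | zero => simp
      | tmul x y =>
        simp only [TensorProduct.map_tmul, act_tensor, LinearMap.flip_apply]
        induction Coalgebra.comul (R := k) a with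
        | zero => simp
        | tmul x y => simp [IsModuleComodule.mul_act]
        | add x y hx hy => simp only [map_add, add_mul, hx, hy]
      | add x y hx hy => simp only [map_add, mul_add, hx, hy]
    | add x y hx hy => simp only [map_add, hx, hy]
  counit_coact := by
    ext v w
    simp only [TensorProduct.AlgebraTensorModule.curry_apply, LinearMap.restrictScalars_self,
      TensorProduct.curry_apply, LinearMap.comp_apply, coact_tensor, LinearMap.id_apply]
    nth_rw 2 [← LinearMap.id_apply (R := k) v, ← LinearMap.id_apply (R := k) w]
    rw [← IsModuleComodule.counit_coact (B := B) (V := V),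
      ← IsModuleComodule.counit_coact (B := B) (V := W)]
    simp only [LinearMap.comp_apply]
    induction ydCoact k B W w with
    | zero => simp
    | tmul x y =>
      induction ydCoact k B V v with
      | zero => simp
      | tmul x' y' =>
        simp [TensorProduct.smul_tmul, TensorProduct.tmul_smul, mul_smul,
          smul_comm (Coalgebra.counit x)]
      | add x y hx hy => simp only [map_add, TensorProduct.add_tmul, hx, hy]
    | add x y hx hy => simp only [map_add, TensorProduct.tmul_add, hx, hy]
  coassoc_coact := by
    ext v w
    let M : (B ⊗[k] (B ⊗[k] V)) ⊗[k] (B ⊗[k] (B ⊗[k] W)) →ₗ[k] B ⊗[k] (B ⊗[k] (V ⊗[k] W)) :=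
      TensorProduct.map (LinearMap.mul' k B) ((LinearMap.mul' k B).rTensor (V ⊗[k] W) ∘ₗ
        (TensorProduct.tensorTensorTensorComm k B V B W).toLinearMap) ∘ₗ
        (TensorProduct.tensorTensorTensorComm k B (B ⊗[k] V) B (B ⊗[k] W)).toLinearMap
    have hv := DFunLike.congr_fun (IsModuleComodule.coassoc_coact (k := k) (B := B) (V := V)) v
    have hw := DFunLike.congr_fun (IsModuleComodule.coassoc_coact (k := k) (B := B) (V := W)) w
    simp only [LinearMap.comp_apply] at hv hw
    have h := congrArg₂ (fun x y => M (x ⊗ₜ[k] y)) hv hw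
    simp only [TensorProduct.AlgebraTensorModule.curry_apply, LinearMap.restrictScalars_self,
      TensorProduct.curry_apply, LinearMap.comp_apply, coact_tensor]
    convert h using 1
    · induction ydCoact k B W w with
      | zero => simp
      | tmul y w =>
        induction ydCoact k B V v with
        | zero => simp
        | tmul x v =>
          simp only [LinearEquiv.coe_coe, TensorProduct.tensorTensorTensorComm_tmul,
            LinearMap.rTensor_tmul, LinearMap.mul'_apply, Bialgebra.comul_mul]
          induction Coalgebra.comul (R := k) y with
          | zero => simp
          | tmul a b =>
            induction Coalgebra.comul (R := k) x with
            | zero => simp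
            | tmul c d => simp [M]
            | add x y hx hy => simp only [map_add, TensorProduct.add_tmul, add_mul, hx, hy]
          | add x y hx hy =>
            simp only [map_add, TensorProduct.add_tmul, TensorProduct.tmul_add, mul_add, hx, hy]
        | add x y hx hy => simp only [map_add, TensorProduct.add_tmul, hx, hy]
      | add x y hx hy => simp only [map_add, TensorProduct.tmul_add, hx, hy]
    · induction ydCoact k B W w with
      | zero => simp
      | tmul y w =>
        induction ydCoact k B V v with
        | zero => simp
        | tmul x v =>
          simp only [TensorProduct.tensorTensorTensorComm_tmul,
            LinearMap.rTensor_tmul, LinearMap.lTensor_tmul, LinearMap.mul'_apply, coact_tensor]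
          induction ydCoact k B W w with
          | zero => simp
          | tmul x y =>
            induction ydCoact k B V v with
            | zero => simp
            | tmul x y => simp [M]
            | add x y hx hy =>
              simp only [map_add, TensorProduct.add_tmul, TensorProduct.tmul_add, hx, hy]
          | add x y hx hy => simp only [map_add, TensorProduct.tmul_add, hx, hy]
        | add x y hx hy => simp only [map_add, TensorProduct.add_tmul, hx, hy]
      | add x y hx hy => simp only [map_add, TensorProduct.tmul_add, hx, hy]

end Act

/-! ### Naturality of the braiding -/

section Naturality

variable {k B : Type*} [Field k] [Ring B] [HopfAlgebra k B]
variable {V P Q X Y Z : Type*} [AddCommMonoid V] [Module k V] [AddCommMonoid P] [Module k P]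
  [AddCommMonoid X] [Module k X] [AddCommMonoid Y] [Module k Y]
  {_ : AddCommMonoid Z} {_ : Module k Z} [AddCommMonoid Q] [Module k Q]
  [YDStruct k B V] [YDStruct k B P] [YDStruct k B X] [YDStruct k B Y] [YDStruct k B Q]

local notation "χ" => pull22 (ydBraiding k B _ _)
local notation "actB" => YDStruct.act (k := k) (B := B)

theorem _root_.IsYDHom.map_act {f : X →ₗ[k] Y} (hf : IsYDHom k B f) (b : B) (x : X) :
    f (actB b x) = actB b (f x) := DFunLike.congr_fun hf.act (b ⊗ₜ x)

theorem _root_.IsYDHom.map_coact {f : X →ₗ[k] Y} (hf : IsYDHom k B f) (x : X) :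
    ydCoact k B Y (f x) = f.lTensor B (ydCoact k B X x) := DFunLike.congr_fun hf.coact.symm x

theorem isYDHom_of {f : X →ₗ[k] Y} (h : ∀ (b : B) (x : X), f (actB b x) = actB b (f x))
    (h' : ∀ x, ydCoact k B Y (f x) = f.lTensor B (ydCoact k B X x)) : IsYDHom k B f where
  act := by ext b x; exact h b x
  coact := by ext x; exact (h' x).symm

theorem braid_under {f : X →ₗ[k] Y} (hf : IsYDHom k B f) (γ : Y →ₗ[k] V →ₗ[k] Z) (v : V) (x : X) :
    χ γ v (f x) = χ (γ ∘ₗ f) v x := by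
  simp only [pull22_apply, braid_apply]
  congr 2
  ext b v
  simp [hf.map_act]

theorem braid_over {f : X →ₗ[k] Y} (hf : IsYDHom k B f) (γ : V →ₗ[k] Y →ₗ[k] Z) (v : V) (x : X) :
    χ γ (f x) v = χ (under (pull11 f) γ) x v := by
  simp only [pull22_apply, braid_apply, hf.map_coact]
  induction ydCoact k B X x with
  | zero => simp
  | tmul x y => simp
  | add x y hx hy => simp only [map_add, hx, hy]

/-- The braiding is natural in the argument that passes under: a morphism `f` can be applied before
or after `V` has passed. The lemmas `braid_pull21`, …, `braid_pull01` say the same for morphisms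
with other numbers of tensor factors. -/
theorem braid_pull11 {f : X →ₗ[k] Y} (hf : IsYDHom k B f) (γ : Y →ₗ[k] V →ₗ[k] Z) :
    χ (pull11 f γ) = under (pull11 f) (χ γ) := by
  ext v x; exact (braid_under hf γ v x).symm

/-- The braiding is natural in the argument that passes over; likewise for `pull21_braid`, …,
`pull01_braid`. -/
theorem pull11_braid {f : X →ₗ[k] Y} (hf : IsYDHom k B f) (γ : V →ₗ[k] Y →ₗ[k] Z) :
    pull11 f (χ γ) = χ (under (pull11 f) γ) := by
  ext v x; exact braid_over hf γ x v

theorem braid_pull21 [IsModuleComodule k B V] {f : P ⊗[k] Q →ₗ[k] Y} (hf : IsYDHom k B f)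
    (γ : Y →ₗ[k] V →ₗ[k] Z) : χ (under χ (pull21 f γ)) = under (pull21 f) (χ γ) := by
  ext v p q
  rw [← hexagon_under, under_apply, pull21_apply, braid_under hf]
  congr 3
  exact TensorProduct.ext' fun _ _ => rfl

theorem pull21_braid [IsModuleComodule k B V] {f : P ⊗[k] Q →ₗ[k] Y} (hf : IsYDHom k B f)
    (γ : V →ₗ[k] Y →ₗ[k] Z) : pull21 f (χ γ) = under χ (χ (under (pull21 f) γ)) := by
  ext p q v
  rw [← hexagon_over, pull21_apply, braid_over hf]
  congr 3
  ext v : 1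
  exact TensorProduct.ext' fun _ _ => rfl

theorem braid_pull12 [IsModuleComodule k B V] {f : X →ₗ[k] P ⊗[k] Q} (hf : IsYDHom k B f)
    (γ : P →ₗ[k] Q →ₗ[k] V →ₗ[k] Z) : χ (pull12 f γ) = under (pull12 f) (χ (under χ γ)) := by
  ext v x
  rw [under_apply, pull12_apply]
  have : ∀ t, TensorProduct.lift (χ (under χ γ) v) t = χ (TensorProduct.lift γ) v t := by
    intro t
    induction t with
    | zero => simp
    | tmul p q => rw [hexagon_under]; rfl
    | add x y hx hy => rw [map_add, hx, hy, map_add]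
  rw [this, braid_under hf]
  rfl

theorem pull12_braid [IsModuleComodule k B V] {f : X →ₗ[k] P ⊗[k] Q} (hf : IsYDHom k B f)
    (γ : V →ₗ[k] P →ₗ[k] Q →ₗ[k] Z) : pull12 f (under χ (χ γ)) = χ (under (pull12 f) γ) := by
  ext x v
  rw [pull12_apply]
  have : ∀ t, TensorProduct.lift (under χ (χ γ)) t v =
      χ (under (TensorProduct.uncurry (.id k) P Q Z) γ) t v := by
    intro t
    induction t with
    | zero => simp
    | tmul p q => rw [hexagon_over]; rfl
    | add x y hx hy => rw [map_add, LinearMap.add_apply, hx, hy, map_add, LinearMap.add_apply]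
  rw [this, braid_over hf]
  rfl

theorem braid_pull22 [IsModuleComodule k B V] {f : X ⊗[k] Y →ₗ[k] P ⊗[k] Q} (hf : IsYDHom k B f)
    (γ : P →ₗ[k] Q →ₗ[k] V →ₗ[k] Z) :
    χ (under χ (pull22 f γ)) = under (pull22 f) (χ (under χ γ)) := by
  have := braid_pull12 hf γ
  ext v x y
  have h := (DFunLike.congr_fun (DFunLike.congr_fun this v) (x ⊗ₜ y))
  rw [← hexagon_under]
  refine Eq.trans ?_ h
  congr 3
  exact TensorProduct.ext' fun _ _ => rfl

theorem braid_unit_right [IsModuleComodule k B V] (γ : k →ₗ[k] V →ₗ[k] Z) (v : V) (c : k) :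
    χ γ v c = γ c v := by
  have := DFunLike.congr_fun (counit_apply (k := k) (B := B) (γ c)) v
  rw [pull22_apply, braid_apply, ← this, pull12_apply]
  congr 2
  ext b v
  have h : (YDStruct.act (k := k) b c : k) = Coalgebra.counit (R := k) b • c := by
    simp [YDStruct.act]
  change γ (actB b c) v = Coalgebra.counit (R := k) b • γ c v
  rw [h, map_smul]
  rfl

theorem braid_unit_left [IsModuleComodule k B V] (γ : V →ₗ[k] k →ₗ[k] Z) (v : V) (c : k) :
    χ γ c v = γ v c := by
  simp [braid_apply, ydCoact, YDStruct.coact, IsModuleComodule.one_act]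

theorem braid_pull10 [IsModuleComodule k B V] {f : X →ₗ[k] k} (hf : IsYDHom k B f) (γ : V →ₗ[k] Z) :
    χ (pull10 f γ) = under (pull10 f) γ := by
  have := braid_pull11 (V := V) hf ((LinearMap.lsmul k Z).flip ∘ₗ γ).flip
  ext v x
  exact (DFunLike.congr_fun (DFunLike.congr_fun this v) x).trans (braid_unit_right _ _ _)

theorem pull10_braid [IsModuleComodule k B V] {f : X →ₗ[k] k} (hf : IsYDHom k B f) (γ : V →ₗ[k] Z) :
    pull10 f γ = χ (under (pull10 f) γ) := by
  have := pull11_braid (V := V) hf ((LinearMap.lsmul k Z).flip ∘ₗ γ)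
  ext x v
  exact (braid_unit_left _ _ _).symm.trans (DFunLike.congr_fun (DFunLike.congr_fun this x) v)

theorem braid_pull20 [IsModuleComodule k B V] {f : P ⊗[k] Q →ₗ[k] k} (hf : IsYDHom k B f)
    (γ : V →ₗ[k] Z) : χ (under χ (pull20 f γ)) = under (pull20 f) γ := by
  have := braid_pull21 (V := V) hf ((LinearMap.lsmul k Z).flip ∘ₗ γ).flip
  ext v x y
  exact (DFunLike.congr_fun (DFunLike.congr_fun (DFunLike.congr_fun this v) x) y).trans
    (braid_unit_right _ _ _)

theorem pull20_braid [IsModuleComodule k B V] {f : P ⊗[k] Q →ₗ[k] k} (hf : IsYDHom k B f)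
    (γ : V →ₗ[k] Z) : pull20 f γ = under χ (χ (under (pull20 f) γ)) := by
  have := pull21_braid (V := V) hf ((LinearMap.lsmul k Z).flip ∘ₗ γ)
  ext x y v
  exact (braid_unit_left _ _ _).symm.trans
    (DFunLike.congr_fun (DFunLike.congr_fun (DFunLike.congr_fun this x) y) v)

theorem braid_pull01 [IsModuleComodule k B V] {u : X}
    (hu : IsYDHom k B (LinearMap.toSpanSingleton k X u))
    (γ : X →ₗ[k] V →ₗ[k] Z) : under (pull01 k u) (χ γ) = pull01 k u γ := by
  have := braid_pull11 (V := V) hu γ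
  ext v
  have := (DFunLike.congr_fun (DFunLike.congr_fun this v) 1)
  rw [braid_unit_right] at this
  simpa using this.symm

theorem pull01_braid [IsModuleComodule k B V] {u : X}
    (hu : IsYDHom k B (LinearMap.toSpanSingleton k X u))
    (γ : V →ₗ[k] X →ₗ[k] Z) : pull01 k u (χ γ) = under (pull01 k u) γ := by
  have := pull11_braid (V := V) hu γ
  ext v
  have := (DFunLike.congr_fun (DFunLike.congr_fun this 1) v)
  rw [braid_unit_left] at this
  simpa using this

end Naturality

/-! ### Closure properties of morphisms -/

section Homs
variable {k B : Type*} [Field k] [Ring B] [HopfAlgebra k B]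
variable {V W X Y Z : Type*} [AddCommMonoid V] [Module k V] [AddCommMonoid W] [Module k W]
  [AddCommMonoid X] [Module k X] [AddCommMonoid Y] [Module k Y] [AddCommMonoid Z] [Module k Z]
  [YDStruct k B V] [YDStruct k B W] [YDStruct k B X] [YDStruct k B Y] [YDStruct k B Z]

local notation "actB" => YDStruct.act (k := k) (B := B)

theorem _root_.IsYDHom.id : IsYDHom k B (LinearMap.id : V →ₗ[k] V) :=
  isYDHom_of (fun _ _ => rfl) (fun _ => by simp)

theorem _root_.IsYDHom.comp {g : Y →ₗ[k] Z} {f : X →ₗ[k] Y} (hg : IsYDHom k B g)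
    (hf : IsYDHom k B f) : IsYDHom k B (g ∘ₗ f) :=
  isYDHom_of (fun b x => by simp [hf.map_act, hg.map_act])
    (fun x => by simp [hf.map_coact, hg.map_coact, LinearMap.lTensor_comp])

theorem _root_.IsYDHom.symm {e : X ≃ₗ[k] Y} (he : IsYDHom k B e.toLinearMap) :
    IsYDHom k B e.symm.toLinearMap := by
  refine isYDHom_of (fun b x => ?_) (fun x => ?_)
  · have := he.map_act b (e.symm x)
    simp only [LinearEquiv.coe_coe, LinearEquiv.apply_symm_apply] at this ⊢
    rw [← this, LinearEquiv.symm_apply_apply]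
  · have := he.map_coact (e.symm x)
    simp only [LinearEquiv.coe_coe, LinearEquiv.apply_symm_apply] at this ⊢
    rw [this, ← LinearMap.lTensor_comp_apply]
    simp

theorem _root_.IsYDHom.map {f : V →ₗ[k] X} {g : W →ₗ[k] Y} (hf : IsYDHom k B f)
    (hg : IsYDHom k B g) : IsYDHom k B (TensorProduct.map f g) := by
  refine isYDHom_of (fun b t => ?_) (fun t => ?_)
  · induction t with
    | zero => simp
    | tmul v w =>
      rw [act_tensor, TensorProduct.map_tmul, act_tensor]
      induction Coalgebra.comul (R := k) b with
      | zero => simp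
      | tmul x y => simp [hf.map_act, hg.map_act]
      | add x y hx hy => simp only [map_add, hx, hy]
    | add x y hx hy => simp only [map_add, hx, hy]
  · induction t with
    | zero => simp
    | tmul v w =>
      rw [TensorProduct.map_tmul, coact_tensor, coact_tensor, hf.map_coact, hg.map_coact]
      induction ydCoact k B V v with
      | zero => simp
      | tmul x y =>
        induction ydCoact k B W w with
        | zero => simp
        | tmul x y => simp
        | add x y hx hy => simp only [map_add, TensorProduct.tmul_add, hx, hy]
      | add x y hx hy => simp only [map_add, TensorProduct.add_tmul, hx, hy]
    | add x y hx hy => simp only [map_add, hx, hy]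

theorem _root_.IsYDHom.rTensor {f : V →ₗ[k] X} (hf : IsYDHom k B f) : IsYDHom k B (f.rTensor W) :=
  hf.map .id

theorem _root_.IsYDHom.lTensor {f : V →ₗ[k] X} (hf : IsYDHom k B f) : IsYDHom k B (f.lTensor W) :=
  IsYDHom.id.map hf

theorem isYDHom_lid [IsModuleComodule k B V] :
    IsYDHom k B (TensorProduct.lid k V).toLinearMap := by
  refine isYDHom_of (fun b t => ?_) (fun t => ?_)
  · induction t with
    | zero => simp
    | tmul c v =>
      have h := congrArg (fun t => TensorProduct.lid k V ((YDStruct.act.flip v).lTensor k t))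
        (Coalgebra.rTensor_counit_comul (R := k) b)
      simp only [act_tensor, LinearMap.lTensor_tmul, TensorProduct.lid_tmul, one_smul,
        LinearMap.flip_apply, LinearEquiv.coe_coe] at h ⊢
      rw [map_smul, ← h]
      induction Coalgebra.comul (R := k) b with
      | zero => simp
      | tmul x y => simp [YDStruct.act, smul_smul, mul_comm]
      | add x y hx hy => simp only [map_add, smul_add, hx, hy]
    | add x y hx hy => simp only [map_add, hx, hy]
  · induction t with
    | zero => simp
    | tmul c v =>
      simp only [LinearEquiv.coe_coe, TensorProduct.lid_tmul, map_smul, coact_tensor]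
      induction ydCoact k B V v with
      | zero => simp
      | tmul x y => simp [ydCoact, YDStruct.coact]
      | add x y hx hy => simp only [map_add, TensorProduct.tmul_add, smul_add, hx, hy]
    | add x y hx hy => simp only [map_add, hx, hy]

theorem isYDHom_rid [IsModuleComodule k B V] :
    IsYDHom k B (TensorProduct.rid k V).toLinearMap := by
  refine isYDHom_of (fun b t => ?_) (fun t => ?_)
  · induction t with
    | zero => simp
    | tmul v c =>
      have h := congrArg (fun t => TensorProduct.rid k V ((YDStruct.act.flip v).rTensor k t))
        (Coalgebra.lTensor_counit_comul (R := k) b)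
      simp only [act_tensor, LinearMap.rTensor_tmul, TensorProduct.rid_tmul, one_smul,
        LinearMap.flip_apply, LinearEquiv.coe_coe] at h ⊢
      rw [map_smul, ← h]
      induction Coalgebra.comul (R := k) b with
      | zero => simp
      | tmul x y => simp [YDStruct.act, smul_smul, mul_comm]
      | add x y hx hy => simp only [map_add, smul_add, hx, hy]
    | add x y hx hy => simp only [map_add, hx, hy]
  · induction t with
    | zero => simp
    | tmul v c =>
      simp only [LinearEquiv.coe_coe, TensorProduct.rid_tmul, map_smul, coact_tensor]
      induction ydCoact k B V v with
      | zero => simp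
      | tmul x y => simp [ydCoact, YDStruct.coact]
      | add x y hx hy => simp only [map_add, TensorProduct.add_tmul, smul_add, hx, hy]
    | add x y hx hy => simp only [map_add, hx, hy]

theorem isYDHom_assoc : IsYDHom k B (TensorProduct.assoc k V W X).toLinearMap := by
  refine isYDHom_of (fun b t => ?_) (fun t => ?_)
  · induction t with
    | zero => simp
    | tmul t x =>
      induction t with
      | zero => simp
      | tmul v w =>
        have h := congrArg (TensorProduct.map (YDStruct.act.flip v) (TensorProduct.map
          (YDStruct.act.flip w) (YDStruct.act.flip x))) (Coalgebra.coassoc_apply (R := k) b)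
        simp only [LinearEquiv.coe_coe, TensorProduct.assoc_tmul, act_tensor] at h ⊢
        convert h using 1
        · induction Coalgebra.comul (R := k) b with
          | zero => simp
          | tmul x y =>
            simp only [TensorProduct.map_tmul, LinearMap.flip_apply, act_tensor,
              LinearMap.rTensor_tmul]
            induction Coalgebra.comul (R := k) x with
            | zero => simp
            | tmul x y => simp
            | add x y hx hy => simp only [map_add, TensorProduct.add_tmul, hx, hy]
          | add x y hx hy => simp only [map_add, hx, hy]
        · induction Coalgebra.comul (R := k) b with
          | zero => simp
          | tmul x y => simp [act_tensor]
          | add x y hx hy => simp only [map_add, hx, hy]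
      | add x y hx hy => simp only [map_add, TensorProduct.add_tmul, hx, hy]
    | add x y hx hy => simp only [map_add, hx, hy]
  · induction t with
    | zero => simp
    | tmul t x =>
      induction t with
      | zero => simp
      | tmul v w =>
        simp only [LinearEquiv.coe_coe, TensorProduct.assoc_tmul, coact_tensor]
        induction ydCoact k B V v with
        | zero => simp
        | tmul b v =>
          induction ydCoact k B W w with
          | zero => simp
          | tmul c w =>
            induction ydCoact k B X x with
            | zero => simp
            | tmul d x => simp [mul_assoc]
            | add x y hx hy => simp only [map_add, TensorProduct.tmul_add, hx, hy]
          | add x y hx hy =>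
            simp only [map_add, TensorProduct.tmul_add, TensorProduct.add_tmul, hx, hy]
        | add x y hx hy => simp only [map_add, TensorProduct.add_tmul, hx, hy]
      | add x y hx hy => simp only [map_add, TensorProduct.add_tmul, hx, hy]
    | add x y hx hy => simp only [map_add, hx, hy]

end Homs

/-! ### The braiding is a morphism -/

section Braiding

variable {k B : Type*} [Field k] [Ring B] [HopfAlgebra k B]
variable {V W X : Type*} [AddCommMonoid V] [Module k V] [AddCommMonoid W] [Module k W]
  [AddCommMonoid X] [Module k X]

local notation "χ" => pull22 (ydBraiding k B _ _)
local notation "actB" => YDStruct.act (k := k) (B := B)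

/-- The compatibility of the action and the coaction, in terms of trilinear maps. -/
theorem compat_eval {Z : Type*} [AddCommMonoid Z] [Module k Z] [YDModule k B W]
    (β : B →ₗ[k] W →ₗ[k] V →ₗ[k] Z) (w : W) (c : B) (v : V) :
    pull12 (Coalgebra.comul (R := k) (A := B)) (pull11 (YDStruct.act.flip w)
      (pull12 (ydCoact k B W) (under tw (pull21 (LinearMap.mul' k B) β)))) c v =
    TensorProduct.lift β (ydCompatLeft k B W (c ⊗ₜ w)) v := by
  rw [YDModule.compat]
  simp only [pull12_apply, ydCompatRight, LinearMap.comp_apply, LinearMap.rTensor_tmul]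
  induction Coalgebra.comul (R := k) c with
  | zero => simp
  | tmul x y =>
    simp only [TensorProduct.lift.tmul, pull11_apply, pull12_apply, LinearMap.flip_apply,
      LinearEquiv.coe_coe, TensorProduct.comm_tmul, TensorProduct.assoc_tmul,
      LinearMap.lTensor_tmul, LinearMap.comp_apply, ydAct_tmul]
    induction ydCoact k B W (actB x w) with
    | zero => simp
    | tmul x y => simp
    | add x y hx hy =>
      simp only [map_add, TensorProduct.tmul_add, LinearMap.add_apply, hx, hy]
  | add x y hx hy =>
    simp only [map_add, TensorProduct.add_tmul, LinearMap.add_apply, hx, hy]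

/-- The coaction after the braiding, with the two coefficients of `v` split off. -/
theorem coact_braiding_left [YDStruct k B V] [YDStruct k B W] (v : V) (w : W) :
    ydCoact k B (W ⊗[k] V) (ydBraiding k B V W (v ⊗ₜ w)) =
      pull12 (ydCoact k B V) (under (pull12 (ydCoact k B V)) (pull11 (YDStruct.act.flip w)
        (pull12 (ydCoact k B W) (under tw (pull21 (LinearMap.mul' k B)
          (under (pull21 LinearMap.id) (TensorProduct.mk k B (W ⊗[k] V)))))))) v := by
  simp only [ydBraiding, LinearMap.comp_apply, LinearMap.rTensor_tmul, pull12_apply]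
  induction ydCoact k B V v with
  | zero => simp
  | tmul c v =>
    simp only [TensorProduct.rightComm_tmul, LinearEquiv.coe_coe, LinearMap.rTensor_tmul,
      ydAct_tmul, coact_tensor, TensorProduct.lift.tmul, under_apply, pull12_apply, pull11_apply,
      LinearMap.flip_apply]
    induction ydCoact k B V v with
    | zero => simp
    | tmul d v =>
      simp only [TensorProduct.lift.tmul]
      induction ydCoact k B W (actB c w) with
      | zero => simp
      | tmul x y => simp
      | add x y hx hy =>
        simp only [map_add, TensorProduct.add_tmul, LinearMap.add_apply, hx, hy]
    | add x y hx hy =>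
      simp only [map_add, TensorProduct.tmul_add, hx, hy]
  | add x y hx hy => simp only [map_add, TensorProduct.add_tmul, hx, hy]

/-- The braiding after the coaction of `V ⊗ W`, in terms of the left-hand side of the compatibility
of `W`. -/
theorem coact_braiding_right {Z : Type*} [AddCommMonoid Z] [Module k Z]
    [YDStruct k B V] [IsModuleComodule k B V] [YDStruct k B W]
    (β : B →ₗ[k] W →ₗ[k] V →ₗ[k] Z) (v : V) (w : W) :
    TensorProduct.lift (TensorProduct.lift β ∘ₗ ydCompatLeft k B W ∘ₗ
      (TensorProduct.mk k B W).flip w) (ydCoact k B V v) =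
    TensorProduct.lift (under (TensorProduct.uncurry (.id k) W V Z) β)
      ((ydBraiding k B V W).lTensor B (ydCoact k B (V ⊗[k] W) (v ⊗ₜ w))) := by
  have key : ∀ s : B ⊗[k] W, TensorProduct.lift (TensorProduct.lift β ∘ₗ
      TensorProduct.map (LinearMap.mul' k B) (ydAct k B W) ∘ₗ
      (TensorProduct.tensorTensorTensorComm k B B B W).toLinearMap ∘ₗ
      (TensorProduct.mk k (B ⊗[k] B) (B ⊗[k] W)).flip s ∘ₗ
      Coalgebra.comul (R := k) (A := B)) (ydCoact k B V v) =
      TensorProduct.lift (under (TensorProduct.uncurry (.id k) W V Z) β)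
        ((ydBraiding k B V W).lTensor B ((LinearMap.mul' k B).rTensor (V ⊗[k] W)
          (TensorProduct.tensorTensorTensorComm k B V B W (ydCoact k B V v ⊗ₜ s)))) := by
    intro s
    induction s with
    | zero => simp
    | tmul e w =>
      have h := DFunLike.congr_fun (coassoc_apply (k := k) (B := B) (V := V)
        (pull11 (LinearMap.mulRight k e) (under (pull11 (YDStruct.act.flip w)) β))) v
      refine Eq.trans (Eq.trans ?_ h) ?_
      · simp only [pull12_apply]
        congr 2
        ext c v
        simp only [LinearMap.comp_apply, LinearMap.flip_apply, TensorProduct.mk_apply, pull12_apply]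
        induction Coalgebra.comul (R := k) c with
        | zero => simp
        | tmul x y => simp
        | add x y hx hy =>
          simp only [map_add, TensorProduct.add_tmul, LinearMap.add_apply, hx, hy]
      · simp only [pull12_apply]
        induction ydCoact k B V v with
        | zero => simp
        | tmul c v =>
          simp only [TensorProduct.tensorTensorTensorComm_tmul, LinearMap.rTensor_tmul,
            LinearMap.lTensor_tmul, TensorProduct.lift.tmul, under_apply, pull12_apply]
          refine Eq.trans ?_ (braid_apply (β (c * e)) v w).symm
          rfl
        | add x y hx hy => simp only [map_add, TensorProduct.add_tmul, hx, hy]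
    | add x y hx hy =>
      simp only [map_add, TensorProduct.tmul_add, ← hx, ← hy, LinearMap.add_comp,
        LinearMap.comp_add, lift_add]
  rw [coact_tensor, ← key]
  rfl

/-- The braiding of two Yetter–Drinfeld modules is a morphism; this is where the compatibility of
action and coaction enters. -/
theorem isYDHom_braiding [YDModule k B V] [YDModule k B W] : IsYDHom k B (ydBraiding k B V W) := by
  refine isYDHom_of (fun b t => ?_) (fun t => ?_)
  · induction t with
    | zero => simp
    | tmul v w =>
      have h := congrArg (TensorProduct.lift (TensorProduct.mk k W V ∘ₗ YDStruct.act.flip w))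
        (DFunLike.congr_fun (YDModule.compat (k := k) (B := B) (V := V)) (b ⊗ₜ v))
      apply eq_of_lift
      refine Eq.trans ?_ (h.symm.trans ?_)
      · rw [act_tensor]
        simp only [ydCompatRight, LinearMap.comp_apply, LinearMap.rTensor_tmul]
        induction Coalgebra.comul (R := k) b with
        | zero => simp
        | tmul x y =>
          simp only [TensorProduct.map_tmul, LinearMap.flip_apply, braid_apply]
          simp only [LinearEquiv.coe_coe, TensorProduct.comm_tmul,
            TensorProduct.assoc_tmul, LinearMap.lTensor_tmul, LinearMap.comp_apply, ydAct_tmul]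
          induction ydCoact k B V (actB x v) with
          | zero => simp
          | tmul x y => simp [IsModuleComodule.mul_act]
          | add x y hx hy => simp only [map_add, TensorProduct.tmul_add, hx, hy]
        | add x y hx hy => simp only [map_add, TensorProduct.add_tmul, hx, hy]
      · simp only [ydCompatLeft, LinearMap.comp_apply, TensorProduct.map_tmul, ydBraiding,
          LinearMap.rTensor_tmul]
        induction ydCoact k B V v with
        | zero => simp
        | tmul c v =>
          simp only [TensorProduct.rightComm_tmul, LinearEquiv.coe_coe, LinearMap.rTensor_tmul,
            ydAct_tmul, act_tensor]
          induction Coalgebra.comul (R := k) b with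
          | zero => simp
          | tmul x y => simp [IsModuleComodule.mul_act]
          | add x y hx hy => simp only [map_add, TensorProduct.add_tmul, hx, hy]
        | add x y hx hy =>
          simp only [map_add, TensorProduct.add_tmul, TensorProduct.tmul_add, hx, hy]
    | add x y hx hy => simp only [map_add, hx, hy]
  · induction t with
    | zero => simp
    | tmul v w =>
      rw [coact_braiding_left, ← coassoc_apply]
      let β := under (pull21 LinearMap.id) (TensorProduct.mk k B (W ⊗[k] V))
      have h₁ : pull12 (Coalgebra.comul (R := k) (A := B)) (pull11 (YDStruct.act.flip w)
          (pull12 (ydCoact k B W) (under tw (pull21 (LinearMap.mul' k B) β)))) =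
          TensorProduct.lift β ∘ₗ ydCompatLeft k B W ∘ₗ (TensorProduct.mk k B W).flip w := by
        ext c v
        exact compat_eval β w c v
      have h₂ : under (TensorProduct.uncurry (.id k) W V _) β =
          TensorProduct.mk k B (W ⊗[k] V) := by
        ext c : 1
        exact TensorProduct.ext' fun _ _ => rfl
      rw [h₁, pull12_apply, coact_braiding_right, h₂, TensorProduct.lift_mk]
      rfl
    | add x y hx hy => simp only [map_add, hx, hy]

theorem isYDHom_braiding_tensor_left [YDStruct k B V] [YDStruct k B W] [YDStruct k B X]
    [IsModuleComodule k B X]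
    (hV : IsYDHom k B (ydBraiding k B V X)) (hW : IsYDHom k B (ydBraiding k B W X)) :
    IsYDHom k B (ydBraiding k B (V ⊗[k] W) X) := by
  have : ydBraiding k B (V ⊗[k] W) X = (TensorProduct.assoc k X V W).toLinearMap ∘ₗ
      (ydBraiding k B V X).rTensor W ∘ₗ (TensorProduct.assoc k V X W).symm.toLinearMap ∘ₗ
      (ydBraiding k B W X).lTensor V ∘ₗ (TensorProduct.assoc k V W X).toLinearMap := by
    ext v w x
    have h := hexagon_over (B := B)
      (under (pull21 LinearMap.id) (TensorProduct.mk k X (V ⊗[k] W))) v w x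
    apply eq_of_lift
    refine Eq.trans (Eq.trans ?_ h) ?_
    · simp only [pull22_apply]
      congr 2
      ext v : 1
      exact TensorProduct.ext' fun _ _ => rfl
    · simp only [under_apply, pull22_apply, LinearMap.comp_apply,
        TensorProduct.AlgebraTensorModule.curry_apply,
        LinearMap.restrictScalars_self, TensorProduct.curry_apply, LinearEquiv.coe_coe,
        TensorProduct.assoc_tmul, LinearMap.lTensor_tmul]
      induction ydBraiding k B W X (w ⊗ₜ x) with
      | zero => simp
      | tmul x w =>
        simp only [TensorProduct.lift.tmul, pull22_apply, TensorProduct.assoc_symm_tmul,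
          LinearMap.rTensor_tmul]
        induction ydBraiding k B V X (v ⊗ₜ x) with
        | zero => simp
        | tmul x v => simp
        | add x y hx hy => simp only [map_add, TensorProduct.add_tmul, LinearMap.add_apply, hx, hy]
      | add x y hx hy => simp only [map_add, TensorProduct.tmul_add, hx, hy]
  rw [this]
  exact isYDHom_assoc.comp
    (hV.rTensor.comp (isYDHom_assoc.symm.comp (hW.lTensor.comp isYDHom_assoc)))

theorem isYDHom_braiding_tensor_right [YDStruct k B V] [YDStruct k B W] [YDStruct k B X]
    [IsModuleComodule k B X]
    (hV : IsYDHom k B (ydBraiding k B X V)) (hW : IsYDHom k B (ydBraiding k B X W)) :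
    IsYDHom k B (ydBraiding k B X (V ⊗[k] W)) := by
  have : ydBraiding k B X (V ⊗[k] W) = (TensorProduct.assoc k V W X).symm.toLinearMap ∘ₗ
      (ydBraiding k B X W).lTensor V ∘ₗ (TensorProduct.assoc k V X W).toLinearMap ∘ₗ
      (ydBraiding k B X V).rTensor W ∘ₗ (TensorProduct.assoc k X V W).symm.toLinearMap := by
    ext x v w
    have h := hexagon_under (B := B) (pull21 LinearMap.id (TensorProduct.mk k (V ⊗[k] W) X)) x v w
    apply eq_of_lift
    refine Eq.trans (Eq.trans ?_ h) ?_
    · simp only [pull22_apply]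
      congr 2
      exact TensorProduct.ext' fun _ _ => rfl
    · simp only [pull22_apply, LinearMap.comp_apply,
        TensorProduct.AlgebraTensorModule.curry_apply,
        LinearMap.restrictScalars_self, TensorProduct.curry_apply, LinearEquiv.coe_coe,
        TensorProduct.assoc_symm_tmul, LinearMap.rTensor_tmul]
      induction ydBraiding k B X V (x ⊗ₜ v) with
      | zero => simp
      | tmul v x =>
        simp only [TensorProduct.lift.tmul, pull22_apply, TensorProduct.assoc_tmul, under_apply,
          LinearMap.lTensor_tmul]
        induction ydBraiding k B X W (x ⊗ₜ w) with
        | zero => simp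
        | tmul x v => simp
        | add x y hx hy => simp only [map_add, TensorProduct.tmul_add, hx, hy]
      | add x y hx hy => simp only [map_add, TensorProduct.add_tmul, LinearMap.add_apply, hx, hy]
  rw [this]
  exact isYDHom_assoc.symm.comp
    (hW.lTensor.comp (isYDHom_assoc.comp (hV.rTensor.comp isYDHom_assoc.symm)))

end Braiding

/-! ### Words: operations on the strands of a multilinear map -/

universe u v

/-- A `k`-module, bundled. Multilinear maps are elements of iterated `hom`s into such a target; with
the target bundled, one operation acts on maps with any number of further arguments. -/
structure Tgt (k : Type u) [Field k] where
  carrier : Type v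
  [acm : AddCommMonoid carrier]
  [mod : Module k carrier]

attribute [instance] Tgt.acm Tgt.mod

section Bundled

variable {k : Type*} [Field k]

/-- The bundled module on `Z`. -/
def Tgt.of (k : Type*) [Field k] (Z : Type*) [AddCommMonoid Z] [Module k Z] : Tgt k := ⟨Z⟩

/-- The module of linear maps from `V` to `Z`, bundled again, so that it can serve as a target. It
is a `def`, so that `simp` and instance search do not unfold it to linear maps. -/
def hom (V : Type*) [AddCommMonoid V] [Module k V] (Z : Tgt k) : Tgt k :=
  ⟨V →ₗ[k] Z.carrier⟩

/-- Linear maps between targets. -/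
abbrev Mor (Z Z' : Tgt k) := Z.carrier →ₗ[k] Z'.carrier

variable {V W X Y Q : Type*}
  {_ : AddCommMonoid V} {_ : Module k V} {_ : AddCommMonoid W} {_ : Module k W}
  {_ : AddCommMonoid X} {_ : Module k X} {_ : AddCommMonoid Y} {_ : Module k Y}
  {_ : AddCommMonoid Q} {_ : Module k Q} {Z Z' : Tgt k}

/-- Evaluation of an element of `hom X Z`. -/
def ev (γ : (hom X Z).carrier) (x : X) : Z.carrier := (show X →ₗ[k] Z.carrier from γ) x

instance : CoeFun (hom X Z).carrier (fun _ => X → Z.carrier) := ⟨ev⟩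

/-- The linear map on `X ⊗ Y` that a bilinear map induces. -/
noncomputable def uncur (γ : (hom X (hom Y Z)).carrier) : X ⊗[k] Y →ₗ[k] Z.carrier :=
  TensorProduct.lift (show X →ₗ[k] Y →ₗ[k] Z.carrier from γ)

/-- `uncur` as a morphism of targets. -/
noncomputable def unc (γ : (hom X (hom Y Z)).carrier) : Mor (Tgt.of k (X ⊗[k] Y)) Z := uncur γ

@[simp] theorem uncur_tmul (γ : (hom X (hom Y Z)).carrier) (x : X) (y : Y) :
    uncur γ (x ⊗ₜ y) = γ x y := rfl

theorem hom_ext {γ γ' : (hom X Z).carrier} (h : ∀ x, γ x = γ' x) : γ = γ' := LinearMap.ext h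

theorem ev_congr {γ γ' : (hom X Z).carrier} (h : γ = γ') (x : X) : γ x = γ' x := h ▸ rfl

@[simp] theorem ev_zero (γ : (hom X Z).carrier) : γ 0 = 0 := LinearMap.map_zero _
@[simp] theorem ev_add (γ : (hom X Z).carrier) (x y : X) : γ (x + y) = γ x + γ y :=
  LinearMap.map_add _ _ _
@[simp] theorem ev_smul (γ : (hom X Z).carrier) (c : k) (x : X) : γ (c • x) = c • γ x :=
  LinearMap.map_smul _ _ _
@[simp] theorem zero_ev (x : X) : (0 : (hom X Z).carrier) x = 0 := rfl
@[simp] theorem add_ev (γ γ' : (hom X Z).carrier) (x : X) : (γ + γ') x = γ x + γ' x := rfl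
@[simp] theorem smul_ev (γ : (hom X Z).carrier) (c : k) (x : X) : (c • γ) x = c • γ x := rfl

/-- The operation on multilinear maps that feeds the first two arguments through `f`, two strands in
and two strands out. The digits of `o22`, `o21`, `o12`, `o20`, `o11`, `o10`, `o01` are the numbers
of strands in and out. -/
noncomputable def o22 (f : V ⊗[k] W →ₗ[k] X ⊗[k] Y) : Mor (hom X (hom Y Z)) (hom V (hom W Z)) :=
  pull22 f
/-- The operation of `f`, two strands in and one strand out. -/
noncomputable def o21 (f : V ⊗[k] W →ₗ[k] X) : Mor (hom X Z) (hom V (hom W Z)) := pull21 f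
/-- The operation of `f`, one strand in and two strands out. -/
noncomputable def o12 (f : V →ₗ[k] X ⊗[k] Y) : Mor (hom X (hom Y Z)) (hom V Z) := pull12 f
/-- The operation of a pairing `f`, which consumes two strands. -/
noncomputable def o20 (f : V ⊗[k] W →ₗ[k] k) : Mor Z (hom V (hom W Z)) := pull20 f
/-- The operation of `f` on a single strand. -/
noncomputable def o11 (f : V →ₗ[k] X) : Mor (hom X Z) (hom V Z) := pull11 f
/-- The operation of a functional `f`, which consumes one strand. -/
noncomputable def o10 (f : V →ₗ[k] k) : Mor Z (hom V Z) := pull10 f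
/-- The operation that inserts the element `u` as a new strand. -/
noncomputable def o01 (u : X) : Mor (hom X Z) Z := pull01 k u
/-- The operation `d`, shifted past the first strand. -/
noncomputable def wh (d : Mor Z Z') : Mor (hom V Z) (hom V Z') := under d

@[simp] theorem o22_apply (f : V ⊗[k] W →ₗ[k] X ⊗[k] Y) (γ : (hom X (hom Y Z)).carrier) (v : V)
    (w : W) : o22 f γ v w = uncur γ (f (v ⊗ₜ w)) := rfl
@[simp] theorem o21_apply (f : V ⊗[k] W →ₗ[k] X) (γ : (hom X Z).carrier) (v : V) (w : W) :
    o21 f γ v w = γ (f (v ⊗ₜ w)) := rfl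
@[simp] theorem o12_apply (f : V →ₗ[k] X ⊗[k] Y) (γ : (hom X (hom Y Z)).carrier) (v : V) :
    o12 f γ v = uncur γ (f v) := rfl
@[simp] theorem o20_apply (f : V ⊗[k] W →ₗ[k] k) (γ : Z.carrier) (v : V) (w : W) :
    o20 f γ v w = f (v ⊗ₜ w) • γ := rfl
@[simp] theorem o11_apply (f : V →ₗ[k] X) (γ : (hom X Z).carrier) (v : V) :
    o11 f γ v = γ (f v) := rfl
@[simp] theorem o10_apply (f : V →ₗ[k] k) (γ : Z.carrier) (v : V) : o10 f γ v = f v • γ := rfl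
@[simp] theorem o01_apply (u : X) (γ : (hom X Z).carrier) : o01 u γ = γ u := rfl
@[simp] theorem wh_apply (d : Mor Z Z') (γ : (hom V Z).carrier) (v : V) :
    wh d γ v = d (γ v) := rfl

/-- Operations on disjoint strands commute; in this and the following lemmas, `simp` lets
the operation on the strands to the right act first. -/
@[simp] theorem o22_wh (f : V ⊗[k] W →ₗ[k] X ⊗[k] Y) (d : Mor Z Z')
    (γ : (hom X (hom Y Z)).carrier) :
    o22 f (wh (wh d) γ) = wh (wh d) (o22 f γ) := pull22_under f d γ
@[simp] theorem o21_wh (f : V ⊗[k] W →ₗ[k] X) (d : Mor Z Z') (γ : (hom X Z).carrier) :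
    o21 f (wh d γ) = wh (wh d) (o21 f γ) := rfl
@[simp] theorem o12_wh (f : V →ₗ[k] X ⊗[k] Y) (d : Mor Z Z') (γ : (hom X (hom Y Z)).carrier) :
    o12 f (wh (wh d) γ) = wh d (o12 f γ) := pull12_under f d γ
@[simp] theorem o20_wh (f : V ⊗[k] W →ₗ[k] k) (d : Mor Z Z') (γ : Z.carrier) :
    o20 f (d γ) = wh (wh d) (o20 f γ) := pull20_under f d γ
@[simp] theorem o11_wh (f : V →ₗ[k] X) (d : Mor Z Z') (γ : (hom X Z).carrier) :
    o11 f (wh d γ) = wh d (o11 f γ) := rfl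
@[simp] theorem o10_wh (f : V →ₗ[k] k) (d : Mor Z Z') (γ : Z.carrier) :
    o10 f (d γ) = wh d (o10 f γ) := pull10_under f d γ
@[simp] theorem o01_wh (u : X) (d : Mor Z Z') (γ : (hom X Z).carrier) :
    o01 u (wh d γ) = d (o01 u γ) := rfl

section Whisker

variable {P Z₀ X₁ X₂ X₃ Y₁ Y₂ Y₃ Y₄ : Tgt k}

/-- An identity between words remains true when all its letters are shifted past one more strand.
The digits of `wh20`, `wh12`, …, `wh44` are the lengths of the two words. -/
theorem wh20 {f₂ : Mor Z₀ X₁} {f₁ : Mor X₁ Z₀}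
    (h : ∀ γ, f₁ (f₂ γ) = γ) (γ : (hom V Z₀).carrier) : wh f₁ (wh f₂ γ) = γ := hom_ext fun _ => h _

theorem wh12 {f₁ : Mor Z₀ P} {g₂ : Mor Z₀ Y₁} {g₁ : Mor Y₁ P}
    (h : ∀ γ, f₁ γ = g₁ (g₂ γ)) (γ : (hom V Z₀).carrier) :
    wh f₁ γ = wh g₁ (wh g₂ γ) := hom_ext fun _ => h _

theorem wh13 {f₁ : Mor Z₀ P} {g₃ : Mor Z₀ Y₂} {g₂ : Mor Y₂ Y₁} {g₁ : Mor Y₁ P}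
    (h : ∀ γ, f₁ γ = g₁ (g₂ (g₃ γ))) (γ : (hom V Z₀).carrier) :
    wh f₁ γ = wh g₁ (wh g₂ (wh g₃ γ)) := hom_ext fun _ => h _

theorem wh14 {f₁ : Mor Z₀ P} {g₄ : Mor Z₀ Y₃} {g₃ : Mor Y₃ Y₂} {g₂ : Mor Y₂ Y₁} {g₁ : Mor Y₁ P}
    (h : ∀ γ, f₁ γ = g₁ (g₂ (g₃ (g₄ γ)))) (γ : (hom V Z₀).carrier) :
    wh f₁ γ = wh g₁ (wh g₂ (wh g₃ (wh g₄ γ))) := hom_ext fun _ => h _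

theorem wh21 {f₂ : Mor Z₀ X₁} {f₁ : Mor X₁ P} {g₁ : Mor Z₀ P}
    (h : ∀ γ, f₁ (f₂ γ) = g₁ γ) (γ : (hom V Z₀).carrier) :
    wh f₁ (wh f₂ γ) = wh g₁ γ := hom_ext fun _ => h _

theorem wh22 {f₂ : Mor Z₀ X₁} {f₁ : Mor X₁ P} {g₂ : Mor Z₀ Y₁} {g₁ : Mor Y₁ P}
    (h : ∀ γ, f₁ (f₂ γ) = g₁ (g₂ γ)) (γ : (hom V Z₀).carrier) :
    wh f₁ (wh f₂ γ) = wh g₁ (wh g₂ γ) := hom_ext fun _ => h _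

theorem wh23 {f₂ : Mor Z₀ X₁} {f₁ : Mor X₁ P} {g₃ : Mor Z₀ Y₂} {g₂ : Mor Y₂ Y₁} {g₁ : Mor Y₁ P}
    (h : ∀ γ, f₁ (f₂ γ) = g₁ (g₂ (g₃ γ))) (γ : (hom V Z₀).carrier) :
    wh f₁ (wh f₂ γ) = wh g₁ (wh g₂ (wh g₃ γ)) := hom_ext fun _ => h _

theorem wh24 {f₂ : Mor Z₀ X₁} {f₁ : Mor X₁ P} {g₄ : Mor Z₀ Y₃} {g₃ : Mor Y₃ Y₂} {g₂ : Mor Y₂ Y₁}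
    {g₁ : Mor Y₁ P}
    (h : ∀ γ, f₁ (f₂ γ) = g₁ (g₂ (g₃ (g₄ γ)))) (γ : (hom V Z₀).carrier) :
    wh f₁ (wh f₂ γ) = wh g₁ (wh g₂ (wh g₃ (wh g₄ γ))) := hom_ext fun _ => h _

theorem wh25 {f₂ : Mor Z₀ X₁} {f₁ : Mor X₁ P} {g₅ : Mor Z₀ Y₄} {g₄ : Mor Y₄ Y₃} {g₃ : Mor Y₃ Y₂}
    {g₂ : Mor Y₂ Y₁} {g₁ : Mor Y₁ P}
    (h : ∀ γ, f₁ (f₂ γ) = g₁ (g₂ (g₃ (g₄ (g₅ γ))))) (γ : (hom V Z₀).carrier) :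
    wh f₁ (wh f₂ γ) = wh g₁ (wh g₂ (wh g₃ (wh g₄ (wh g₅ γ)))) := hom_ext fun _ => h _

theorem wh31 {f₃ : Mor Z₀ X₂} {f₂ : Mor X₂ X₁} {f₁ : Mor X₁ P} {g₁ : Mor Z₀ P}
    (h : ∀ γ, f₁ (f₂ (f₃ γ)) = g₁ γ) (γ : (hom V Z₀).carrier) :
    wh f₁ (wh f₂ (wh f₃ γ)) = wh g₁ γ := hom_ext fun _ => h _

theorem wh32 {f₃ : Mor Z₀ X₂} {f₂ : Mor X₂ X₁} {f₁ : Mor X₁ P} {g₂ : Mor Z₀ Y₁} {g₁ : Mor Y₁ P}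
    (h : ∀ γ, f₁ (f₂ (f₃ γ)) = g₁ (g₂ γ)) (γ : (hom V Z₀).carrier) :
    wh f₁ (wh f₂ (wh f₃ γ)) = wh g₁ (wh g₂ γ) := hom_ext fun _ => h _

theorem wh33 {f₃ : Mor Z₀ X₂} {f₂ : Mor X₂ X₁} {f₁ : Mor X₁ P} {g₃ : Mor Z₀ Y₂} {g₂ : Mor Y₂ Y₁}
    {g₁ : Mor Y₁ P}
    (h : ∀ γ, f₁ (f₂ (f₃ γ)) = g₁ (g₂ (g₃ γ))) (γ : (hom V Z₀).carrier) :
    wh f₁ (wh f₂ (wh f₃ γ)) = wh g₁ (wh g₂ (wh g₃ γ)) := hom_ext fun _ => h _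

theorem wh34 {f₃ : Mor Z₀ X₂} {f₂ : Mor X₂ X₁} {f₁ : Mor X₁ P} {g₄ : Mor Z₀ Y₃} {g₃ : Mor Y₃ Y₂}
    {g₂ : Mor Y₂ Y₁} {g₁ : Mor Y₁ P}
    (h : ∀ γ, f₁ (f₂ (f₃ γ)) = g₁ (g₂ (g₃ (g₄ γ)))) (γ : (hom V Z₀).carrier) :
    wh f₁ (wh f₂ (wh f₃ γ)) = wh g₁ (wh g₂ (wh g₃ (wh g₄ γ))) := hom_ext fun _ => h _

theorem wh41 {f₄ : Mor Z₀ X₃} {f₃ : Mor X₃ X₂} {f₂ : Mor X₂ X₁} {f₁ : Mor X₁ P} {g₁ : Mor Z₀ P}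
    (h : ∀ γ, f₁ (f₂ (f₃ (f₄ γ))) = g₁ γ) (γ : (hom V Z₀).carrier) :
    wh f₁ (wh f₂ (wh f₃ (wh f₄ γ))) = wh g₁ γ := hom_ext fun _ => h _

theorem wh42 {f₄ : Mor Z₀ X₃} {f₃ : Mor X₃ X₂} {f₂ : Mor X₂ X₁} {f₁ : Mor X₁ P} {g₂ : Mor Z₀ Y₁}
    {g₁ : Mor Y₁ P}
    (h : ∀ γ, f₁ (f₂ (f₃ (f₄ γ))) = g₁ (g₂ γ)) (γ : (hom V Z₀).carrier) :
    wh f₁ (wh f₂ (wh f₃ (wh f₄ γ))) = wh g₁ (wh g₂ γ) := hom_ext fun _ => h _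

theorem wh44 {f₄ : Mor Z₀ X₃} {f₃ : Mor X₃ X₂} {f₂ : Mor X₂ X₁} {f₁ : Mor X₁ P} {g₄ : Mor Z₀ Y₃}
    {g₃ : Mor Y₃ Y₂} {g₂ : Mor Y₂ Y₁} {g₁ : Mor Y₁ P}
    (h : ∀ γ, f₁ (f₂ (f₃ (f₄ γ))) = g₁ (g₂ (g₃ (g₄ γ)))) (γ : (hom V Z₀).carrier) :
    wh f₁ (wh f₂ (wh f₃ (wh f₄ γ))) = wh g₁ (wh g₂ (wh g₃ (wh g₄ γ))) := hom_ext fun _ => h _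

end Whisker

section Interchange

variable {P₁ P₂ : Type*} {_ : AddCommMonoid P₁} {_ : Module k P₁}
  {_ : AddCommMonoid P₂} {_ : Module k P₂}

/-- The interchange laws, shifted past one or two strands. -/
@[simp] theorem o22_wh_1 (f : V ⊗[k] W →ₗ[k] X ⊗[k] Y) (d : Mor Z Z')
    (γ : (hom P₁ (hom X (hom Y Z))).carrier) :
    wh (o22 f) (wh (wh (wh d)) γ) =
      wh (wh (wh d)) (wh (o22 f) γ) := wh22 (o22_wh f d) γ
@[simp] theorem o22_wh_2 (f : V ⊗[k] W →ₗ[k] X ⊗[k] Y) (d : Mor Z Z')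
    (γ : (hom P₁ (hom P₂ (hom X (hom Y Z)))).carrier) :
    wh (wh (o22 f)) (wh (wh (wh (wh d))) γ) =
      wh (wh (wh (wh d))) (wh (wh (o22 f)) γ) := wh22 (o22_wh_1 f d) γ
@[simp] theorem o21_wh_1 (f : V ⊗[k] W →ₗ[k] X) (d : Mor Z Z')
    (γ : (hom P₁ (hom X Z)).carrier) :
    wh (o21 f) (wh (wh d) γ) =
      wh (wh (wh d)) (wh (o21 f) γ) := wh22 (o21_wh f d) γ
@[simp] theorem o21_wh_2 (f : V ⊗[k] W →ₗ[k] X) (d : Mor Z Z')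
    (γ : (hom P₁ (hom P₂ (hom X Z))).carrier) :
    wh (wh (o21 f)) (wh (wh (wh d)) γ) =
      wh (wh (wh (wh d))) (wh (wh (o21 f)) γ) := wh22 (o21_wh_1 f d) γ
@[simp] theorem o12_wh_1 (f : V →ₗ[k] X ⊗[k] Y) (d : Mor Z Z')
    (γ : (hom P₁ (hom X (hom Y Z))).carrier) :
    wh (o12 f) (wh (wh (wh d)) γ) =
      wh (wh d) (wh (o12 f) γ) := wh22 (o12_wh f d) γ
@[simp] theorem o12_wh_2 (f : V →ₗ[k] X ⊗[k] Y) (d : Mor Z Z')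
    (γ : (hom P₁ (hom P₂ (hom X (hom Y Z)))).carrier) :
    wh (wh (o12 f)) (wh (wh (wh (wh d))) γ) =
      wh (wh (wh d)) (wh (wh (o12 f)) γ) := wh22 (o12_wh_1 f d) γ
@[simp] theorem o20_wh_1 (f : V ⊗[k] W →ₗ[k] k) (d : Mor Z Z')
    (γ : (hom P₁ Z).carrier) :
    wh (o20 f) (wh d γ) =
      wh (wh (wh d)) (wh (o20 f) γ) := wh22 (o20_wh f d) γ
@[simp] theorem o20_wh_2 (f : V ⊗[k] W →ₗ[k] k) (d : Mor Z Z')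
    (γ : (hom P₁ (hom P₂ Z)).carrier) :
    wh (wh (o20 f)) (wh (wh d) γ) =
      wh (wh (wh (wh d))) (wh (wh (o20 f)) γ) := wh22 (o20_wh_1 f d) γ
@[simp] theorem o11_wh_1 (f : V →ₗ[k] X) (d : Mor Z Z')
    (γ : (hom P₁ (hom X Z)).carrier) :
    wh (o11 f) (wh (wh d) γ) =
      wh (wh d) (wh (o11 f) γ) := wh22 (o11_wh f d) γ
@[simp] theorem o11_wh_2 (f : V →ₗ[k] X) (d : Mor Z Z')
    (γ : (hom P₁ (hom P₂ (hom X Z))).carrier) :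
    wh (wh (o11 f)) (wh (wh (wh d)) γ) =
      wh (wh (wh d)) (wh (wh (o11 f)) γ) := wh22 (o11_wh_1 f d) γ
@[simp] theorem o10_wh_1 (f : V →ₗ[k] k) (d : Mor Z Z')
    (γ : (hom P₁ Z).carrier) :
    wh (o10 f) (wh d γ) =
      wh (wh d) (wh (o10 f) γ) := wh22 (o10_wh f d) γ
@[simp] theorem o10_wh_2 (f : V →ₗ[k] k) (d : Mor Z Z')
    (γ : (hom P₁ (hom P₂ Z)).carrier) :
    wh (wh (o10 f)) (wh (wh d) γ) =
      wh (wh (wh d)) (wh (wh (o10 f)) γ) := wh22 (o10_wh_1 f d) γ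
@[simp] theorem o01_wh_1 (u : X) (d : Mor Z Z')
    (γ : (hom P₁ (hom X Z)).carrier) :
    wh (o01 u) (wh (wh d) γ) =
      wh d (wh (o01 u) γ) := wh22 (o01_wh u d) γ
end Interchange

theorem eq_of_uncur {s t : X ⊗[k] Y}
    (h : ∀ γ : (hom X (hom Y (Tgt.of k (X ⊗[k] Y)))).carrier, uncur γ s = uncur γ t) : s = t :=
  eq_of_lift (h (TensorProduct.mk k X Y))

end Bundled

/-- Words are composed with `⋄`. The letters of `a ⋄ b ⋄ γ` act on the arguments of `γ` from left to
right, `a` first, as in a string diagram read from top to bottom. -/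
infixr:67 " ⋄ " => DFunLike.coe
/-- The letter `x` with one strand to its left; likewise for `↓2`, `↓3`, `↓4`. -/
notation "↓1" x:max => wh x
notation "↓2" x:max => wh (wh x)
notation "↓3" x:max => wh (wh (wh x))
notation "↓4" x:max => wh (wh (wh (wh x)))

/-! ### Naturality of the braiding for words -/

section Naturality

variable {k B : Type*} [Field k] [Ring B] [HopfAlgebra k B]
variable {V P Q X Y : Type*} [AddCommMonoid V] [Module k V] [AddCommMonoid P] [Module k P]
  [AddCommMonoid X] [Module k X] [AddCommMonoid Y] [Module k Y] {Z : Tgt k}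
  [AddCommMonoid Q] [Module k Q]
  [YDStruct k B V] [YDStruct k B P] [YDStruct k B X] [YDStruct k B Y] [YDStruct k B Q]

local notation "χ" => o22 (ydBraiding k B _ _)

variable [IsModuleComodule k B V]

/-- A strand `V` passes over the morphism `f`; likewise for the other `braid_oMN`. -/
theorem braid_o21 {f : P ⊗[k] Q →ₗ[k] Y} (hf : IsYDHom k B f)
    (γ : (hom Y (hom V Z)).carrier) : χ (wh χ (o21 f γ)) = wh (o21 f) (χ γ) := braid_pull21 hf γ

/-- A strand `V` passes under the morphism `f`; likewise for the other `oMN_braid`. -/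
theorem o21_braid {f : P ⊗[k] Q →ₗ[k] Y} (hf : IsYDHom k B f)
    (γ : (hom V (hom Y Z)).carrier) : o21 f (χ γ) = wh χ (χ (wh (o21 f) γ)) := pull21_braid hf γ

theorem braid_o12 {f : X →ₗ[k] P ⊗[k] Q} (hf : IsYDHom k B f)
    (γ : (hom P (hom Q (hom V Z))).carrier) : χ (o12 f γ) = wh (o12 f) (χ (wh χ γ)) :=
  braid_pull12 hf γ

theorem o12_braid {f : X →ₗ[k] P ⊗[k] Q} (hf : IsYDHom k B f)
    (γ : (hom V (hom P (hom Q Z))).carrier) : o12 f (wh χ (χ γ)) = χ (wh (o12 f) γ) :=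
  pull12_braid hf γ

theorem braid_o22 {f : X ⊗[k] Y →ₗ[k] P ⊗[k] Q} (hf : IsYDHom k B f)
    (γ : (hom P (hom Q (hom V Z))).carrier) :
    χ (wh χ (o22 f γ)) = wh (o22 f) (χ (wh χ γ)) := braid_pull22 hf γ

theorem braid_o10 {f : X →ₗ[k] k} (hf : IsYDHom k B f) (γ : (hom V Z).carrier) :
    χ (o10 f γ) = wh (o10 f) γ := braid_pull10 hf γ

theorem o10_braid {f : X →ₗ[k] k} (hf : IsYDHom k B f) (γ : (hom V Z).carrier) :
    o10 f γ = χ (wh (o10 f) γ) := pull10_braid hf γ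

theorem braid_o20 {f : P ⊗[k] Q →ₗ[k] k} (hf : IsYDHom k B f) (γ : (hom V Z).carrier) :
    χ (wh χ (o20 f γ)) = wh (o20 f) γ := braid_pull20 hf γ

theorem o20_braid {f : P ⊗[k] Q →ₗ[k] k} (hf : IsYDHom k B f) (γ : (hom V Z).carrier) :
    o20 f γ = wh χ (χ (wh (o20 f) γ)) := pull20_braid hf γ

theorem braid_o01 {u : X} (hu : IsYDHom k B (LinearMap.toSpanSingleton k X u))
    (γ : (hom X (hom V Z)).carrier) : wh (o01 u) (χ γ) = o01 u γ := braid_pull01 hu γ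

theorem o01_braid {u : X} (hu : IsYDHom k B (LinearMap.toSpanSingleton k X u))
    (γ : (hom V (hom X Z)).carrier) : o01 u (χ γ) = wh (o01 u) γ := pull01_braid hu γ

end Naturality

/-! ### Products and actions twisted by a map `D ⊗ A → A ⊗ D` -/

section Twisted

variable {k : Type*} [Field k] {A D X : Type*} [AddCommMonoid A] [Module k A]
  [AddCommMonoid D] [Module k D] [AddCommMonoid X] [Module k X] {Z : Tgt k}

/-- The action of the twisted product `A ⊗ D` on `A ⊗ X` for a module `X` over `D`. -/
noncomputable def twistedAct (mA : A ⊗[k] A →ₗ[k] A) (l : D ⊗[k] X →ₗ[k] X)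
    (σ : D ⊗[k] A →ₗ[k] A ⊗[k] D) : (A ⊗[k] D) ⊗[k] (A ⊗[k] X) →ₗ[k] A ⊗[k] X :=
  TensorProduct.map mA l
    ∘ₗ (TensorProduct.assoc k A A (D ⊗[k] X)).symm.toLinearMap
    ∘ₗ ((TensorProduct.assoc k A D X).toLinearMap
        ∘ₗ σ.rTensor X
        ∘ₗ (TensorProduct.assoc k D A X).symm.toLinearMap).lTensor A
    ∘ₗ (TensorProduct.assoc k A D (A ⊗[k] X)).toLinearMap

theorem twistedMul_eq (mA : A ⊗[k] A →ₗ[k] A) (mD : D ⊗[k] D →ₗ[k] D)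
    (σ : D ⊗[k] A →ₗ[k] A ⊗[k] D) : twistedMul mA mD σ = twistedAct mA mD σ := rfl

/-- Here and in similar lemmas, elements of tensor products are compared by evaluating all bilinear
maps `γ` on them, which turns compositions of maps into words. -/
theorem twistedAct_tmul (mA : A ⊗[k] A →ₗ[k] A) (l : D ⊗[k] X →ₗ[k] X)
    (σ : D ⊗[k] A →ₗ[k] A ⊗[k] D) (γ : (hom A (hom X Z)).carrier) (a a' : A) (d : D) (x : X) :
    uncur γ (twistedAct mA l σ ((a ⊗ₜ d) ⊗ₜ (a' ⊗ₜ x))) =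
      wh (o22 σ) (o21 mA (wh (o21 l) γ)) a d a' x := by
  simp only [twistedAct, LinearMap.comp_apply, LinearEquiv.coe_coe, TensorProduct.assoc_tmul,
    LinearMap.lTensor_tmul, TensorProduct.assoc_symm_tmul, LinearMap.rTensor_tmul, wh_apply,
    o22_apply]
  induction σ (d ⊗ₜ a') with
  | zero => simp
  | tmul a' d => simp
  | add s t hs ht =>
    simp only [map_add, TensorProduct.tmul_add, TensorProduct.add_tmul, add_ev, hs, ht]

theorem twistedAct_left (mA : A ⊗[k] A →ₗ[k] A) (l : D ⊗[k] X →ₗ[k] X)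
    (σ : D ⊗[k] A →ₗ[k] A ⊗[k] D) (γ : (hom A (hom X Z)).carrier) (t : A ⊗[k] D) (a : A) (x : X) :
    uncur γ (twistedAct mA l σ (t ⊗ₜ (a ⊗ₜ x))) =
      ev (ev (uncur (wh (o22 σ) (o21 mA (wh (o21 l) γ))) t) a) x := by
  induction t with
  | zero => simp
  | tmul a' d => rw [twistedAct_tmul, uncur_tmul]
  | add s t hs ht => simp only [map_add, TensorProduct.add_tmul, add_ev, hs, ht]

theorem twistedAct_right (mA : A ⊗[k] A →ₗ[k] A) (l : D ⊗[k] X →ₗ[k] X)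
    (σ : D ⊗[k] A →ₗ[k] A ⊗[k] D) (γ : (hom A (hom X Z)).carrier) (t : A ⊗[k] X) (a : A) (d : D) :
    uncur γ (twistedAct mA l σ ((a ⊗ₜ d) ⊗ₜ t)) =
      uncur (wh (o22 σ) (o21 mA (wh (o21 l) γ)) a d) t := by
  induction t with
  | zero => simp
  | tmul a' d => rw [twistedAct_tmul, uncur_tmul]
  | add s t hs ht => simp only [map_add, TensorProduct.tmul_add, hs, ht]

variable {mA : A ⊗[k] A →ₗ[k] A} {mD : D ⊗[k] D →ₗ[k] D} {l : D ⊗[k] X →ₗ[k] X}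
  {σ : D ⊗[k] A →ₗ[k] A ⊗[k] D}

/-- The universal bilinear map. An identity of words on a bilinear map only needs to be checked
for `pair`, by `eq_wh_pair`. -/
noncomputable def pair (k A D : Type*) [Field k] [AddCommMonoid A] [Module k A]
    [AddCommMonoid D] [Module k D] : (hom A (hom D (Tgt.of k (A ⊗[k] D)))).carrier :=
  TensorProduct.mk k A D

/-- The two hexagon-like identities which make the product twisted by `σ` associative. -/
structure IsTwisting (mA : A ⊗[k] A →ₗ[k] A) (mD : D ⊗[k] D →ₗ[k] D)
    (σ : D ⊗[k] A →ₗ[k] A ⊗[k] D) : Prop where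
  mul_left : o21 mD (o22 σ (pair k A D)) = wh (o22 σ) (o22 σ (wh (o21 mD) (pair k A D)))
  mul_right : wh (o21 mA) (o22 σ (pair k A D)) = o22 σ (wh (o22 σ) (o21 mA (pair k A D)))

theorem eq_wh_pair (γ : (hom A (hom D Z)).carrier) :
    γ = wh (wh (unc γ)) (pair k A D) := rfl

theorem IsTwisting.left (h : IsTwisting mA mD σ) (γ : (hom A (hom D Z)).carrier) :
    o21 mD (o22 σ γ) = wh (o22 σ) (o22 σ (wh (o21 mD) γ)) := by
  conv_lhs => rw [eq_wh_pair γ, o22_wh, o21_wh, h.mul_left, ← wh22 (o22_wh _ _), ← o22_wh,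
    ← wh22 (o21_wh _ _), ← eq_wh_pair γ]

theorem IsTwisting.right (h : IsTwisting mA mD σ) (γ : (hom A (hom D Z)).carrier) :
    wh (o21 mA) (o22 σ γ) = o22 σ (wh (o22 σ) (o21 mA γ)) := by
  conv_lhs => rw [eq_wh_pair γ, o22_wh, wh22 (o21_wh _ _), h.mul_right, ← o22_wh,
    ← wh22 (o22_wh _ _), ← o21_wh, ← eq_wh_pair γ]

theorem assoc_word (hA : ∀ x y z : A, mA (mA (x ⊗ₜ y) ⊗ₜ z) = mA (x ⊗ₜ mA (y ⊗ₜ z)))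
    (γ : (hom A Z).carrier) : o21 mA (o21 mA γ) = wh (o21 mA) (o21 mA γ) :=
  hom_ext fun _ => hom_ext fun _ => hom_ext fun _ => by simp [hA]

theorem assoc_act_word (hl : ∀ (d e : D) (x : X), l (mD (d ⊗ₜ e) ⊗ₜ x) = l (d ⊗ₜ l (e ⊗ₜ x)))
    (γ : (hom X Z).carrier) : o21 mD (o21 l γ) = wh (o21 l) (o21 l γ) :=
  hom_ext fun _ => hom_ext fun _ => hom_ext fun _ => by simp [hl]

/-- Associativity of the twisted action, as an identity of words. -/
theorem twistedAct_word (hA : ∀ x y z : A, mA (mA (x ⊗ₜ y) ⊗ₜ z) = mA (x ⊗ₜ mA (y ⊗ₜ z)))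
    (hl : ∀ (d e : D) (x : X), l (mD (d ⊗ₜ e) ⊗ₜ x) = l (d ⊗ₜ l (e ⊗ₜ x)))
    (h : IsTwisting mA mD σ) (γ : (hom A (hom X Z)).carrier) :
    wh (o22 σ) (o21 mA (wh (o21 mD) (wh (o22 σ) (o21 mA (wh (o21 l) γ))))) =
    wh (wh (wh (o22 σ))) (wh (wh (o21 mA)) (wh (wh (wh (o21 l)))
      (wh (o22 σ) (o21 mA (wh (o21 l) γ))))) := by
  calc
  _ = ↓1(o22 σ) ⋄ ↓3(o22 σ) ⋄ ↓2(o22 σ) ⋄ o21 mA ⋄ o21 mA ⋄ ↓1(o21 mD) ⋄ ↓1(o21 l) ⋄ γ := by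
    rw [wh23 h.left]; simp
  _ = ↓1(o22 σ) ⋄ ↓3(o22 σ) ⋄ ↓2(o22 σ) ⋄ ↓1(o21 mA) ⋄ o21 mA ⋄ ↓2(o21 l) ⋄ ↓1(o21 l) ⋄ γ := by
    rw [wh22 (assoc_act_word hl), assoc_word hA]
  _ = ↓3(o22 σ) ⋄ ↓2(o21 mA) ⋄ ↓1(o22 σ) ⋄ o21 mA ⋄ ↓2(o21 l) ⋄ ↓1(o21 l) ⋄ γ := by
    rw [wh23 h.right]; simp
  _ = _ := by simp

theorem twistedAct_assoc (hA : ∀ x y z : A, mA (mA (x ⊗ₜ y) ⊗ₜ z) = mA (x ⊗ₜ mA (y ⊗ₜ z)))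
    (hl : ∀ (d e : D) (x : X), l (mD (d ⊗ₜ e) ⊗ₜ x) = l (d ⊗ₜ l (e ⊗ₜ x)))
    (h : IsTwisting mA mD σ) (s t : A ⊗[k] D) (z : A ⊗[k] X) :
    twistedAct mA l σ (twistedMul mA mD σ (s ⊗ₜ t) ⊗ₜ z) =
      twistedAct mA l σ (s ⊗ₜ twistedAct mA l σ (t ⊗ₜ z)) := by
  induction s with
  | zero => simp
  | add s t hs ht => simp only [map_add, TensorProduct.add_tmul, hs, ht]
  | tmul a d =>
    induction t with
    | zero => simp
    | add s t hs ht => simp only [map_add, TensorProduct.add_tmul, TensorProduct.tmul_add, hs, ht]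
    | tmul a' d' =>
      induction z with
      | zero => simp
      | add s t hs ht => simp only [map_add, TensorProduct.tmul_add, hs, ht]
      | tmul b x =>
        refine eq_of_uncur fun γ => ?_
        rw [twistedAct_left, twistedMul_eq, twistedAct_tmul, twistedAct_right, twistedAct_tmul,
          twistedAct_word hA hl h]
        rfl

theorem _root_.IsYDHom.twistedAct {B : Type*} [Ring B] [HopfAlgebra k B] [YDStruct k B A]
    [YDStruct k B D] [YDStruct k B X] (hm : IsYDHom k B mA) (hl : IsYDHom k B l)
    (hσ : IsYDHom k B σ) :
    IsYDHom k B (twistedAct mA l σ) :=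
  (hm.map hl).comp (isYDHom_assoc.symm.comp
    ((isYDHom_assoc.comp (hσ.rTensor.comp isYDHom_assoc.symm)).lTensor.comp isYDHom_assoc))

theorem twistedAct_one_tmul {u : A} (hu : ∀ a, mA (u ⊗ₜ a) = a) {d : D}
    (hσ : ∀ a, σ (d ⊗ₜ a) = a ⊗ₜ d) (a : A) (x : X) :
    twistedAct mA l σ ((u ⊗ₜ d) ⊗ₜ (a ⊗ₜ x)) = a ⊗ₜ l (d ⊗ₜ x) := by
  simp [twistedAct, hσ, hu]

theorem twistedAct_tmul_one {u : A} (hu : ∀ a, mA (a ⊗ₜ u) = a)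
    (hσ : ∀ d, σ (d ⊗ₜ u) = u ⊗ₜ d) (a : A) (d : D) (x : X) :
    twistedAct mA l σ ((a ⊗ₜ d) ⊗ₜ (u ⊗ₜ x)) = a ⊗ₜ l (d ⊗ₜ x) := by
  simp [twistedAct, hσ, hu]

theorem isYDHom_unit_tmul {B : Type*} [Ring B] [HopfAlgebra k B] [YDStruct k B A] [YDStruct k B D]
    {u : A} {v : D} (hu : IsYDHom k B (LinearMap.toSpanSingleton k A u))
    (hv : IsYDHom k B (LinearMap.toSpanSingleton k D v)) :
    IsYDHom k B (LinearMap.toSpanSingleton k (A ⊗[k] D) (u ⊗ₜ v)) := by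
  have : LinearMap.toSpanSingleton k (A ⊗[k] D) (u ⊗ₜ v) =
      TensorProduct.map (LinearMap.toSpanSingleton k A u) (LinearMap.toSpanSingleton k D v) ∘ₗ
        (TensorProduct.lid k k).symm.toLinearMap := by
    ext; simp
  rw [this]
  exact (hu.map hv).comp isYDHom_lid.symm

/-- A twisting makes `A ⊗ D` an algebra. -/
theorem _root_.IsYDAlgebra.twisted {B : Type*} [Ring B] [HopfAlgebra k B] [YDStruct k B A]
    [YDStruct k B D] {u : A} {v : D} (hA : IsYDAlgebra B mA u) (hD : IsYDAlgebra B mD v)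
    (h : IsTwisting mA mD σ) (hσ : IsYDHom k B σ) (h₁ : ∀ a, σ (v ⊗ₜ a) = a ⊗ₜ v)
    (h₂ : ∀ d, σ (d ⊗ₜ u) = u ⊗ₜ d) :
    IsYDAlgebra B (twistedMul mA mD σ) (u ⊗ₜ v) where
  assoc := twistedAct_assoc hA.assoc hD.assoc h
  one_mul x := by
    induction x with
    | zero => simp
    | add s t hs ht => simp only [map_add, TensorProduct.tmul_add, hs, ht]
    | tmul a d => rw [twistedMul_eq, twistedAct_one_tmul hA.one_mul h₁, hD.one_mul]
  mul_one x := by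
    induction x with
    | zero => simp
    | add s t hs ht => simp only [map_add, TensorProduct.add_tmul, hs, ht]
    | tmul a d => rw [twistedMul_eq, twistedAct_tmul_one hA.mul_one h₂, hD.mul_one]
  isYDHom_mul := IsYDHom.twistedAct hA.isYDHom_mul hD.isYDHom_mul hσ
  isYDHom_unit := isYDHom_unit_tmul hA.isYDHom_unit hD.isYDHom_unit

end Twisted

section Braided

variable {k B : Type*} [Field k] [Ring B] [HopfAlgebra k B]
  {A D : Type*} [AddCommMonoid A] [Module k A]
  [AddCommMonoid D] [Module k D] [YDStruct k B A] [YDStruct k B D]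
  [IsModuleComodule k B A] [IsModuleComodule k B D] {mA : A ⊗[k] A →ₗ[k] A}
  {mD : D ⊗[k] D →ₗ[k] D} {u : A} {v : D}

/-- For the braiding, the two identities are naturality with respect to the products. -/
theorem isTwisting_braiding (hA : IsYDHom k B mA) (hD : IsYDHom k B mD) :
    IsTwisting mA mD (ydBraiding k B D A) :=
  ⟨o21_braid hD _, (braid_o21 hA _).symm⟩

theorem _root_.IsYDAlgebra.braidedTensor (hA : IsYDAlgebra B mA u) (hD : IsYDAlgebra B mD v)
    (hσ : IsYDHom k B (ydBraiding k B D A)) :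
    IsYDAlgebra B (braidedTensorMul B mA mD) (u ⊗ₜ v) :=
  hA.twisted hD (isTwisting_braiding hA.isYDHom_mul hD.isYDHom_mul) hσ
    (fun a => eq_of_uncur fun γ => ev_congr (o01_braid hD.isYDHom_unit γ) a)
    (fun d => eq_of_uncur fun γ => ev_congr (braid_o01 hA.isYDHom_unit γ) d)

end Braided

/-! ### Words evaluated on tensors -/

section Tensors

variable {k : Type*} [Field k] {V W X Y P Q : Type*} [AddCommMonoid V] [Module k V]
  [AddCommMonoid W] [Module k W] [AddCommMonoid X] [Module k X] [AddCommMonoid Y] [Module k Y]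
  [AddCommMonoid P] [Module k P] [AddCommMonoid Q] [Module k Q] {Z : Tgt k}

theorem uncur_rTensor (f : V →ₗ[k] X ⊗[k] Y) (γ : (hom X (hom Y (hom W Z))).carrier)
    (t : V ⊗[k] W) : uncur (o12 f γ) t =
      uncur (wh (o12 .id) γ) (TensorProduct.assoc k X Y W (f.rTensor W t)) := by
  induction t with
  | zero => simp
  | add s t hs ht => simp only [map_add, hs, ht]
  | tmul v w =>
    rw [uncur_tmul, o12_apply, LinearMap.rTensor_tmul]
    induction f v with
    | zero => simp
    | add s t hs ht => simp only [map_add, add_ev, TensorProduct.add_tmul, hs, ht]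
    | tmul x y => rfl

theorem uncur_lTensor (f : V →ₗ[k] X ⊗[k] Y) (γ : (hom W (hom X (hom Y Z))).carrier)
    (t : W ⊗[k] V) : uncur (wh (o12 f) γ) t = uncur (wh (o12 .id) γ) (f.lTensor W t) := by
  induction t with
  | zero => simp
  | add s t hs ht => simp only [map_add, hs, ht]
  | tmul v w => simp

theorem uncur_rTensor₁ (f : V →ₗ[k] X) (γ : (hom X (hom W Z)).carrier)
    (t : V ⊗[k] W) : uncur (o11 f γ) t = uncur γ (f.rTensor W t) := by
  induction t with
  | zero => simp
  | add s t hs ht => simp only [map_add, hs, ht]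
  | tmul v w => rfl

theorem uncur_lTensor₁ (f : V →ₗ[k] X) (γ : (hom W (hom X Z)).carrier)
    (t : W ⊗[k] V) : uncur (wh (o11 f) γ) t = uncur γ (f.lTensor W t) := by
  induction t with
  | zero => simp
  | add s t hs ht => simp only [map_add, hs, ht]
  | tmul v w => rfl

theorem uncur_rTensor₀ (f : V →ₗ[k] k) (γ : (hom W Z).carrier)
    (t : V ⊗[k] W) : uncur (o10 f γ) t = γ (TensorProduct.lid k W (f.rTensor W t)) := by
  induction t with
  | zero => simp
  | add s t hs ht => simp only [map_add, hs, ht, ev_add]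
  | tmul v w => simp

theorem uncur_lTensor₀ (f : V →ₗ[k] k) (γ : (hom W Z).carrier)
    (t : W ⊗[k] V) : uncur (wh (o10 f) γ) t = γ (TensorProduct.rid k W (f.lTensor W t)) := by
  induction t with
  | zero => simp
  | add s t hs ht => simp only [map_add, hs, ht, ev_add]
  | tmul v w => simp

theorem uncur_mul (f : X ⊗[k] Y →ₗ[k] W) (γ : (hom W Z).carrier) (t : X ⊗[k] Y) :
    uncur (o21 f γ) t = γ (f t) := by
  induction t with
  | zero => simp
  | add s t hs ht => simp only [map_add, hs, ht, ev_add]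
  | tmul v w => rfl

/-- The twisted action of `f x` on `g y`. -/
theorem twistedAct_comp (mA : X ⊗[k] X →ₗ[k] X) (l : Y ⊗[k] W →ₗ[k] W)
    (σ : Y ⊗[k] X →ₗ[k] X ⊗[k] Y) (f : P →ₗ[k] X ⊗[k] Y) (g : Q →ₗ[k] X ⊗[k] W)
    (γ : (hom X (hom W Z)).carrier) (x : P) (y : Q) :
    uncur γ (twistedAct mA l σ (f x ⊗ₜ g y)) =
      (o12 f ⋄ ↓2(o12 g) ⋄ ↓1(o22 σ) ⋄ o21 mA ⋄ ↓1(o21 l) ⋄ γ) x y := by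
  rw [o12_apply]
  induction f x with
  | zero => simp
  | add s t hs ht => simp only [map_add, TensorProduct.add_tmul, add_ev, hs, ht]
  | tmul a d => rw [twistedAct_right]; rfl

end Tensors

/-! In the words below, `χ` is the braiding, `μ`, `δ`, `ε`, `η` and `S` are the product, the
coproduct, the counit, the unit and the antipode, and `κ` is the coaction of `B`. -/

section Calculus

set_option linter.unusedSectionVars false

variable {k B : Type*} [Field k] [Ring B] [HopfAlgebra k B]

local notation "χ" => o22 (ydBraiding k B _ _)
local notation "μ" => o21 (LinearMap.mul' k _)
local notation "δ" => o12 (Coalgebra.comul (R := k) (A := _))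
local notation "ε" => o10 (Coalgebra.counit (R := k) (A := _))
local notation "η" => o01 (1 : _)
local notation "S" => o11 (braidedAntipode k B _)
local notation "κ" => o12 (ydCoact k B _)

/-! ### Words in a braided Hopf algebra -/

section Hopf

variable {H : Type*} [Ring H] [Algebra k H] {Z : Tgt k}

theorem mul_mul (γ : (hom H Z).carrier) : μ ⋄ μ ⋄ γ = ↓1 μ ⋄ μ ⋄ γ :=
  assoc_word (fun x y z => by simp [mul_assoc]) γ

theorem one_mul_word (γ : (hom H Z).carrier) : η ⋄ μ ⋄ γ = γ := hom_ext fun _ => by simp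
theorem mul_one_word (γ : (hom H Z).carrier) : ↓1 η ⋄ μ ⋄ γ = γ := hom_ext fun _ => by simp

variable [Coalgebra k H]

theorem comul_comul (γ : (hom H (hom H (hom H Z))).carrier) : δ ⋄ δ ⋄ γ = δ ⋄ ↓1 δ ⋄ γ :=
  hom_ext fun x => by
    rw [o12_apply, o12_apply, uncur_rTensor, Coalgebra.coassoc_apply, ← uncur_lTensor]

theorem comul_counit (γ : (hom H Z).carrier) : δ ⋄ ε ⋄ γ = γ :=
  hom_ext fun x => by
    rw [o12_apply, uncur_rTensor₀, Coalgebra.rTensor_counit_comul]; simp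

theorem comul_counit' (γ : (hom H Z).carrier) : δ ⋄ ↓1 ε ⋄ γ = γ :=
  hom_ext fun x => by
    rw [o12_apply, uncur_lTensor₀, Coalgebra.lTensor_counit_comul]; simp

theorem one_comul (B : Type*) [Ring B] [HopfAlgebra k B]
    [YDModule k B H] [BraidedHopfAlgebra k B H] (γ : (hom H (hom H Z)).carrier) :
    η ⋄ δ ⋄ γ = η ⋄ η ⋄ γ := by
  rw [o01_apply, o12_apply, BraidedHopfAlgebra.comul_one B]; rfl

theorem one_counit (B : Type*) [Ring B] [HopfAlgebra k B]
    [YDModule k B H] [BraidedHopfAlgebra k B H] (γ : Z.carrier) : o01 (1 : H) ⋄ ε ⋄ γ = γ := by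
  rw [o01_apply, o10_apply, BraidedHopfAlgebra.counit_one B, one_smul]

theorem mul_counit (B : Type*) [Ring B] [HopfAlgebra k B]
    [YDModule k B H] [BraidedHopfAlgebra k B H] (γ : Z.carrier) :
    o21 (LinearMap.mul' k H) ⋄ ε ⋄ γ = ε ⋄ ε ⋄ γ :=
  hom_ext fun _ => hom_ext fun _ => by
    simp [BraidedHopfAlgebra.counit_mul B, mul_smul]

variable [YDModule k B H] [BraidedHopfAlgebra k B H]

variable (B)

/-- The coproduct is multiplicative for the braided tensor product. -/
theorem mul_comul (γ : (hom H (hom H Z)).carrier) :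
    μ ⋄ δ ⋄ γ = δ ⋄ ↓2 δ ⋄ ↓1 χ ⋄ μ ⋄ ↓1 μ ⋄ γ :=
  hom_ext fun x => hom_ext fun y => by
    rw [o21_apply, o12_apply, LinearMap.mul'_apply, BraidedHopfAlgebra.comul_mul (B := B),
      braidedTensorMul, twistedMul_eq, twistedAct_comp]

theorem antipode_mul_left (γ : (hom H Z).carrier) : δ ⋄ S ⋄ μ ⋄ γ = ε ⋄ η ⋄ γ :=
  hom_ext fun x => by
    rw [o12_apply, uncur_rTensor₁, uncur_mul]
    have := DFunLike.congr_fun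
      (BraidedHopfAlgebra.mul_antipode_rTensor_comul (k := k) (B := B) (H := H)) x
    simp only [LinearMap.comp_apply, Algebra.linearMap_apply,
      Algebra.algebraMap_eq_smul_one] at this
    rw [braidedAntipode, this, ev_smul]; rfl

theorem antipode_mul_right (γ : (hom H Z).carrier) : δ ⋄ ↓1 S ⋄ μ ⋄ γ = ε ⋄ η ⋄ γ :=
  hom_ext fun x => by
    rw [o12_apply, uncur_lTensor₁, uncur_mul]
    have := DFunLike.congr_fun
      (BraidedHopfAlgebra.mul_antipode_lTensor_comul (k := k) (B := B) (H := H)) x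
    simp only [LinearMap.comp_apply, Algebra.linearMap_apply,
      Algebra.algebraMap_eq_smul_one] at this
    rw [braidedAntipode, this, ev_smul]; rfl

variable (k H)

theorem isYDHom_mul : IsYDHom k B (LinearMap.mul' k H) :=
  (BraidedHopfAlgebra.isYDAlgebra (k := k) (B := B) (H := H)).isYDHom_mul
theorem isYDHom_one : IsYDHom k B (LinearMap.toSpanSingleton k H 1) :=
  (BraidedHopfAlgebra.isYDAlgebra (k := k) (B := B) (H := H)).isYDHom_unit
theorem isYDHom_comul : IsYDHom k B (Coalgebra.comul (R := k) (A := H)) :=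
  BraidedHopfAlgebra.isYDHom_comul
theorem isYDHom_counit : IsYDHom k B (Coalgebra.counit (R := k) (A := H)) :=
  BraidedHopfAlgebra.isYDHom_counit
theorem isYDHom_antipode : IsYDHom k B (braidedAntipode k B H) :=
  BraidedHopfAlgebra.isYDHom_antipode

end Hopf

/-! ### Words in a module algebra -/

section Smash

variable {H A : Type*} [Ring H] [Algebra k H] [Coalgebra k H] [YDStruct k B H]
  [AddCommMonoid A] [Module k A] [YDStruct k B A] {Z : Tgt k}

variable {m : A ⊗[k] A →ₗ[k] A} {u : A} {α : H ⊗[k] A →ₗ[k] A}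

variable (B) in
/-- The right-hand side of the module algebra axiom is the word of its string diagram. -/
theorem module_algebra_apply (m : A ⊗[k] A →ₗ[k] A) (α : H ⊗[k] A →ₗ[k] A)
    (γ : (hom A Z).carrier) (h : H) (a b : A) :
    γ ((m ∘ₗ TensorProduct.map α α
    ∘ₗ (TensorProduct.assoc k H A (H ⊗[k] A)).symm.toLinearMap
    ∘ₗ ((TensorProduct.assoc k A H A).toLinearMap
        ∘ₗ (ydBraiding k B H A).rTensor A
        ∘ₗ (TensorProduct.assoc k H A A).symm.toLinearMap).lTensor H
    ∘ₗ (TensorProduct.assoc k H H (A ⊗[k] A)).toLinearMap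
    ∘ₗ (Coalgebra.comul (R := k) (A := H)).rTensor (A ⊗[k] A)) (h ⊗ₜ (a ⊗ₜ b))) =
    (δ ⋄ ↓1 χ ⋄ o21 α ⋄ ↓1(o21 α) ⋄ o21 m ⋄ γ) h a b := by
  simp only [LinearMap.comp_apply, LinearMap.rTensor_tmul, o12_apply]
  induction Coalgebra.comul (R := k) h with
  | zero => simp
  | add s t hs ht => simp only [map_add, TensorProduct.add_tmul, add_ev, ev_add, hs, ht]
  | tmul x y =>
    simp only [LinearEquiv.coe_coe, TensorProduct.assoc_tmul, LinearMap.lTensor_tmul,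
      LinearMap.comp_apply, TensorProduct.assoc_symm_tmul, LinearMap.rTensor_tmul, uncur_tmul,
      wh_apply, o22_apply]
    induction ydBraiding k B H A (y ⊗ₜ a) with
    | zero => simp
    | add s t hs ht =>
      simp only [map_add, TensorProduct.add_tmul, TensorProduct.tmul_add, add_ev, ev_add, hs, ht]
    | tmul x y => simp

theorem act_mul_word (h : IsYDModuleAlgebra B m u α) (γ : (hom A Z).carrier) :
    ↓1(o21 m) ⋄ o21 α ⋄ γ = δ ⋄ ↓1 χ ⋄ o21 α ⋄ ↓1(o21 α) ⋄ o21 m ⋄ γ :=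
  hom_ext fun x => hom_ext fun a => hom_ext fun b => by
    rw [← module_algebra_apply, ← h.act_mul]; simp

/-- The module algebra axiom follows from its identity of words. -/
theorem act_mul_of_word (h : ∀ γ : (hom A (Tgt.of k A)).carrier,
      ↓1(o21 m) ⋄ o21 α ⋄ γ = δ ⋄ ↓1 χ ⋄ o21 α ⋄ ↓1(o21 α) ⋄ o21 m ⋄ γ) :
    α ∘ₗ m.lTensor H = m ∘ₗ TensorProduct.map α α
    ∘ₗ (TensorProduct.assoc k H A (H ⊗[k] A)).symm.toLinearMap
    ∘ₗ ((TensorProduct.assoc k A H A).toLinearMap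
        ∘ₗ (ydBraiding k B H A).rTensor A
        ∘ₗ (TensorProduct.assoc k H A A).symm.toLinearMap).lTensor H
    ∘ₗ (TensorProduct.assoc k H H (A ⊗[k] A)).toLinearMap
    ∘ₗ (Coalgebra.comul (R := k) (A := H)).rTensor (A ⊗[k] A) := by
  refine TensorProduct.ext <| LinearMap.ext fun x => TensorProduct.ext' fun a b => ?_
  let i : (hom A (Tgt.of k A)).carrier := LinearMap.id
  exact (ev_congr (ev_congr (ev_congr (h i) x) a) b).trans (module_algebra_apply B m α i x a b).symm

theorem act_act (h : IsYDModuleAlgebra B m u α) (γ : (hom A Z).carrier) :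
    μ ⋄ o21 α ⋄ γ = ↓1(o21 α) ⋄ o21 α ⋄ γ :=
  assoc_act_word (by simpa using h.mul_act) γ

theorem one_act_word (h : IsYDModuleAlgebra B m u α) (γ : (hom A Z).carrier) :
    o01 (1 : H) ⋄ o21 α ⋄ γ = γ := hom_ext fun x => by simp [h.one_act]

theorem act_one_word (h : IsYDModuleAlgebra B m u α) (γ : (hom A Z).carrier) :
    ↓1(o01 u) ⋄ o21 α ⋄ γ = ε ⋄ o01 u ⋄ γ := hom_ext fun x => by simp [h.act_one]

variable (B) in
/-- The twist `D ⊗ A → A ⊗ D` underlying the smash product. -/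
noncomputable def smashTwist (α : H ⊗[k] A →ₗ[k] A) : H ⊗[k] A →ₗ[k] A ⊗[k] H :=
    α.rTensor H
      ∘ₗ (TensorProduct.assoc k H A H).symm.toLinearMap
      ∘ₗ (ydBraiding k B H A).lTensor H
      ∘ₗ (TensorProduct.assoc k H H A).toLinearMap
      ∘ₗ (Coalgebra.comul (R := k) (A := H)).rTensor A

theorem smashMul_eq : smashMul B m α = twistedMul m (LinearMap.mul' k H) (smashTwist B α) := rfl

theorem smashTwist_word (γ : (hom A (hom H Z)).carrier) :
    o22 (smashTwist B α) ⋄ γ = δ ⋄ ↓1 χ ⋄ o21 α ⋄ γ :=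
  hom_ext fun x => hom_ext fun a => by
    simp only [smashTwist, LinearMap.comp_apply, LinearMap.rTensor_tmul, o12_apply, o22_apply]
    induction Coalgebra.comul (R := k) x with
    | zero => simp
    | add s t hs ht => simp only [map_add, TensorProduct.add_tmul, add_ev, hs, ht]
    | tmul x y =>
      simp only [LinearEquiv.coe_coe, TensorProduct.assoc_tmul, LinearMap.lTensor_tmul, uncur_tmul,
        wh_apply, o22_apply]
      induction ydBraiding k B H A (y ⊗ₜ a) with
      | zero => simp
      | add s t hs ht =>
        simp only [map_add, TensorProduct.tmul_add, hs, ht]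
      | tmul x y => simp

end Smash

/-! ### Smash products -/

section SmashAlgebra

variable {H A : Type*} [Ring H] [Algebra k H] [Coalgebra k H] [YDModule k B H]
  [BraidedHopfAlgebra k B H]
  [AddCommMonoid A] [Module k A] [YDStruct k B A] [IsModuleComodule k B A] {Z : Tgt k}

variable {m : A ⊗[k] A →ₗ[k] A} {u : A} {α : H ⊗[k] A →ₗ[k] A}

theorem isTwisting_smashTwist (h : IsYDModuleAlgebra B m u α) :
    IsTwisting m (LinearMap.mul' k H) (smashTwist B α) where
  mul_left := by
    let γ := pair k A H
    calc
    _ = δ ⋄ ↓2 δ ⋄ ↓1 χ ⋄ μ ⋄ ↓1 μ ⋄ ↓1 χ ⋄ o21 α ⋄ γ := by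
      rw [smashTwist_word, mul_comul B]
    _ = δ ⋄ ↓2 δ ⋄ ↓1 χ ⋄ ↓3 χ ⋄ ↓2 χ ⋄ μ ⋄ o21 α ⋄ ↓1 μ ⋄ γ := by
      rw [wh23 (o21_braid (isYDHom_mul k B H))]; simp
    _ = δ ⋄ ↓2 δ ⋄ ↓3 χ ⋄ ↓2 (o21 α) ⋄ ↓1 χ ⋄ o21 α ⋄ ↓1 μ ⋄ γ := by
      rw [act_act h, wh23 (fun γ => (braid_o21 h.isYDHom γ).symm)]; simp
    _ = _ := by
      rw [smashTwist_word, wh13 smashTwist_word]; simp [γ]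
  mul_right := by
    let γ := pair k A H
    calc
    _ = δ ⋄ ↓2 (o21 m) ⋄ ↓1 χ ⋄ o21 α ⋄ γ := by
      rw [smashTwist_word]; simp [γ]
    _ = δ ⋄ ↓1 χ ⋄ ↓2 χ ⋄ δ ⋄ ↓1 χ ⋄ o21 α ⋄ ↓1(o21 α) ⋄ o21 m ⋄ γ := by
      rw [wh23 (fun γ => (braid_o21 h.isYDAlgebra.isYDHom_mul γ).symm), act_mul_word h]
    _ = δ ⋄ ↓1 δ ⋄ ↓2 χ ⋄ ↓1 χ ⋄ ↓3 χ ⋄ o21 α ⋄ ↓1(o21 α) ⋄ o21 m ⋄ γ := by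
      rw [← comul_comul]; simp
    _ = δ ⋄ ↓1 χ ⋄ o21 α ⋄ ↓1 δ ⋄ ↓2 χ ⋄ ↓1(o21 α) ⋄ o21 m ⋄ γ := by
      rw [wh32 (o12_braid (isYDHom_comul k B H))]; simp
    _ = _ := by rw [smashTwist_word, wh13 smashTwist_word]

theorem smashTwist_one (h : IsYDModuleAlgebra B m u α) (a : A) :
    smashTwist B α (1 ⊗ₜ a) = a ⊗ₜ 1 := by
  refine eq_of_uncur fun γ => ?_
  have : η ⋄ o22 (smashTwist B α) ⋄ γ = ↓1 η ⋄ γ := by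
    rw [smashTwist_word, one_comul B, o01_wh, o01_braid (isYDHom_one k B H), one_act_word h]
  exact (ev_congr this a)

theorem smashTwist_tmul_one (h : IsYDModuleAlgebra B m u α) (x : H) :
    smashTwist B α (x ⊗ₜ u) = u ⊗ₜ x := by
  refine eq_of_uncur fun γ => ?_
  have : ↓1(o01 u) ⋄ o22 (smashTwist B α) ⋄ γ = o01 u ⋄ γ := by
    rw [smashTwist_word, ← o12_wh, wh21 (braid_o01 h.isYDAlgebra.isYDHom_unit), act_one_word h,
      comul_counit]
  exact (ev_congr this x)

theorem _root_.IsYDHom.smashTwist (hα : IsYDHom k B α) (hC : IsYDHom k B (ydBraiding k B H A)) :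
    IsYDHom k B (smashTwist B α) :=
  hα.rTensor.comp (isYDHom_assoc.symm.comp (hC.lTensor.comp
    (isYDHom_assoc.comp (isYDHom_comul k B H).rTensor)))

/-- The smash product of a module algebra is an algebra. -/
theorem _root_.IsYDModuleAlgebra.smash (h : IsYDModuleAlgebra B m u α)
    (hC : IsYDHom k B (ydBraiding k B H A)) : IsYDAlgebra B (smashMul B m α) (u ⊗ₜ 1) :=
  h.isYDAlgebra.twisted BraidedHopfAlgebra.isYDAlgebra (isTwisting_smashTwist h)
    (h.isYDHom.smashTwist hC) (smashTwist_one h) (smashTwist_tmul_one h)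

/-- The action `(a # h) · x = a (h · x)` of `A # H` on `A`. -/
noncomputable def smashAct (m : A ⊗[k] A →ₗ[k] A) (α : H ⊗[k] A →ₗ[k] A) :
    (A ⊗[k] H) ⊗[k] A →ₗ[k] A :=
  m ∘ₗ α.lTensor A ∘ₗ (TensorProduct.assoc k A H A).toLinearMap

@[simp] theorem smashAct_tmul (m : A ⊗[k] A →ₗ[k] A) (α : H ⊗[k] A →ₗ[k] A) (a x : A) (h : H) :
    smashAct m α ((a ⊗ₜ h) ⊗ₜ x) = m (a ⊗ₜ α (h ⊗ₜ x)) := rfl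

/-- The action of `A # H` on `A` is associative, as an identity of words. -/
theorem smashAct_word (h : IsYDModuleAlgebra B m u α) (γ : (hom A Z).carrier) :
    ↓1(o22 (smashTwist B α)) ⋄ o21 m ⋄ ↓1 μ ⋄ ↓1(o21 α) ⋄ o21 m ⋄ γ =
      ↓3(o21 α) ⋄ ↓2(o21 m) ⋄ ↓1(o21 α) ⋄ o21 m ⋄ γ := calc
  _ = ↓1 δ ⋄ ↓2 χ ⋄ ↓1(o21 α) ⋄ o21 m ⋄ ↓2(o21 α) ⋄ ↓1(o21 α) ⋄ o21 m ⋄ γ := by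
    rw [wh13 smashTwist_word, wh22 (act_act h)]
  _ = ↓3(o21 α) ⋄ ↓1 δ ⋄ ↓2 χ ⋄ ↓1(o21 α) ⋄ ↓2(o21 α) ⋄ ↓1(o21 m) ⋄ o21 m ⋄ γ := by
    rw [← assoc_word h.isYDAlgebra.assoc]; simp
  _ = _ := by
    rw [wh25 (act_mul_word h)]

theorem smashAct_smashMul (h : IsYDModuleAlgebra B m u α) (s t : A ⊗[k] H) (x : A) :
    smashAct m α (smashMul B m α (s ⊗ₜ t) ⊗ₜ x) =
      smashAct m α (s ⊗ₜ smashAct m α (t ⊗ₜ x)) := by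
  induction s with
  | zero => simp
  | add s t hs ht => simp only [map_add, TensorProduct.add_tmul, hs, ht]
  | tmul a d =>
    induction t with
    | zero => simp
    | add s t hs ht => simp only [map_add, TensorProduct.add_tmul, TensorProduct.tmul_add, hs, ht]
    | tmul a' d' =>
      let i : (hom A (Tgt.of k A)).carrier := LinearMap.id
      have e : ∀ w : A ⊗[k] H, smashAct m α (w ⊗ₜ x) = uncur (↓1(o21 α) ⋄ o21 m ⋄ i) w x := by
        intro w
        induction w with
        | zero => simp; rfl
        | add s t hs ht => simp only [map_add, TensorProduct.add_tmul, add_ev, hs, ht]; rfl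
        | tmul a d => rfl
      rw [e, smashMul_eq, twistedMul_eq, twistedAct_tmul, smashAct_word h]
      rfl

end SmashAlgebra

/-! ### Separating tensors by linear maps -/

section Separation

variable {D X Y R : Type*} [AddCommGroup D] [Module k D]
  [AddCommGroup X] [Module k X] [AddCommGroup Y] [Module k Y] [AddCommGroup R] [Module k R]

/-- A jointly injective family of maps on `D` is jointly injective on `R ⊗ D`: expand along a basis
of `R`. -/
theorem eq_zero_of_lTensor (ℓ : D →ₗ[k] X →ₗ[k] Y) (hℓ : ∀ d, (∀ x, ℓ d x = 0) → d = 0)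
    (T : R ⊗[k] D) (h : ∀ x, (ℓ.flip x).lTensor R T = 0) : T = 0 := by
  classical
  let b := Module.Basis.ofVectorSpace k R
  have nat : ∀ (f : D →ₗ[k] Y) (T : R ⊗[k] D) i,
      TensorProduct.equivFinsuppOfBasisLeft b (f.lTensor R T) i =
        f (TensorProduct.equivFinsuppOfBasisLeft b T i) := by
    intro f T i
    induction T with
    | zero => simp
    | add s t hs ht => simp only [map_add, Finsupp.add_apply, hs, ht]
    | tmul r d => simp
  refine (TensorProduct.equivFinsuppOfBasisLeft b).injective (Finsupp.ext fun i => ?_)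
  rw [map_zero, Finsupp.zero_apply]
  refine hℓ _ fun x => ?_
  rw [← LinearMap.flip_apply, ← nat, h, map_zero, Finsupp.zero_apply]

theorem eq_zero_of_rTensor (ℓ : D →ₗ[k] X →ₗ[k] Y) (hℓ : ∀ d, (∀ x, ℓ d x = 0) → d = 0)
    (T : D ⊗[k] R) (h : ∀ x, (ℓ.flip x).rTensor R T = 0) : T = 0 := by
  have : TensorProduct.comm k D R T = 0 := eq_zero_of_lTensor ℓ hℓ _ fun x => by
    have := congrArg (TensorProduct.comm k Y R) (h x)
    rw [map_zero] at this
    rw [← this]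
    simp [← LinearMap.comm_comp_rTensor_comp_comm_eq]
  simpa using this

theorem eq_of_lTensor (ℓ : D →ₗ[k] X →ₗ[k] Y) (hℓ : ∀ d, (∀ x, ℓ d x = 0) → d = 0)
    {s t : R ⊗[k] D} (h : ∀ x, (ℓ.flip x).lTensor R s = (ℓ.flip x).lTensor R t) : s = t :=
  sub_eq_zero.1 (eq_zero_of_lTensor ℓ hℓ _ fun x => by rw [map_sub, h, sub_self])

theorem eq_of_rTensor (ℓ : D →ₗ[k] X →ₗ[k] Y) (hℓ : ∀ d, (∀ x, ℓ d x = 0) → d = 0)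
    {s t : D ⊗[k] R} (h : ∀ x, (ℓ.flip x).rTensor R s = (ℓ.flip x).rTensor R t) : s = t :=
  sub_eq_zero.1 (eq_zero_of_rTensor ℓ hℓ _ fun x => by rw [map_sub, h, sub_self])

end Separation

/-! ### Coactions of the Hopf algebra `B` -/

section Coaction

variable {V M : Type*} [AddCommMonoid V] [Module k V] [YDStruct k B V] [IsModuleComodule k B V]
  [AddCommMonoid M] [Module k M] {Z : Tgt k}

theorem coact_comul (γ : (hom B (hom B (hom V Z))).carrier) :
    κ ⋄ δ ⋄ γ = κ ⋄ ↓1 κ ⋄ γ := coassoc_apply γ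

theorem coact_counit (γ : (hom V Z).carrier) : κ ⋄ o10 (Coalgebra.counit (A := B)) ⋄ γ = γ :=
  counit_apply γ

theorem hopf_antipode_right (γ : (hom B Z).carrier) :
    δ ⋄ ↓1(o11 (HopfAlgebra.antipode k)) ⋄ μ ⋄ γ = ε ⋄ η ⋄ γ :=
  hom_ext fun x => by
    rw [o12_apply, uncur_lTensor₁, uncur_mul, HopfAlgebra.mul_antipode_lTensor_comul_apply,
      Algebra.algebraMap_eq_smul_one, ev_smul]; rfl

theorem hopf_antipode_left (γ : (hom B Z).carrier) :
    δ ⋄ o11 (HopfAlgebra.antipode k) ⋄ μ ⋄ γ = ε ⋄ η ⋄ γ :=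
  hom_ext fun x => by
    rw [o12_apply, uncur_rTensor₁, uncur_mul, HopfAlgebra.mul_antipode_rTensor_comul_apply,
      Algebra.algebraMap_eq_smul_one, ev_smul]; rfl

/-- For a right `B`-module `M` and a `B`-comodule `V`, the map `m ⊗ v ↦ ∑ m v₍₋₁₎ ⊗ v₍₀₎` has the
left inverse `m ⊗ v ↦ ∑ m S(v₍₋₁₎) ⊗ v₍₀₎`. -/
theorem coact_cancel {a : M ⊗[k] B →ₗ[k] M} (h₁ : ∀ m, a (m ⊗ₜ 1) = m)
    (h₂ : ∀ m b c, a (a (m ⊗ₜ b) ⊗ₜ c) = a (m ⊗ₜ (b * c))) (γ : (hom M (hom V Z)).carrier) :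
    ↓1 κ ⋄ o21 a ⋄ ↓1 κ ⋄ ↓1(o11 (HopfAlgebra.antipode k)) ⋄ o21 a ⋄ γ = γ := by
  have ha : ∀ {Z : Tgt k} (γ : (hom M Z).carrier), o21 a ⋄ o21 a ⋄ γ = ↓1 μ ⋄ o21 a ⋄ γ :=
    fun γ => hom_ext fun _ => hom_ext fun _ => hom_ext fun _ => by simp [h₂]
  have hu : ↓1(o01 (1 : B)) ⋄ o21 a ⋄ γ = γ := hom_ext fun _ => by simp [h₁]
  have hb : ∀ γ : (hom B (hom V Z)).carrier,
      κ ⋄ ↓1 κ ⋄ ↓1(o11 (HopfAlgebra.antipode k)) ⋄ μ ⋄ γ = η ⋄ γ := fun γ => by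
    rw [← coact_comul, hopf_antipode_right, coact_counit]
  calc
  _ = ↓1 κ ⋄ ↓2 κ ⋄ ↓2(o11 (HopfAlgebra.antipode k)) ⋄ o21 a ⋄ o21 a ⋄ γ := by simp
  _ = _ := by rw [ha, wh41 hb, hu]

end Coaction

/-! ### The pairing and the symmetry of the braiding -/

section Pairing

variable {H F : Type*} [Ring H] [Algebra k H] [Coalgebra k H] [YDModule k B H]
  [Ring F] [Algebra k F] [Coalgebra k F] [YDModule k B F] {Z : Tgt k}

variable {p : F ⊗[k] H →ₗ[k] k}

theorem pairTwo_tmul (f g : F) (x y : H) (γ : Z.carrier) :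
    pairTwo B p ((f ⊗ₜ g) ⊗ₜ (x ⊗ₜ y)) • γ = (↓1 χ ⋄ o20 p ⋄ o20 p ⋄ γ) f g x y := by
  simp only [pairTwo, LinearMap.comp_apply, LinearEquiv.coe_coe, TensorProduct.assoc_tmul,
    LinearMap.lTensor_tmul, TensorProduct.assoc_symm_tmul, LinearMap.rTensor_tmul, wh_apply,
    o22_apply]
  induction ydBraiding k B F H (g ⊗ₜ x) with
  | zero => simp
  | add s t hs ht =>
    simp only [map_add, TensorProduct.add_tmul, TensorProduct.tmul_add, add_ev, add_smul, hs, ht]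
  | tmul a d => simp [mul_smul]

variable [BraidedHopfAlgebra k B H] [BraidedHopfAlgebra k B F]

/-- Multiplicativity of the pairing in the second argument. -/
theorem mul_pair (hp : IsQuasiDual B p) (γ : Z.carrier) :
    ↓1 μ ⋄ o20 p ⋄ γ = δ ⋄ ↓1 χ ⋄ o20 p ⋄ o20 p ⋄ γ :=
  hom_ext fun f => hom_ext fun x => hom_ext fun y => by
    rw [wh_apply, o21_apply, o20_apply, LinearMap.mul'_apply, hp.pair_mul_right, o12_apply]
    induction Coalgebra.comul (R := k) f with
    | zero => simp
    | add s t hs ht => simp only [map_add, TensorProduct.add_tmul, add_ev, add_smul, hs, ht]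
    | tmul a d => rw [pairTwo_tmul]; rfl

/-- Multiplicativity of the pairing in the first argument. -/
theorem mul_pair' (hp : IsQuasiDual B p) (γ : Z.carrier) :
    μ ⋄ o20 p ⋄ γ = ↓2 δ ⋄ ↓1 χ ⋄ o20 p ⋄ o20 p ⋄ γ :=
  hom_ext fun f => hom_ext fun g => hom_ext fun x => by
    rw [o21_apply, o20_apply, LinearMap.mul'_apply, hp.pair_mul_left, wh_apply, wh_apply, o12_apply]
    induction Coalgebra.comul (R := k) x with
    | zero => simp
    | add s t hs ht => simp only [map_add, TensorProduct.tmul_add, add_smul, hs, ht]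
    | tmul a d => rw [pairTwo_tmul]; rfl

theorem one_pair (hp : IsQuasiDual B p) (γ : Z.carrier) : ↓1 η ⋄ o20 p ⋄ γ = ε ⋄ γ :=
  hom_ext fun f => by simp [hp.pair_one_right]

theorem one_pair' (hp : IsQuasiDual B p) (γ : Z.carrier) : η ⋄ o20 p ⋄ γ = ε ⋄ γ :=
  hom_ext fun f => by simp [hp.pair_one_left]

theorem antipode_pair (hp : IsQuasiDual B p) (γ : Z.carrier) :
    S ⋄ o20 p ⋄ γ = ↓1 S ⋄ o20 p ⋄ γ :=
  hom_ext fun f => hom_ext fun g => by simp [hp.pair_antipode]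

theorem uncur_wh {V W : Type*} [AddCommMonoid V] [Module k V] [AddCommMonoid W] [Module k W]
    {Z' : Tgt k} (d : Mor Z Z') (γ : (hom V (hom W Z)).carrier) (t : V ⊗[k] W) :
    uncur (↓2 d ⋄ γ) t = d (uncur γ t) := lift_comp d γ t

theorem uncur_braid {V W : Type*} [AddCommMonoid V] [Module k V] [AddCommMonoid W] [Module k W]
    [YDStruct k B V] [YDStruct k B W] (γ : (hom W (hom V Z)).carrier) (t : V ⊗[k] W) :
    uncur (χ ⋄ γ) t = uncur γ (ydBraiding k B V W t) :=
  DFunLike.congr_fun (show uncur (χ ⋄ γ) = uncur γ ∘ₗ ydBraiding k B V W from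
      TensorProduct.ext' fun _ _ => rfl) t

theorem symm_word (hs : ydBraiding k B H H ∘ₗ ydBraiding k B H H = LinearMap.id)
    (γ : (hom H (hom H Z)).carrier) : χ ⋄ χ ⋄ γ = γ :=
  hom_ext fun x => hom_ext fun y => by
    rw [o22_apply, uncur_braid]
    exact congrArg (uncur γ) (DFunLike.congr_fun hs (x ⊗ₜ y))

/-- The braiding of a functional past an argument can be moved to the other argument. -/
theorem braid_pair (hp : IsYDHom k B p)
    (hs : ydBraiding k B H H ∘ₗ ydBraiding k B H H = LinearMap.id) (γ : (hom H Z).carrier) :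
    χ ⋄ ↓1(o20 p) ⋄ γ = ↓1 χ ⋄ o20 p ⋄ γ := by
  rw [o20_braid (V := H) hp, wh20 (symm_word hs)]

/-- `C_{F,H} C_{H,F} = 1`, by faithfulness. -/
theorem symm_left (hp : IsYDHom k B p) (hf : IsLeftFaithful p)
    (hs : ydBraiding k B H H ∘ₗ ydBraiding k B H H = LinearMap.id) (γ : (hom H (hom F Z)).carrier) :
    χ ⋄ χ ⋄ γ = γ := by
  refine hom_ext fun y => hom_ext fun f => ?_
  have key : ydBraiding k B F H (ydBraiding k B H F (y ⊗ₜ f)) = y ⊗ₜ f := by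
    refine eq_of_lTensor (TensorProduct.curry p) hf fun x => ?_
    let γ₀ : (hom H (Tgt.of k (H ⊗[k] k))).carrier := (TensorProduct.mk k H k).flip 1
    have e : ∀ t : H ⊗[k] F, ((TensorProduct.curry p).flip x).lTensor H t =
        uncur (↓1(o20 p) ⋄ γ₀) t x := fun t => by
      induction t with
      | zero => simp; rfl
      | add s t hs ht => simp only [map_add, add_ev, hs, ht]; rfl
      | tmul y f =>
        have : y ⊗ₜ[k] p (f ⊗ₜ x) = p (f ⊗ₜ x) • y ⊗ₜ[k] (1 : k) := by
          rw [← TensorProduct.tmul_smul]; simp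
        exact this
    rw [e, e, ← uncur_braid, ← uncur_braid]
    have : χ ⋄ χ ⋄ ↓1(o20 p) ⋄ γ₀ = ↓1(o20 p) ⋄ γ₀ := by
      rw [braid_pair hp hs, braid_o20 hp]
    rw [this]
  rw [o22_apply, uncur_braid, key]; rfl

/-- `C_{H,F} C_{F,H} = 1`. -/
theorem symm_right (hp : IsYDHom k B p) (hf : IsLeftFaithful p)
    (hs : ydBraiding k B H H ∘ₗ ydBraiding k B H H = LinearMap.id) (γ : (hom F (hom H Z)).carrier) :
    χ ⋄ χ ⋄ γ = γ := by
  let a : (H →ₗ[k] k) ⊗[k] B →ₗ[k] (H →ₗ[k] k) := TensorProduct.lift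
    (LinearMap.lcomp k (H →ₗ[k] k) (YDStruct.act (k := k) (B := B) (V := H)) ∘ₗ
      LinearMap.llcomp k H H k)
  have ha : ∀ φ b x, a (φ ⊗ₜ b) x = φ (YDStruct.act b x) := fun _ _ _ => rfl
  refine hom_ext fun f => hom_ext fun y => ?_
  -- It suffices to compare `g t = ∑ ⟨f, y₍₋₁₎ · -⟩ ⊗ y₍₀₎` for `t = f ⊗ y` and its double braiding:
  -- `g` evaluated at `x` is `⟨f, -⟩` after the braiding of `y` and `x`, and `coact_cancel`
  -- recovers `t`.
  have key : ydBraiding k B H F (ydBraiding k B F H (f ⊗ₜ y)) = f ⊗ₜ y := by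
    let L : F →ₗ[k] H →ₗ[k] k := TensorProduct.curry p
    let g : F ⊗[k] H →ₗ[k] (H →ₗ[k] k) ⊗[k] H :=
      uncur (o11 L ⋄ ↓1(o12 (ydCoact k B H)) ⋄ o21 a ⋄ pair k (H →ₗ[k] k) H)
    have hg : ∀ {Z : Tgt k} (γ : (hom (H →ₗ[k] k) (hom H Z)).carrier) (t : F ⊗[k] H),
        uncur (o11 L ⋄ ↓1(o12 (ydCoact k B H)) ⋄ o21 a ⋄ γ) t = uncur γ (g t) := by
      intro Z γ t
      rw [eq_wh_pair γ, o21_wh, wh22 (o12_wh _ _), o11_wh, uncur_wh]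
      rw [← eq_wh_pair γ]; rfl
    let γ₁ : (hom H (Tgt.of k (k ⊗[k] H))).carrier := TensorProduct.mk k k H 1
    have hgx : ∀ (x : H) (t : F ⊗[k] H), (LinearMap.id.flip x).rTensor H (g t) =
        uncur (↓1 χ ⋄ o20 p ⋄ γ₁) t x := by
      intro x t
      induction t with
      | zero => simp; rfl
      | add s t hs ht => simp only [map_add, add_ev, hs, ht]; rfl
      | tmul f y =>
        have h₁ : g (f ⊗ₜ y) = uncur (ev (o21 a ⋄ pair k (H →ₗ[k] k) H) (L f))
          (ydCoact k B H y) := rfl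
        rw [h₁]
        refine Eq.trans ?_ (braid_apply (k := k) (B := B) (ev (o20 p ⋄ γ₁) f) y x).symm
        induction ydCoact k B H y with
        | zero => simp; rfl
        | add s t hs ht =>
          refine Eq.trans ?_ ((congrArg₂ (· + ·) hs ht).trans (map_add _ _ _).symm)
          rw [map_add]; exact map_add _ _ _
        | tmul b y =>
          have : p (f ⊗ₜ YDStruct.act (k := k) b x) ⊗ₜ[k] y =
              p (f ⊗ₜ YDStruct.act (k := k) b x) • (1 : k) ⊗ₜ[k] y := by
            rw [TensorProduct.smul_tmul']; simp
          exact this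
    have hgs : g (ydBraiding k B H F (ydBraiding k B F H (f ⊗ₜ y))) = g (f ⊗ₜ y) := by
      refine eq_of_rTensor LinearMap.id (fun d h => LinearMap.ext h) fun x => ?_
      rw [hgx, hgx, ← uncur_braid, ← uncur_braid, braid_o20 hp, braid_pair hp hs]
    refine eq_of_rTensor (TensorProduct.curry p) hf fun x => ?_
    let γ₀ : (hom (H →ₗ[k] k) (hom H (Tgt.of k (k ⊗[k] H)))).carrier :=
      TensorProduct.mk k k H ∘ₗ LinearMap.id.flip x
    have e : ∀ t : F ⊗[k] H, ((TensorProduct.curry p).flip x).rTensor H t =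
        uncur (o11 L ⋄ γ₀) t := fun t => by
      induction t with
      | zero => simp; rfl
      | add s t hs ht => simp only [map_add, hs, ht]; rfl
      | tmul f y => rfl
    rw [e, e, ← coact_cancel (B := B) (a := a) (fun φ => LinearMap.ext fun x => by
      rw [ha, IsModuleComodule.one_act]) (fun φ b c => LinearMap.ext fun x => by
      rw [ha, ha, ha, IsModuleComodule.mul_act]) γ₀, hg, hgs, hg]
  rw [o22_apply, uncur_braid, key]; rfl

end Pairing

/-! ### The module algebra structures on `R` and `H` -/

section Actions

variable {H F R : Type*} [Ring H] [Algebra k H] [Coalgebra k H] [YDModule k B H]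
  [Ring F] [Algebra k F] [Coalgebra k F] [YDModule k B F]
  [Ring R] [Algebra k R] [YDModule k B R] {Z : Tgt k}

variable {p : F ⊗[k] H →ₗ[k] k} {ψ : R →ₗ[k] R ⊗[k] F}

/-- The action of `H` on `R` defined by `ψ`, as a word. -/
theorem coactToAct_word (γ : (hom R Z).carrier) :
    o21 (coactToAct B p ψ) ⋄ γ = ↓1(o12 ψ) ⋄ χ ⋄ ↓1 χ ⋄ ↓1(o20 p) ⋄ γ :=
  hom_ext fun h => hom_ext fun r => by
    simp only [coactToAct, LinearMap.comp_apply, LinearMap.lTensor_tmul, o12_apply, o21_apply,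
      wh_apply]
    induction ψ r with
    | zero => simp
    | add s t hs ht => simp only [map_add, TensorProduct.tmul_add, ev_add, hs, ht]
    | tmul x y =>
      simp only [LinearEquiv.coe_coe, TensorProduct.assoc_symm_tmul, LinearMap.rTensor_tmul,
        uncur_tmul, o22_apply]
      induction ydBraiding k B H R (h ⊗ₜ x) with
      | zero => simp
      | add s t hs ht => simp only [map_add, TensorProduct.add_tmul, ev_add, add_ev, hs, ht]
      | tmul x h =>
        simp only [TensorProduct.assoc_tmul, LinearMap.lTensor_tmul, TensorProduct.rid_tmul,
          uncur_tmul, wh_apply, o22_apply, LinearMap.comp_apply, ev_smul]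
        induction ydBraiding k B H F (h ⊗ₜ y) with
        | zero => simp
        | add s t hs ht => simp only [map_add, add_smul, hs, ht]
        | tmul x h => simp

/-- The action of `F` on `H` defined by the pairing, as a word. -/
theorem dualAct_word (γ : (hom H Z).carrier) :
    o21 (dualAct B p) ⋄ γ = ↓1 δ ⋄ χ ⋄ ↓1(o20 p) ⋄ γ :=
  hom_ext fun f => hom_ext fun x => by
    simp only [dualAct, LinearMap.comp_apply, LinearMap.lTensor_tmul, o12_apply, o21_apply,
      wh_apply]
    induction Coalgebra.comul (R := k) x with
    | zero => simp
    | add s t hs ht => simp only [map_add, TensorProduct.tmul_add, ev_add, hs, ht]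
    | tmul x y =>
      simp only [LinearEquiv.coe_coe, TensorProduct.assoc_symm_tmul, LinearMap.rTensor_tmul,
        uncur_tmul, o22_apply]
      induction ydBraiding k B F H (f ⊗ₜ x) with
      | zero => simp
      | add s t hs ht => simp only [map_add, TensorProduct.add_tmul, ev_add, add_ev, hs, ht]
      | tmul x h => simp

theorem comodule_counit (hψ : IsYDComoduleAlgebra B ψ) (γ : (hom R Z).carrier) :
    o12 ψ ⋄ ↓1 ε ⋄ γ = γ := hom_ext fun r => by
  rw [o12_apply, uncur_lTensor₀]
  exact congrArg (ev γ) (DFunLike.congr_fun hψ.counit r)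

theorem comodule_coassoc (hψ : IsYDComoduleAlgebra B ψ) (γ : (hom R (hom F (hom F Z))).carrier) :
    o12 ψ ⋄ o12 ψ ⋄ γ = o12 ψ ⋄ ↓1 δ ⋄ γ := hom_ext fun r => by
  rw [o12_apply, o12_apply, uncur_lTensor (Coalgebra.comul (R := k) (A := F)), uncur_rTensor]
  exact congrArg (uncur (↓1(o12 .id) ⋄ γ)) (DFunLike.congr_fun hψ.coassoc r)

theorem comodule_one (hψ : IsYDComoduleAlgebra B ψ) (γ : (hom R (hom F Z)).carrier) :
    η ⋄ o12 ψ ⋄ γ = η ⋄ η ⋄ γ := by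
  rw [o01_apply, o12_apply, hψ.map_one]; rfl

theorem comodule_mul (hψ : IsYDComoduleAlgebra B ψ) (γ : (hom R (hom F Z)).carrier) :
    μ ⋄ o12 ψ ⋄ γ = o12 ψ ⋄ ↓2(o12 ψ) ⋄ ↓1 χ ⋄ μ ⋄ ↓1 μ ⋄ γ :=
  hom_ext fun x => hom_ext fun y => by
    rw [o21_apply, o12_apply, LinearMap.mul'_apply, hψ.map_mul, braidedTensorMul, twistedMul_eq,
      twistedAct_comp]

theorem isYDHom_coactToAct (hp : IsYDHom k B p) (hψ : IsYDHom k B ψ) :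
    IsYDHom k B (coactToAct B p ψ) :=
  isYDHom_rid.comp ((hp.comp isYDHom_braiding).lTensor.comp (isYDHom_assoc.comp
    (isYDHom_braiding.rTensor.comp (isYDHom_assoc.symm.comp hψ.lTensor))))

variable [BraidedHopfAlgebra k B H] [BraidedHopfAlgebra k B F]

theorem isYDHom_dualAct (hp : IsYDHom k B p) : IsYDHom k B (dualAct B p) :=
  isYDHom_rid.comp (hp.lTensor.comp (isYDHom_assoc.comp
    (isYDHom_braiding.rTensor.comp (isYDHom_assoc.symm.comp (isYDHom_comul k B H).lTensor))))

/-- The coaction `ψ` makes `R` an `H`-module algebra. Both axioms for products need the symmetry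
`symm_left` to undo a double crossing of `H` and `F`. -/
theorem isYDModuleAlgebra_coactToAct (hp : IsQuasiDual B p) (hf : IsLeftFaithful p)
    (hs : ydBraiding k B H H ∘ₗ ydBraiding k B H H = LinearMap.id)
    (hψ : IsYDComoduleAlgebra B ψ) :
    IsYDModuleAlgebra B (LinearMap.mul' k R) 1 (coactToAct B p ψ) where
  isYDAlgebra := hψ.isYDAlgebra
  isYDHom := isYDHom_coactToAct hp.isYDHom hψ.isYDHom
  one_act a := by
    let γ : (hom R (Tgt.of k R)).carrier := LinearMap.id
    have : η ⋄ o21 (coactToAct B p ψ) ⋄ γ = γ := by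
      rw [coactToAct_word, o01_wh, o01_braid (isYDHom_one k B H),
        wh21 (o01_braid (isYDHom_one k B H)), wh21 (one_pair hp), comodule_counit hψ]
    exact (ev_congr this a)
  act_one h := by
    let γ : (hom R (Tgt.of k R)).carrier := LinearMap.id
    have : ↓1 η ⋄ o21 (coactToAct B p ψ) ⋄ γ = ε ⋄ η ⋄ γ := by
      rw [coactToAct_word, wh22 (comodule_one hψ), braid_o01 hψ.isYDAlgebra.isYDHom_unit,
        o01_wh, o01_wh, braid_o01 (isYDHom_one k B F), one_pair' hp]
    exact (ev_congr this h)
  mul_act g h r := by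
    let γ : (hom R (Tgt.of k R)).carrier := LinearMap.id
    have : μ ⋄ o21 (coactToAct B p ψ) ⋄ γ =
        ↓1(o21 (coactToAct B p ψ)) ⋄ o21 (coactToAct B p ψ) ⋄ γ := calc
      _ = ↓2(o12 ψ) ⋄ μ ⋄ χ ⋄ ↓1 χ ⋄ ↓1(o20 p) ⋄ γ := by rw [coactToAct_word, o21_wh]
      _ = ↓2(o12 ψ) ⋄ ↓1 χ ⋄ χ ⋄ ↓1 μ ⋄ ↓1 χ ⋄ ↓1(o20 p) ⋄ γ := by
        rw [o21_braid (isYDHom_mul k B H)]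
      _ = ↓2(o12 ψ) ⋄ ↓1 χ ⋄ χ ⋄ ↓2 χ ⋄ ↓1 χ ⋄ ↓2 μ ⋄ ↓1(o20 p) ⋄ γ := by
        rw [wh23 (o21_braid (isYDHom_mul k B H))]
      _ = ↓2(o12 ψ) ⋄ ↓1 χ ⋄ χ ⋄ ↓2 χ ⋄ ↓1 χ ⋄ ↓1 δ ⋄ ↓2 χ ⋄ ↓1(o20 p) ⋄ ↓1(o20 p) ⋄ γ := by
        rw [wh24 (mul_pair hp)]
      _ = ↓2(o12 ψ) ⋄ ↓1 χ ⋄ χ ⋄ ↓2 χ ⋄ ↓2 δ ⋄ ↓1 χ ⋄ ↓2 χ ⋄ ↓2 χ ⋄ ↓1(o20 p) ⋄ ↓1(o20 p) ⋄ γ := by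
        rw [wh23 (braid_o12 (isYDHom_comul k B F))]
      _ = ↓2(o12 ψ) ⋄ ↓1 χ ⋄ χ ⋄ ↓3 δ ⋄ ↓2 χ ⋄ ↓3 χ ⋄ ↓1 χ ⋄ ↓1(o20 p) ⋄ ↓1(o20 p) ⋄ γ := by
        rw [wh20 (wh20 (symm_left hp.isYDHom hf hs)), wh23 (wh23 (braid_o12 (isYDHom_comul k B F)))]
      _ = ↓2(o12 ψ) ⋄ ↓3 δ ⋄ ↓1 χ ⋄ ↓2 χ ⋄ ↓3 χ ⋄ ↓3(o20 p) ⋄ χ ⋄ ↓1 χ ⋄ ↓1(o20 p) ⋄ γ := by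
        simp
      _ = ↓2(o12 ψ) ⋄ ↓2(o12 ψ) ⋄ ↓1 χ ⋄ ↓2 χ ⋄ ↓3 χ ⋄ ↓3(o20 p) ⋄ χ ⋄ ↓1 χ ⋄ ↓1(o20 p) ⋄ γ := by
        rw [wh22 (wh22 (comodule_coassoc hψ))]
      _ = ↓2(o12 ψ) ⋄ ↓1 χ ⋄ ↓1(o12 ψ) ⋄ ↓3 χ ⋄ ↓3(o20 p) ⋄ χ ⋄ ↓1 χ ⋄ ↓1(o20 p) ⋄ γ := by
        rw [wh23 (braid_o12 hψ.isYDHom)]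
      _ = _ := by
        rw [wh14 coactToAct_word, coactToAct_word]; simp
    exact (ev_congr (ev_congr (ev_congr this g) h) r)
  act_mul := by
    refine act_mul_of_word fun γ => ?_
    calc
    _ = ↓1(o12 ψ) ⋄ ↓3(o12 ψ) ⋄ ↓2 χ ⋄ ↓1 μ ⋄ ↓2 μ ⋄ χ ⋄ ↓1 χ ⋄ ↓1(o20 p) ⋄ γ := by
      rw [coactToAct_word, wh25 (comodule_mul hψ)]
    _ = ↓1(o12 ψ) ⋄ ↓3(o12 ψ) ⋄ ↓2 χ ⋄ ↓3 μ ⋄ χ ⋄ ↓1 χ ⋄ μ ⋄ ↓1 χ ⋄ ↓1(o20 p) ⋄ γ := by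
      rw [braid_o21 hψ.isYDAlgebra.isYDHom_mul]; simp
    _ = ↓1(o12 ψ) ⋄ ↓3(o12 ψ) ⋄ ↓2 χ ⋄ χ ⋄ ↓1 χ ⋄ ↓3 μ ⋄ ↓2 χ ⋄ ↓2(o20 p) ⋄ μ ⋄ γ := by simp
    _ = ↓1(o12 ψ) ⋄ ↓3(o12 ψ) ⋄ ↓2 χ ⋄ χ ⋄ ↓1 χ ⋄ ↓2 χ ⋄ ↓3 χ ⋄ ↓4 δ ⋄ ↓3 χ ⋄ ↓2(o20 p) ⋄
          ↓2(o20 p) ⋄ μ ⋄ γ := by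
      rw [wh23 (wh23 (fun γ => (braid_o21 (isYDHom_mul k B F) γ).symm)), wh24 (wh24 (mul_pair' hp))]
    _ = ↓1(o12 ψ) ⋄ ↓3(o12 ψ) ⋄ ↓2 χ ⋄ δ ⋄ ↓1 χ ⋄ χ ⋄ ↓2 χ ⋄ ↓1 χ ⋄ ↓3 χ ⋄ ↓2 χ ⋄ ↓4 χ ⋄ ↓3 χ ⋄
          ↓3 χ ⋄ ↓2(o20 p) ⋄ ↓2(o20 p) ⋄ μ ⋄ γ := by
      rw [← wh32 (wh32 (wh32 (o12_braid (isYDHom_comul k B H)))),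
        ← wh32 (wh32 (o12_braid (isYDHom_comul k B H))),
        ← wh32 (o12_braid (isYDHom_comul k B H)), ← o12_braid (isYDHom_comul k B H)]
    _ = δ ⋄ ↓2(o12 ψ) ⋄ ↓4(o12 ψ) ⋄ ↓3 χ ⋄ ↓1 χ ⋄ χ ⋄ ↓2 χ ⋄ ↓1 χ ⋄ ↓3 χ ⋄ ↓2 χ ⋄ ↓4 χ ⋄
          ↓2(o20 p) ⋄ ↓2(o20 p) ⋄ μ ⋄ γ := by
      rw [wh20 (wh20 (wh20 (symm_left hp.isYDHom hf hs)))]; simp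
    _ = δ ⋄ ↓2(o12 ψ) ⋄ ↓4(o12 ψ) ⋄ ↓1 χ ⋄ χ ⋄ ↓3 χ ⋄ ↓2 χ ⋄ ↓3 χ ⋄ ↓1 χ ⋄ ↓2 χ ⋄
          ↓2(o20 p) ⋄ ↓2 χ ⋄ ↓2(o20 p) ⋄ μ ⋄ γ := by simp
    _ = δ ⋄ ↓2(o12 ψ) ⋄ ↓4(o12 ψ) ⋄ ↓1 χ ⋄ χ ⋄ ↓2 χ ⋄ ↓3 χ ⋄ ↓1 χ ⋄ ↓2 χ ⋄ ↓1 χ ⋄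
          ↓2(o20 p) ⋄ ↓2 χ ⋄ ↓2(o20 p) ⋄ μ ⋄ γ := by
      rw [← wh33 (wh33 (braid_o22 isYDHom_braiding)), ← wh33 (braid_o22 isYDHom_braiding)]
    _ = δ ⋄ ↓2(o12 ψ) ⋄ ↓4(o12 ψ) ⋄ ↓1 χ ⋄ χ ⋄ ↓2 χ ⋄ ↓1 χ ⋄ ↓3 χ ⋄
          ↓1(o20 p) ⋄ ↓2 χ ⋄ ↓2(o20 p) ⋄ μ ⋄ γ := by
      rw [wh13 (o20_braid hp.isYDHom)]; simp
    _ = _ := by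
      rw [wh14 coactToAct_word, coactToAct_word, wh23 (braid_o12 hψ.isYDHom)]; simp

/-- The pairing makes `H` an `F`-module algebra. -/
theorem isYDModuleAlgebra_dualAct (hp : IsQuasiDual B p) :
    IsYDModuleAlgebra B (LinearMap.mul' k H) 1 (dualAct B p) where
  isYDAlgebra := BraidedHopfAlgebra.isYDAlgebra
  isYDHom := isYDHom_dualAct hp.isYDHom
  one_act a := by
    let γ : (hom H (Tgt.of k H)).carrier := LinearMap.id
    have : η ⋄ o21 (dualAct B p) ⋄ γ = γ := by
      rw [dualAct_word, o01_wh, o01_braid (isYDHom_one k B F), wh21 (one_pair' hp), comul_counit']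
    exact (ev_congr this a)
  act_one h := by
    let γ : (hom H (Tgt.of k H)).carrier := LinearMap.id
    have : ↓1 η ⋄ o21 (dualAct B p) ⋄ γ = ε ⋄ η ⋄ γ := by
      rw [dualAct_word, wh22 (one_comul B), braid_o01 (isYDHom_one k B H), o01_wh, one_pair hp]
    exact (ev_congr this h)
  mul_act g h r := by
    let γ : (hom H (Tgt.of k H)).carrier := LinearMap.id
    have : μ ⋄ o21 (dualAct B p) ⋄ γ =
        ↓1(o21 (dualAct B p)) ⋄ o21 (dualAct B p) ⋄ γ := calc
      _ = ↓2 δ ⋄ ↓1 χ ⋄ χ ⋄ ↓3 δ ⋄ ↓2 χ ⋄ ↓1(o20 p) ⋄ ↓1(o20 p) ⋄ γ := by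
        rw [dualAct_word, o21_wh, o21_braid (isYDHom_mul k B F), wh24 (mul_pair' hp)]
      _ = ↓2 δ ⋄ ↓3 δ ⋄ ↓1 χ ⋄ ↓2 χ ⋄ ↓3(o20 p) ⋄ χ ⋄ ↓1(o20 p) ⋄ γ := by simp
      _ = ↓2 δ ⋄ ↓1 χ ⋄ ↓1 δ ⋄ ↓3(o20 p) ⋄ χ ⋄ ↓1(o20 p) ⋄ γ := by
        rw [← wh22 (wh22 comul_comul), wh23 (braid_o12 (isYDHom_comul k B H))]
      _ = _ := by
        rw [wh13 dualAct_word, dualAct_word]; simp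
    exact (ev_congr (ev_congr (ev_congr this g) h) r)
  act_mul := by
    refine act_mul_of_word fun γ => ?_
    calc
    _ = ↓1 δ ⋄ ↓3 δ ⋄ ↓2 χ ⋄ ↓1 μ ⋄ ↓2 μ ⋄ χ ⋄ ↓1(o20 p) ⋄ γ := by
      rw [dualAct_word, wh25 (mul_comul B)]
    _ = ↓1 δ ⋄ ↓3 δ ⋄ ↓2 χ ⋄ ↓3 μ ⋄ χ ⋄ ↓1 χ ⋄ μ ⋄ ↓1(o20 p) ⋄ γ := by
      rw [braid_o21 (isYDHom_mul k B H)]; simp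
    _ = ↓1 δ ⋄ ↓3 δ ⋄ ↓2 χ ⋄ χ ⋄ ↓1 χ ⋄ ↓3 μ ⋄ ↓2(o20 p) ⋄ μ ⋄ γ := by simp
    _ = ↓1 δ ⋄ ↓3 δ ⋄ ↓2 χ ⋄ δ ⋄ ↓1 χ ⋄ χ ⋄ ↓2 χ ⋄ ↓1 χ ⋄ ↓3 χ ⋄ ↓2(o20 p) ⋄ ↓2(o20 p) ⋄ μ ⋄ γ := by
      rw [wh24 (wh24 (mul_pair hp)), ← wh32 (o12_braid (isYDHom_comul k B F)),
        ← o12_braid (isYDHom_comul k B F)]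
    _ = δ ⋄ ↓2 δ ⋄ ↓4 δ ⋄ ↓1 χ ⋄ χ ⋄ ↓3 χ ⋄ ↓2 χ ⋄ ↓3 χ ⋄ ↓1 χ ⋄ ↓2(o20 p) ⋄ ↓2(o20 p) ⋄ μ ⋄ γ := by
      simp
    _ = δ ⋄ ↓2 δ ⋄ ↓4 δ ⋄ ↓1 χ ⋄ χ ⋄ ↓2 χ ⋄ ↓3 χ ⋄ ↓1(o20 p) ⋄ ↓2(o20 p) ⋄ μ ⋄ γ := by
      rw [← wh33 (wh33 (braid_o22 isYDHom_braiding)), wh13 (o20_braid hp.isYDHom)]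
    _ = _ := by
      rw [wh13 dualAct_word, dualAct_word, wh23 (braid_o12 (isYDHom_comul k B H))]; simp

end Actions

section Split

variable {X Y : Type*} [AddCommMonoid X] [Module k X] [AddCommMonoid Y]
  [Module k Y] {Z : Tgt k}

/-- A word on `X ⊗ Y` is determined by its values on pure tensors. -/
theorem split_injective {γ γ' : (hom (X ⊗[k] Y) Z).carrier}
    (h : o21 .id ⋄ γ = o21 .id ⋄ γ') : γ = γ' :=
  TensorProduct.ext h

end Split

/-! ### Actions that are trivial on one factor -/

section TrivialAction

variable {F A D : Type*}
  [Ring F] [Algebra k F] [Coalgebra k F] [YDModule k B F] [BraidedHopfAlgebra k B F]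
  [AddCommMonoid A] [Module k A] [YDStruct k B A] [IsModuleComodule k B A]
  [AddCommMonoid D] [Module k D] [YDStruct k B D] [IsModuleComodule k B D] {Z : Tgt k}

local notation "ς" => o21 (LinearMap.id (M := A ⊗[k] D))

variable {mA : A ⊗[k] A →ₗ[k] A} {mD : D ⊗[k] D →ₗ[k] D} {σ : D ⊗[k] A →ₗ[k] A ⊗[k] D}
  {uA : A} {uD : D} {α : F ⊗[k] D →ₗ[k] D}

variable (B A) in
/-- The action of `F` on `A ⊗ D` which is trivial on `A` and `α` on `D`. -/
noncomputable def trivialAct (α : F ⊗[k] D →ₗ[k] D) : F ⊗[k] (A ⊗[k] D) →ₗ[k] A ⊗[k] D :=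
  α.lTensor A ∘ₗ (TensorProduct.assoc k A F D).toLinearMap ∘ₗ (ydBraiding k B F A).rTensor D
    ∘ₗ (TensorProduct.assoc k F A D).symm.toLinearMap

theorem trivialAct_word (γ : (hom (A ⊗[k] D) Z).carrier) :
    ↓1 ς ⋄ o21 (trivialAct B A α) ⋄ γ = χ ⋄ ↓1(o21 α) ⋄ ς ⋄ γ :=
  hom_ext fun f => hom_ext fun a => hom_ext fun d => by
    simp only [trivialAct, LinearMap.comp_apply, o21_apply, wh_apply, LinearMap.id_apply,
      LinearEquiv.coe_coe, TensorProduct.assoc_symm_tmul, LinearMap.rTensor_tmul, o22_apply]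
    induction ydBraiding k B F A (f ⊗ₜ a) with
    | zero => simp
    | add s t hs ht => simp only [map_add, TensorProduct.add_tmul, ev_add, add_ev, hs, ht]
    | tmul x h => simp

theorem twistedMul_word (γ : (hom (A ⊗[k] D) Z).carrier) :
    ↓2 ς ⋄ ς ⋄ o21 (twistedMul mA mD σ) ⋄ γ = ↓1(o22 σ) ⋄ o21 mA ⋄ ↓1(o21 mD) ⋄ ς ⋄ γ :=
  hom_ext fun a => hom_ext fun d => hom_ext fun a' => hom_ext fun d' => by
    rw [← twistedAct_tmul, ← twistedMul_eq, uncur_mul]; rfl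

theorem trivialAct_twist
    (hc : ↓1(o22 σ) ⋄ χ ⋄ ↓1(o21 α) ⋄ pair k A D = o21 α ⋄ o22 σ ⋄ pair k A D)
    (γ : (hom A (hom D Z)).carrier) : ↓1(o22 σ) ⋄ χ ⋄ ↓1(o21 α) ⋄ γ = o21 α ⋄ o22 σ ⋄ γ := calc
  _ = ↓3(unc γ) ⋄ ↓1(o22 σ) ⋄ χ ⋄ ↓1(o21 α) ⋄ pair k A D := by
    conv_lhs => rw [eq_wh_pair γ]
    simp
  _ = o21 α ⋄ o22 σ ⋄ ↓2(unc γ) ⋄ pair k A D := by rw [hc]; simp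
  _ = _ := by rw [← eq_wh_pair γ]

/-- If the action of `F` on `D` commutes with the twist, then the action on `A ⊗ D` that is trivial
on `A` respects the twisted product. -/
theorem isYDModuleAlgebra_trivialAct
    (hAD : IsYDAlgebra B (twistedMul mA mD σ) (uA ⊗ₜ uD)) (hA : IsYDAlgebra B mA uA)
    (hD : IsYDModuleAlgebra B mD uD α) (hσ : IsYDHom k B σ) (hC : IsYDHom k B (ydBraiding k B F A))
    (hc : ↓1(o22 σ) ⋄ χ ⋄ ↓1(o21 α) ⋄ pair k A D = o21 α ⋄ o22 σ ⋄ pair k A D) :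
    IsYDModuleAlgebra B (twistedMul mA mD σ) (uA ⊗ₜ uD) (trivialAct B A α) where
  isYDAlgebra := hAD
  isYDHom := hD.isYDHom.lTensor.comp (isYDHom_assoc.comp (hC.rTensor.comp isYDHom_assoc.symm))
  one_act a := by
    let γ : (hom (A ⊗[k] D) (Tgt.of k (A ⊗[k] D))).carrier := LinearMap.id
    have : η ⋄ o21 (trivialAct B A α) ⋄ γ = γ := split_injective <| by
      rw [← o01_wh, trivialAct_word, o01_braid (isYDHom_one k B F), wh20 (one_act_word hD)]
    exact (ev_congr this a)
  act_one h := by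
    let γ : (hom (A ⊗[k] D) (Tgt.of k (A ⊗[k] D))).carrier := LinearMap.id
    have : ↓1(o01 (uA ⊗ₜ uD)) ⋄ o21 (trivialAct B A α) ⋄ γ = ε ⋄ o01 (uA ⊗ₜ uD) ⋄ γ := calc
      _ = ↓1(o01 uD) ⋄ ↓1(o01 uA) ⋄ ↓1 ς ⋄ o21 (trivialAct B A α) ⋄ γ := rfl
      _ = ε ⋄ o01 uD ⋄ o01 uA ⋄ ς ⋄ γ := by
        rw [trivialAct_word, braid_o01 hA.isYDHom_unit, o01_wh, act_one_word hD]
      _ = _ := rfl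
    exact (ev_congr this h)
  mul_act g h r := by
    let γ : (hom (A ⊗[k] D) (Tgt.of k (A ⊗[k] D))).carrier := LinearMap.id
    have : μ ⋄ o21 (trivialAct B A α) ⋄ γ =
        ↓1(o21 (trivialAct B A α)) ⋄ o21 (trivialAct B A α) ⋄ γ := by
      have h : ↓2 ς ⋄ μ ⋄ o21 (trivialAct B A α) ⋄ γ =
          ↓2 ς ⋄ ↓1(o21 (trivialAct B A α)) ⋄ o21 (trivialAct B A α) ⋄ γ := calc
        _ = ↓1 χ ⋄ χ ⋄ ↓2(o21 α) ⋄ ↓1(o21 α) ⋄ ς ⋄ γ := by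
          rw [← o21_wh, trivialAct_word, o21_braid (isYDHom_mul k B F), wh22 (act_act hD)]
        _ = ↓1 χ ⋄ ↓2(o21 α) ⋄ ↓1 ς ⋄ o21 (trivialAct B A α) ⋄ γ := by
          rw [trivialAct_word]; simp
        _ = _ := by rw [wh23 trivialAct_word]
      exact hom_ext fun f => hom_ext fun g => split_injective ((ev_congr (ev_congr h f) g))
    exact (ev_congr (ev_congr (ev_congr this g) h) r)
  act_mul := by
    refine act_mul_of_word fun γ => ?_
    have h : ↓3 ς ⋄ ↓1 ς ⋄ ↓1(o21 (twistedMul mA mD σ)) ⋄ o21 (trivialAct B A α) ⋄ γ =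
        ↓3 ς ⋄ ↓1 ς ⋄ δ ⋄ ↓1 χ ⋄ o21 (trivialAct B A α) ⋄ ↓1(o21 (trivialAct B A α)) ⋄
          o21 (twistedMul mA mD σ) ⋄ γ := calc
      _ = ↓2(o22 σ) ⋄ ↓1(o21 mA) ⋄ ↓2(o21 mD) ⋄ χ ⋄ ↓1(o21 α) ⋄ ς ⋄ γ := by
        rw [wh34 twistedMul_word, trivialAct_word]
      _ = ↓2(o22 σ) ⋄ ↓3(o21 mD) ⋄ χ ⋄ ↓1 χ ⋄ o21 mA ⋄ ↓1(o21 α) ⋄ ς ⋄ γ := by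
        rw [braid_o21 hA.isYDHom_mul]; simp
      _ = ↓2(o22 σ) ⋄ χ ⋄ ↓1 χ ⋄ ↓3(o21 mD) ⋄ ↓2(o21 α) ⋄ o21 mA ⋄ ς ⋄ γ := by simp
      _ = ↓2(o22 σ) ⋄ δ ⋄ ↓1 χ ⋄ χ ⋄ ↓2 χ ⋄ ↓1 χ ⋄ ↓3 χ ⋄ ↓2(o21 α) ⋄ ↓3(o21 α) ⋄ ↓2(o21 mD) ⋄
            o21 mA ⋄ ς ⋄ γ := by
        rw [wh25 (wh25 (act_mul_word hD)), ← wh32 (o12_braid (isYDHom_comul k B F)),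
          ← o12_braid (isYDHom_comul k B F)]
      _ = δ ⋄ ↓1 χ ⋄ χ ⋄ ↓3(o22 σ) ⋄ ↓2 χ ⋄ ↓3 χ ⋄ ↓1 χ ⋄ ↓2(o21 α) ⋄ ↓3(o21 α) ⋄ ↓2(o21 mD) ⋄
            o21 mA ⋄ ς ⋄ γ := by simp
      _ = δ ⋄ ↓1 χ ⋄ χ ⋄ ↓2 χ ⋄ ↓3 χ ⋄ ↓2(o22 σ) ⋄ ↓1 χ ⋄ ↓2(o21 α) ⋄ ↓3(o21 α) ⋄ ↓2(o21 mD) ⋄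
            o21 mA ⋄ ς ⋄ γ := by
        rw [← wh33 (wh33 (braid_o22 hσ))]
      _ = δ ⋄ ↓1 χ ⋄ χ ⋄ ↓2 χ ⋄ ↓3 χ ⋄ ↓1(o21 α) ⋄ ↓1(o22 σ) ⋄ ↓3(o21 α) ⋄ ↓2(o21 mD) ⋄
            o21 mA ⋄ ς ⋄ γ := by
        rw [wh32 (trivialAct_twist hc)]
      _ = δ ⋄ ↓1 χ ⋄ ↓2 χ ⋄ χ ⋄ ↓1(o21 α) ⋄ ↓2 χ ⋄ ↓3(o21 α) ⋄ ↓2 ς ⋄ ς ⋄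
            o21 (twistedMul mA mD σ) ⋄ γ := by
        rw [twistedMul_word]; simp
      _ = δ ⋄ ↓1 χ ⋄ ↓2 χ ⋄ χ ⋄ ↓1(o21 α) ⋄ ς ⋄ ↓2 ς ⋄ ↓1(o21 (trivialAct B A α)) ⋄
            o21 (twistedMul mA mD σ) ⋄ γ := by
        rw [← wh23 (wh23 trivialAct_word)]; simp
      _ = δ ⋄ ↓1 χ ⋄ ↓2 χ ⋄ ↓1 ς ⋄ ↓3 ς ⋄ o21 (trivialAct B A α) ⋄ ↓1(o21 (trivialAct B A α)) ⋄
            o21 (twistedMul mA mD σ) ⋄ γ := by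
        rw [← trivialAct_word]; simp
      _ = _ := by
        rw [wh32 (braid_o21 IsYDHom.id)]; simp
    exact hom_ext fun f => split_injective <| hom_ext fun a => hom_ext fun d =>
      split_injective ((ev_congr (ev_congr (ev_congr h f) a) d))

end TrivialAction

/-! ### The algebras `(R # H) # F` and `R ⊗ (H # F)` -/

section Tower

variable {H F R : Type*} [Ring H] [Algebra k H] [Coalgebra k H] [YDModule k B H]
  [BraidedHopfAlgebra k B H]
  [Ring F] [Algebra k F] [Coalgebra k F] [YDModule k B F] [BraidedHopfAlgebra k B F]
  [Ring R] [Algebra k R] [YDModule k B R] {Z : Tgt k}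

variable {p : F ⊗[k] H →ₗ[k] k} {ψ : R →ₗ[k] R ⊗[k] F} {β : H ⊗[k] R →ₗ[k] R}

/-- The actions of `F` on `R` (trivial) and on `H` commute with the twist of `R # H`, by
coassociativity: `F` evaluates on the last tensor factor of a coproduct, and the twist uses the
first. -/
theorem dualAct_smashTwist (hp : IsQuasiDual B p) (hβ : IsYDHom k B β)
    (γ : (hom R (hom H Z)).carrier) :
    ↓1(o22 (smashTwist B β)) ⋄ χ ⋄ ↓1(o21 (dualAct B p)) ⋄ γ =
      o21 (dualAct B p) ⋄ o22 (smashTwist B β) ⋄ γ := calc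
  _ = ↓1 δ ⋄ ↓2 χ ⋄ ↓1(o21 β) ⋄ χ ⋄ ↓1(o21 (dualAct B p)) ⋄ γ := by
    rw [wh13 smashTwist_word]
  _ = ↓1 δ ⋄ χ ⋄ ↓2 χ ⋄ ↓1 χ ⋄ ↓2(o21 (dualAct B p)) ⋄ o21 β ⋄ γ := by
    rw [← braid_o21 hβ]; simp
  _ = ↓1 δ ⋄ χ ⋄ ↓1(o21 (dualAct B p)) ⋄ ↓1 χ ⋄ o21 β ⋄ γ := by
    rw [← wh23 (o21_braid (isYDHom_dualAct hp.isYDHom))]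
  _ = ↓1 δ ⋄ ↓2 δ ⋄ χ ⋄ ↓1 χ ⋄ ↓2(o20 p) ⋄ ↓1 χ ⋄ o21 β ⋄ γ := by
    rw [wh13 dualAct_word]; simp
  _ = ↓1 δ ⋄ χ ⋄ ↓1(o20 p) ⋄ δ ⋄ ↓1 χ ⋄ o21 β ⋄ γ := by
    rw [← wh22 comul_comul, ← braid_o12 (isYDHom_comul k B H)]; simp
  _ = _ := by
    rw [dualAct_word, smashTwist_word]

theorem isYDModuleAlgebra_dualActSmash (hp : IsQuasiDual B p)
    (hR : IsYDModuleAlgebra B (LinearMap.mul' k R) 1 (coactToAct B p ψ)) :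
    IsYDModuleAlgebra B (smashOneMul B p ψ) (1 ⊗ₜ 1) (dualActSmash B R p) :=
  isYDModuleAlgebra_trivialAct (hR.smash isYDHom_braiding) hR.isYDAlgebra
    (isYDModuleAlgebra_dualAct hp) (hR.isYDHom.smashTwist isYDHom_braiding) isYDHom_braiding
    (dualAct_smashTwist hp hR.isYDHom _)

theorem isYDAlgebra_smashTwoMul (hp : IsQuasiDual B p)
    (hR : IsYDModuleAlgebra B (LinearMap.mul' k R) 1 (coactToAct B p ψ)) :
    IsYDAlgebra B (smashTwoMul B p ψ) ((1 ⊗ₜ 1) ⊗ₜ 1) :=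
  (isYDModuleAlgebra_dualActSmash hp hR).smash
    (isYDHom_braiding_tensor_right isYDHom_braiding isYDHom_braiding)

theorem isYDAlgebra_smashDual (hp : IsQuasiDual B p) :
    IsYDAlgebra B (smashMul B (LinearMap.mul' k H) (dualAct B p)) (1 ⊗ₜ 1) :=
  (isYDModuleAlgebra_dualAct hp).smash isYDHom_braiding

theorem isYDAlgebra_tensorSmashMul (hp : IsQuasiDual B p)
    (hR : IsYDAlgebra B (LinearMap.mul' k R) 1) :
    IsYDAlgebra B (tensorSmashMul B R p) (1 ⊗ₜ (1 ⊗ₜ 1)) :=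
  hR.braidedTensor (isYDAlgebra_smashDual hp)
    (isYDHom_braiding_tensor_left isYDHom_braiding isYDHom_braiding)

end Tower

/-! ### The antipode and its inverse -/

section Antipode

variable {H : Type*} [Ring H] [Algebra k H] [Coalgebra k H] [YDModule k B H]
  [BraidedHopfAlgebra k B H]
  {Z : Tgt k}

variable (B)

/-- Coassociativity of the coalgebra `H ⊗ H`. -/
theorem comul_tensor_coassoc (γ : (hom H (hom H (hom H (hom H (hom H (hom H Z)))))).carrier) :
    δ ⋄ ↓2 δ ⋄ ↓1 χ ⋄ δ ⋄ ↓2 δ ⋄ ↓1 χ ⋄ γ = δ ⋄ ↓2 δ ⋄ ↓1 χ ⋄ ↓2 δ ⋄ ↓4 δ ⋄ ↓3 χ ⋄ γ := calc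
  _ = δ ⋄ δ ⋄ ↓3 δ ⋄ ↓2 χ ⋄ ↓2 δ ⋄ ↓1 χ ⋄ γ := by simp
  _ = δ ⋄ δ ⋄ ↓3 δ ⋄ ↓3 δ ⋄ ↓2 χ ⋄ ↓3 χ ⋄ ↓1 χ ⋄ γ := by
    rw [wh23 (wh23 (braid_o12 (isYDHom_comul k B H)))]
  _ = δ ⋄ ↓1 δ ⋄ ↓3 δ ⋄ ↓4 δ ⋄ ↓2 χ ⋄ ↓1 χ ⋄ ↓3 χ ⋄ γ := by
    rw [comul_comul, wh22 (wh22 (wh22 comul_comul))]; simp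
  _ = δ ⋄ ↓2 δ ⋄ ↓3 δ ⋄ ↓1 δ ⋄ ↓2 χ ⋄ ↓1 χ ⋄ ↓3 χ ⋄ γ := by simp
  _ = _ := by
    rw [wh32 (o12_braid (isYDHom_comul k B H))]; simp

/-- `S ∘ m` is a left convolution inverse of the product `m : H ⊗ H → H`. -/
theorem antipode_conv_mul (γ : (hom H Z).carrier) :
    δ ⋄ ↓2 δ ⋄ ↓1 χ ⋄ μ ⋄ S ⋄ ↓1 μ ⋄ μ ⋄ γ = ε ⋄ ε ⋄ η ⋄ γ := calc
  _ = δ ⋄ ↓2 δ ⋄ ↓1 χ ⋄ μ ⋄ ↓1 μ ⋄ S ⋄ μ ⋄ γ := by simp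
  _ = _ := by rw [← mul_comul B, antipode_mul_left, mul_counit B]

/-- `m ∘ (S ⊗ S) ∘ C` is a right convolution inverse of the product `m : H ⊗ H → H`. -/
theorem mul_conv_antipode (γ : (hom H Z).carrier) :
    δ ⋄ ↓2 δ ⋄ ↓1 χ ⋄ μ ⋄ ↓1 χ ⋄ ↓1 S ⋄ ↓2 S ⋄ ↓1 μ ⋄ μ ⋄ γ = ε ⋄ ε ⋄ η ⋄ γ := calc
  _ = δ ⋄ ↓2 δ ⋄ ↓1 χ ⋄ ↓2 χ ⋄ ↓2 S ⋄ ↓3 S ⋄ ↓2 μ ⋄ μ ⋄ μ ⋄ γ := by simp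
  _ = δ ⋄ ↓1 χ ⋄ ↓1 δ ⋄ ↓2 S ⋄ ↓3 S ⋄ ↓1 μ ⋄ ↓1 μ ⋄ μ ⋄ γ := by
    rw [mul_mul, ← wh22 mul_mul, wh23 (braid_o12 (isYDHom_comul k B H))]
  _ = δ ⋄ ↓1 χ ⋄ ↓1 δ ⋄ ↓2 S ⋄ ↓1 μ ⋄ ↓2 S ⋄ ↓1 μ ⋄ μ ⋄ γ := by simp
  _ = δ ⋄ ↓1 χ ⋄ ↓1 ε ⋄ ↓1 S ⋄ ↓1 η ⋄ ↓1 μ ⋄ μ ⋄ γ := by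
    rw [wh32 (antipode_mul_right B)]; simp
  _ = ↓1 ε ⋄ δ ⋄ ↓1 S ⋄ μ ⋄ γ := by
    rw [wh21 (braid_o10 (isYDHom_counit k B H)), wh20 one_mul_word]; simp
  _ = _ := by
    rw [antipode_mul_right B]; simp

/-- The antipode is antimultiplicative up to the braiding, because both sides are convolution
inverses of the product. -/
theorem antipode_mul (γ : (hom H Z).carrier) :
    μ ⋄ S ⋄ γ = χ ⋄ S ⋄ ↓1 S ⋄ μ ⋄ γ := calc
  _ = δ ⋄ ↓1 ε ⋄ ↓1 δ ⋄ ↓2 ε ⋄ μ ⋄ S ⋄ γ := by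
    rw [comul_counit', wh20 comul_counit']
  _ = δ ⋄ ↓2 δ ⋄ ↓1 χ ⋄ ↓2 ε ⋄ ↓2 ε ⋄ μ ⋄ S ⋄ γ := by
    rw [wh21 (fun γ => (o10_braid (isYDHom_counit k B H) γ).symm)]; simp
  _ = δ ⋄ ↓2 δ ⋄ ↓1 χ ⋄ μ ⋄ S ⋄ ↓1 ε ⋄ ↓1 ε ⋄ ↓1 η ⋄ μ ⋄ γ := by
    rw [mul_one_word]; simp
  _ = δ ⋄ ↓2 δ ⋄ ↓1 χ ⋄ μ ⋄ S ⋄ ↓1 δ ⋄ ↓3 δ ⋄ ↓2 χ ⋄ ↓1 μ ⋄ ↓2 χ ⋄ ↓2 S ⋄ ↓3 S ⋄ ↓2 μ ⋄ ↓1 μ ⋄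
        μ ⋄ γ := by
    congr 5
    exact hom_ext fun u => (mul_conv_antipode B ((μ ⋄ γ) u)).symm
  _ = δ ⋄ ↓2 δ ⋄ ↓1 χ ⋄ ↓2 δ ⋄ ↓4 δ ⋄ ↓3 χ ⋄ μ ⋄ S ⋄ ↓1 μ ⋄ ↓2 χ ⋄ ↓2 S ⋄ ↓3 S ⋄ ↓2 μ ⋄ μ ⋄
        μ ⋄ γ := by
    rw [mul_mul]; simp
  _ = δ ⋄ ↓2 δ ⋄ ↓1 χ ⋄ δ ⋄ ↓2 δ ⋄ ↓1 χ ⋄ μ ⋄ S ⋄ ↓1 μ ⋄ μ ⋄ ↓1 χ ⋄ ↓1 S ⋄ ↓2 S ⋄ ↓1 μ ⋄ μ ⋄ γ := by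
    rw [comul_tensor_coassoc]; simp
  _ = δ ⋄ ↓2 δ ⋄ ↓1 χ ⋄ ε ⋄ ε ⋄ χ ⋄ S ⋄ ↓1 S ⋄ μ ⋄ γ := by
    rw [antipode_conv_mul, o01_wh, o01_wh, o01_wh, o01_wh, one_mul_word]
  _ = δ ⋄ ε ⋄ ↓1 δ ⋄ ↓1 ε ⋄ χ ⋄ S ⋄ ↓1 S ⋄ μ ⋄ γ := by
    rw [← o10_wh, braid_o10 (isYDHom_counit k B H)]; simp
  _ = _ := by
    rw [comul_counit, wh20 comul_counit]

variable (k H)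

/-- The inverse of the antipode. -/
noncomputable def antipodeInv (hS : Function.Bijective (braidedAntipode k B H)) : H →ₗ[k] H :=
  (LinearEquiv.ofBijective (braidedAntipode k B H) hS).symm.toLinearMap

theorem isYDHom_antipodeInv (hS : Function.Bijective (braidedAntipode k B H)) :
    IsYDHom k B (antipodeInv k B H hS) := by
  have h : IsYDHom k B (LinearEquiv.ofBijective (braidedAntipode k B H) hS).toLinearMap :=
    isYDHom_antipode k B H
  exact h.symm

variable {k H}

theorem antipode_antipodeInv (hS : Function.Bijective (braidedAntipode k B H)) (x : H) :
    braidedAntipode k B H (antipodeInv k B H hS x) = x :=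
  (LinearEquiv.ofBijective (braidedAntipode k B H) hS).apply_symm_apply x

theorem antipodeInv_antipode (hS : Function.Bijective (braidedAntipode k B H)) (x : H) :
    antipodeInv k B H hS (braidedAntipode k B H x) = x :=
  (LinearEquiv.ofBijective (braidedAntipode k B H) hS).symm_apply_apply x

theorem inv_antipode_word (hS : Function.Bijective (braidedAntipode k B H))
    (γ : (hom H Z).carrier) :
    o11 (antipodeInv k B H hS) ⋄ S ⋄ γ = γ :=
  hom_ext fun x => congrArg (ev γ) (antipode_antipodeInv B hS x)

theorem antipode_inv_word (hS : Function.Bijective (braidedAntipode k B H))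
    (γ : (hom H Z).carrier) :
    S ⋄ o11 (antipodeInv k B H hS) ⋄ γ = γ :=
  hom_ext fun x => congrArg (ev γ) (antipodeInv_antipode B hS x)

theorem one_antipode (γ : (hom H Z).carrier) : η ⋄ S ⋄ γ = η ⋄ γ := calc
  _ = η ⋄ S ⋄ ↓1 η ⋄ μ ⋄ γ := by rw [mul_one_word]
  _ = η ⋄ η ⋄ S ⋄ μ ⋄ γ := rfl
  _ = η ⋄ γ := by
    rw [← one_comul B, antipode_mul_left, one_counit B]

/-- `∑ S⁻¹(x₁)` multiplied from the left by `x₂`, braided past each other, is `ε(x)`. -/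
theorem antipodeInv_left (hs : ydBraiding k B H H ∘ₗ ydBraiding k B H H = LinearMap.id)
    (hS : Function.Bijective (braidedAntipode k B H)) (γ : (hom H Z).carrier) :
    δ ⋄ o11 (antipodeInv k B H hS) ⋄ χ ⋄ μ ⋄ γ = ε ⋄ η ⋄ γ := calc
  _ = δ ⋄ o11 (antipodeInv k B H hS) ⋄ χ ⋄ μ ⋄ S ⋄ o11 (antipodeInv k B H hS) ⋄ γ := by
    rw [antipode_inv_word]
  _ = δ ⋄ ↓1 S ⋄ μ ⋄ o11 (antipodeInv k B H hS) ⋄ γ := by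
    rw [antipode_mul, symm_word hs, inv_antipode_word]
  _ = _ := by
    rw [antipode_mul_right, ← one_antipode B (o11 _ ⋄ γ), antipode_inv_word]

/-- The mirror image of `antipodeInv_left`: `S⁻¹(x₂)` times `x₁`, braided past each other. -/
theorem antipodeInv_right (hs : ydBraiding k B H H ∘ₗ ydBraiding k B H H = LinearMap.id)
    (hS : Function.Bijective (braidedAntipode k B H)) (γ : (hom H Z).carrier) :
    δ ⋄ ↓1(o11 (antipodeInv k B H hS)) ⋄ χ ⋄ μ ⋄ γ = ε ⋄ η ⋄ γ := calc
  _ = δ ⋄ ↓1(o11 (antipodeInv k B H hS)) ⋄ χ ⋄ μ ⋄ S ⋄ o11 (antipodeInv k B H hS) ⋄ γ := by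
    rw [antipode_inv_word]
  _ = δ ⋄ S ⋄ ↓1(o11 (antipodeInv k B H hS)) ⋄ ↓1 S ⋄ μ ⋄ o11 (antipodeInv k B H hS) ⋄ γ := by
    rw [antipode_mul, symm_word hs]; simp
  _ = δ ⋄ S ⋄ μ ⋄ o11 (antipodeInv k B H hS) ⋄ γ := by
    rw [wh20 (inv_antipode_word B hS)]
  _ = _ := by
    rw [antipode_mul_left, ← one_antipode B (o11 _ ⋄ γ), antipode_inv_word]

end Antipode

/-! ### The operators of `ρ` -/

section Rho

variable {H F : Type*} [Ring H] [Algebra k H] [Coalgebra k H] [YDModule k B H]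
  [Ring F] [Algebra k F] [Coalgebra k F] [YDModule k B F] {Z : Tgt k}

/-- The map `u ⊗ x ↦ ∑ q(u, x₁) x₂`. -/
noncomputable def rightAct (q : F ⊗[k] H →ₗ[k] k) : F ⊗[k] H →ₗ[k] H :=
  (TensorProduct.lid k H).toLinearMap ∘ₗ q.rTensor H ∘ₗ
    (TensorProduct.assoc k F H H).symm.toLinearMap ∘ₗ (Coalgebra.comul (R := k) (A := H)).lTensor F

variable {p q : F ⊗[k] H →ₗ[k] k}

theorem rightAct_word (γ : (hom H Z).carrier) :
    o21 (rightAct q) ⋄ γ = ↓1 δ ⋄ o20 q ⋄ γ :=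
  hom_ext fun u => hom_ext fun x => by
    simp only [rightAct, LinearMap.comp_apply, LinearMap.lTensor_tmul, o12_apply, o21_apply,
      wh_apply]
    induction Coalgebra.comul (R := k) x with
    | zero => simp
    | add s t hs ht => simp only [map_add, TensorProduct.tmul_add, ev_add, hs, ht]
    | tmul x y => simp

theorem rhoMap_apply (p : F ⊗[k] H →ₗ[k] k) (u : F) (h x : H) (γ : (hom H Z).carrier) :
    γ (rhoMap B p (u ⊗ₜ h) x) = (↓2 δ ⋄ ↓1 χ ⋄ ↓2 χ ⋄ o20 p ⋄ μ ⋄ γ) u h x := by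
  simp only [rhoMap, TensorProduct.curry_apply, LinearMap.comp_apply, LinearEquiv.coe_coe,
    TensorProduct.assoc_tmul, LinearMap.lTensor_tmul, o12_apply, wh_apply]
  induction Coalgebra.comul (R := k) x with
  | zero => simp
  | add s t hs ht => simp only [map_add, TensorProduct.tmul_add, ev_add, hs, ht]
  | tmul x y =>
    simp only [TensorProduct.assoc_symm_tmul, LinearMap.rTensor_tmul, uncur_tmul, o22_apply]
    induction ydBraiding k B H H (h ⊗ₜ x) with
    | zero => simp
    | add s t hs ht =>
      simp only [map_add, TensorProduct.add_tmul, TensorProduct.tmul_add, ev_add, add_ev, hs, ht]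
    | tmul x h =>
      simp only [TensorProduct.assoc_tmul, LinearMap.lTensor_tmul, uncur_tmul, o22_apply,
        wh_apply]
      induction ydBraiding k B H H (h ⊗ₜ y) with
      | zero => simp
      | add s t hs ht => simp only [map_add, TensorProduct.tmul_add, ev_add, hs, ht]
      | tmul y h => simp

/-- The operators `ρ(u ⊗ 1)` are those of `rightAct`. -/
theorem rhoMap_one [BraidedHopfAlgebra k B H] (p : F ⊗[k] H →ₗ[k] k) (u : F) (x : H) :
    rhoMap B p (u ⊗ₜ 1) x = rightAct p (u ⊗ₜ x) := by
  let γ : (hom H (Tgt.of k H)).carrier := LinearMap.id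
  have : ↓1 η ⋄ ↓2 δ ⋄ ↓1 χ ⋄ ↓2 χ ⋄ o20 p ⋄ μ ⋄ γ = o21 (rightAct p) ⋄ γ := calc
    _ = ↓1 δ ⋄ ↓1 η ⋄ ↓1 χ ⋄ ↓2 χ ⋄ o20 p ⋄ μ ⋄ γ := rfl
    _ = ↓1 δ ⋄ o20 p ⋄ ↓1 η ⋄ μ ⋄ γ := by
      rw [wh21 (o01_braid (isYDHom_one k B H)), wh21 (wh21 (o01_braid (isYDHom_one k B H)))]; simp
    _ = _ := by rw [mul_one_word, rightAct_word]
  exact (rhoMap_apply p u 1 x γ).trans (ev_congr (ev_congr this u) x)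

variable [BraidedHopfAlgebra k B H] [BraidedHopfAlgebra k B F]

theorem isYDHom_rightAct (hq : IsYDHom k B q) : IsYDHom k B (rightAct q) :=
  isYDHom_lid.comp (hq.rTensor.comp
    (isYDHom_assoc.symm.comp (isYDHom_comul k B H).lTensor))

/-- The pairing precomposed with the inverse of the antipode. -/
noncomputable def pairInv (p : F ⊗[k] H →ₗ[k] k) (hS : Function.Bijective (braidedAntipode k B H)) :
    F ⊗[k] H →ₗ[k] k :=
  p ∘ₗ (antipodeInv k B H hS).lTensor F

theorem pairInv_word (hS : Function.Bijective (braidedAntipode k B H)) (γ : Z.carrier) :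
    o20 (pairInv p hS) ⋄ γ = ↓1(o11 (antipodeInv k B H hS)) ⋄ o20 p ⋄ γ := rfl

theorem isYDHom_pairInv (hp : IsYDHom k B p) (hS : Function.Bijective (braidedAntipode k B H)) :
    IsYDHom k B (pairInv p hS) :=
  hp.comp (isYDHom_antipodeInv k B H hS).lTensor

section Symmetric

variable (hp : IsQuasiDual B p) (hf : IsLeftFaithful p)
  (hs : ydBraiding k B H H ∘ₗ ydBraiding k B H H = LinearMap.id)

include hp hs

/-- Two nested evaluations of the coproduct of a functional are an evaluation at the braided
opposite product of the arguments. -/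
theorem nested_pair (γ : Z.carrier) :
    δ ⋄ ↓1(o20 p) ⋄ o20 p ⋄ γ = ↓1 χ ⋄ ↓1 μ ⋄ o20 p ⋄ γ := calc
  _ = δ ⋄ ↓2 χ ⋄ ↓2 χ ⋄ ↓1(o20 p) ⋄ o20 p ⋄ γ := by rw [wh20 (wh20 (symm_word hs))]
  _ = δ ⋄ ↓2 χ ⋄ ↓1 χ ⋄ ↓2(o20 p) ⋄ o20 p ⋄ γ := by
    rw [← wh22 (braid_pair hp.isYDHom hs)]
  _ = _ := by
    rw [mul_pair hp]; simp

/-- The operators `ρ_u` are convolution invertible in `u`, with inverse the operators of the pairing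
twisted by `S⁻¹`. -/
theorem rightAct_inv_left (hS : Function.Bijective (braidedAntipode k B H))
    (γ : (hom H Z).carrier) :
    δ ⋄ ↓1(o21 (rightAct p)) ⋄ o21 (rightAct (pairInv p hS)) ⋄ γ = ε ⋄ γ := calc
  _ = δ ⋄ ↓2 δ ⋄ ↓1(o20 p) ⋄ ↓1 δ ⋄ ↓1(o11 (antipodeInv k B H hS)) ⋄ o20 p ⋄ γ := by
    rw [wh12 rightAct_word, rightAct_word, pairInv_word]
  _ = ↓1 δ ⋄ ↓2 δ ⋄ ↓2(o11 (antipodeInv k B H hS)) ⋄ δ ⋄ ↓1(o20 p) ⋄ o20 p ⋄ γ := by simp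
  _ = ↓1 δ ⋄ ↓1 δ ⋄ ↓2(o11 (antipodeInv k B H hS)) ⋄ ↓1 χ ⋄ ↓1 μ ⋄ o20 p ⋄ γ := by
    rw [nested_pair hp hs, wh22 comul_comul]
  _ = _ := by
    rw [wh42 (antipodeInv_right B hs hS), wh20 comul_counit, one_pair hp]

theorem rightAct_inv_right (hS : Function.Bijective (braidedAntipode k B H))
    (γ : (hom H Z).carrier) :
    δ ⋄ ↓1(o21 (rightAct (pairInv p hS))) ⋄ o21 (rightAct p) ⋄ γ = ε ⋄ γ := calc
  _ = δ ⋄ ↓2 δ ⋄ ↓2(o11 (antipodeInv k B H hS)) ⋄ ↓1(o20 p) ⋄ ↓1 δ ⋄ o20 p ⋄ γ := by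
    rw [wh12 rightAct_word, rightAct_word, wh12 (pairInv_word hS)]
  _ = ↓1 δ ⋄ ↓2 δ ⋄ ↓1(o11 (antipodeInv k B H hS)) ⋄ δ ⋄ ↓1(o20 p) ⋄ o20 p ⋄ γ := by simp
  _ = ↓1 δ ⋄ ↓1 δ ⋄ ↓1(o11 (antipodeInv k B H hS)) ⋄ ↓1 χ ⋄ ↓1 μ ⋄ o20 p ⋄ γ := by
    rw [nested_pair hp hs, wh22 comul_comul]
  _ = _ := by
    rw [wh42 (antipodeInv_left B hs hS), wh20 comul_counit, one_pair hp]

/-- The operators `ρ_u` act on products through the coproduct of `u`. -/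
theorem mul_rightAct' (γ : (hom H Z).carrier) :
    ↓1 μ ⋄ o21 (rightAct p) ⋄ γ =
      δ ⋄ ↓1 χ ⋄ o21 (rightAct p) ⋄ ↓1(o21 (rightAct p)) ⋄ μ ⋄ γ := calc
  _ = ↓1 δ ⋄ ↓3 δ ⋄ ↓2 χ ⋄ ↓3 μ ⋄ ↓1 μ ⋄ o20 p ⋄ γ := by
    rw [rightAct_word, wh25 (mul_comul B)]; simp
  _ = δ ⋄ ↓2 δ ⋄ ↓4 δ ⋄ ↓1 χ ⋄ ↓3 χ ⋄ ↓2(o20 p) ⋄ o20 p ⋄ μ ⋄ γ := by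
    rw [mul_pair hp]; simp
  _ = δ ⋄ ↓2 δ ⋄ ↓4 δ ⋄ ↓1 χ ⋄ ↓2 χ ⋄ ↓3(o20 p) ⋄ o20 p ⋄ μ ⋄ γ := by
    rw [← wh22 (wh22 (braid_pair hp.isYDHom hs))]
  _ = δ ⋄ ↓1 χ ⋄ ↓1 δ ⋄ ↓4 δ ⋄ ↓3(o20 p) ⋄ o20 p ⋄ μ ⋄ γ := by
    rw [wh23 (braid_o12 (isYDHom_comul k B H))]; simp
  _ = _ := by
    rw [wh12 rightAct_word, rightAct_word]; simp

include hf

/-- A pairing past a functional: the crossing of the two functionals can replace that of the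
functional and the argument. -/
theorem pair_swap (γ : (hom F Z).carrier) : ↓1 χ ⋄ o20 p ⋄ γ = χ ⋄ ↓1(o20 p) ⋄ γ := by
  rw [o20_braid (V := F) hp.isYDHom, wh20 (symm_right hp.isYDHom hf hs)]

/-- Up to the braiding, `u ↦ ρ_u` is antimultiplicative. -/
theorem rightAct_mul (γ : (hom H Z).carrier) :
    μ ⋄ o21 (rightAct p) ⋄ γ = χ ⋄ ↓1(o21 (rightAct p)) ⋄ o21 (rightAct p) ⋄ γ := calc
  _ = ↓2 δ ⋄ ↓2 δ ⋄ ↓1 χ ⋄ o20 p ⋄ o20 p ⋄ γ := by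
    rw [rightAct_word, o21_wh, mul_pair' hp]
  _ = ↓2 δ ⋄ ↓3 δ ⋄ χ ⋄ ↓1(o20 p) ⋄ o20 p ⋄ γ := by
    rw [pair_swap hp hf hs, wh22 (wh22 comul_comul)]
  _ = _ := by
    rw [wh12 rightAct_word, rightAct_word]; simp

omit hf hs

/-- Up to the braiding, `ρ_u` commutes with the action of `F` on `H`, by coassociativity: one
evaluates on the first and the other on the last tensor factor of the coproduct. -/
theorem rightAct_dualAct (γ : (hom H Z).carrier) :
    ↓1(o21 (rightAct p)) ⋄ o21 (dualAct B p) ⋄ γ =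
      χ ⋄ ↓1(o21 (dualAct B p)) ⋄ o21 (rightAct p) ⋄ γ := calc
  _ = ↓2 δ ⋄ ↓1(o20 p) ⋄ ↓1 δ ⋄ χ ⋄ ↓1(o20 p) ⋄ γ := by
    rw [wh12 rightAct_word, dualAct_word]
  _ = ↓2 δ ⋄ ↓3 δ ⋄ χ ⋄ ↓1 χ ⋄ o20 p ⋄ χ ⋄ ↓1(o20 p) ⋄ γ := by
    rw [braid_o20 hp.isYDHom]; simp
  _ = χ ⋄ ↓2 δ ⋄ ↓2 δ ⋄ ↓1 χ ⋄ ↓2 χ ⋄ ↓3(o20 p) ⋄ o20 p ⋄ γ := by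
    rw [← wh22 (wh22 comul_comul)]; simp
  _ = χ ⋄ ↓2 δ ⋄ ↓1 χ ⋄ ↓1 δ ⋄ ↓3(o20 p) ⋄ o20 p ⋄ γ := by
    rw [wh23 (braid_o12 (isYDHom_comul k B H))]
  _ = _ := by
    rw [wh13 dualAct_word, rightAct_word]; simp

end Symmetric

end Rho

section Uncurry

variable {V W X Y : Type*} [AddCommMonoid V] [Module k V]
  [AddCommMonoid W] [Module k W] [AddCommMonoid X] [Module k X] [AddCommMonoid Y] [Module k Y]
  {Z : Tgt k}

theorem uncur_o22 (f : V ⊗[k] W →ₗ[k] X ⊗[k] Y) (γ : (hom X (hom Y Z)).carrier) (t : V ⊗[k] W) :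
    uncur (o22 f γ) t = uncur γ (f t) :=
  DFunLike.congr_fun (show uncur (o22 f γ) = uncur γ ∘ₗ f from TensorProduct.ext' fun _ _ => rfl) t

theorem uncur_pair (t : V ⊗[k] W) : uncur (pair k V W) t = t :=
  DFunLike.congr_fun TensorProduct.lift_mk t

end Uncurry

/-! ### Linearity and colinearity of families of operators -/

section Shift

variable {V V' X Y : Type*} [AddCommMonoid V] [Module k V] [YDStruct k B V]
  [AddCommMonoid V'] [Module k V']
  [AddCommMonoid X] [Module k X] [YDStruct k B X] [AddCommMonoid Y] [Module k Y]

/-- Auxiliary to `coactShift`: the map `b ⊗ v ↦ b c ⊗ f(v ⊗ x)`. -/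
noncomputable def coactShiftAux (B : Type*) [Ring B] [HopfAlgebra k B] (f : V' ⊗[k] X →ₗ[k] Y) :
    B →ₗ[k] X →ₗ[k] (B ⊗[k] V' →ₗ[k] B ⊗[k] Y) :=
  (TensorProduct.mapBilinear (.id k) B V' B Y).compl₁₂ (LinearMap.mul k B).flip
    (TensorProduct.curry f).flip

@[simp] theorem coactShiftAux_tmul (f : V' ⊗[k] X →ₗ[k] Y) (c : B) (x : X) (b : B) (v : V') :
    coactShiftAux B f c x (b ⊗ₜ v) = (b * c) ⊗ₜ f (v ⊗ₜ x) := rfl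

/-- For `f : V ⊗ X → Y`, the map `b ⊗ v ↦ ∑ b x₍₋₁₎ ⊗ f(v ⊗ x₍₀₎)`. -/
noncomputable def coactShift (B : Type*) [Ring B] [HopfAlgebra k B] [YDStruct k B X]
    (f : V' ⊗[k] X →ₗ[k] Y) : X →ₗ[k] (B ⊗[k] V' →ₗ[k] B ⊗[k] Y) :=
  TensorProduct.lift (coactShiftAux B f) ∘ₗ ydCoact k B X

/-- For a morphism `f`, the shift of the coaction of `v` by `x` is the coaction of `f(v ⊗ x)`. This
expresses colinearity of `f` by the operators of `v` on `X` only. -/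
theorem coactShift_coact [YDStruct k B Y] {f : V ⊗[k] X →ₗ[k] Y} (hf : IsYDHom k B f)
    (v : V) (x : X) : coactShift B f x (ydCoact k B V v) = ydCoact k B Y (f (v ⊗ₜ x)) := by
  rw [hf.map_coact, coact_tensor, coactShift, LinearMap.comp_apply]
  induction ydCoact k B X x with
  | zero => simp
  | add s t hs ht => simp only [map_add, TensorProduct.tmul_add, LinearMap.add_apply, hs, ht]
  | tmul c x =>
    induction ydCoact k B V v with
    | zero => simp
    | add s t hs ht => simp only [map_add, TensorProduct.add_tmul, hs, ht]
    | tmul b v => simp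

theorem coactShift_lTensor {U : Type*} [AddCommMonoid U] [Module k U] (f : U ⊗[k] X →ₗ[k] Y)
    (g : V' →ₗ[k] U) (x : X) (t : B ⊗[k] V') :
    coactShift B f x (g.lTensor B t) = coactShift B (V' := V') (f ∘ₗ g.rTensor X) x t := by
  simp only [coactShift, LinearMap.comp_apply]
  induction ydCoact k B X x with
  | zero => simp
  | add s t hs ht => simp only [map_add, LinearMap.add_apply, hs, ht]
  | tmul c x =>
    induction t with
    | zero => simp
    | add s t hs ht => simp only [map_add, hs, ht]
    | tmul b v => simp

/-- A morphism `f : V ⊗ X → Y` satisfies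
`f(b · v ⊗ x) = ∑ b₁ · f(v ⊗ S(b₂) · x)`. -/
theorem act_left [YDStruct k B Y] {f : V ⊗[k] X →ₗ[k] Y} [IsModuleComodule k B X]
    (hf : IsYDHom k B f) (v : V) (x : X) (b : B) :
    f (YDStruct.act (k := k) b v ⊗ₜ x) =
      TensorProduct.lift (LinearMap.compl₁₂ (YDStruct.act (k := k) (B := B) (V := Y)) LinearMap.id
        (TensorProduct.curry f v ∘ₗ YDStruct.act.flip x ∘ₗ HopfAlgebra.antipode k))
        (Coalgebra.comul (R := k) b) := by
  let g : (hom B (hom B (Tgt.of k Y))).carrier :=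
    LinearMap.compl₁₂ (TensorProduct.curry f) (YDStruct.act.flip v) (YDStruct.act.flip x)
  let g' : (hom B (hom B (Tgt.of k Y))).carrier :=
    LinearMap.compl₁₂ (YDStruct.act (k := k) (B := B) (V := Y)) LinearMap.id
      (TensorProduct.curry f v ∘ₗ YDStruct.act.flip x ∘ₗ HopfAlgebra.antipode k)
  have e : δ ⋄ ↓2(o11 (HopfAlgebra.antipode k)) ⋄ ↓1 μ ⋄ g = g' := by
    refine hom_ext fun a => hom_ext fun c => ?_
    have h := hf.map_act a (v ⊗ₜ YDStruct.act (k := k) (HopfAlgebra.antipode k c) x)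
    refine Eq.trans ?_ h
    rw [act_tensor, o12_apply]
    induction Coalgebra.comul (R := k) a with
    | zero => simp; rfl
    | add s t hs ht => simp only [map_add, add_ev, hs, ht]; rfl
    | tmul a a' =>
      change f (YDStruct.act a v ⊗ₜ YDStruct.act (a' * HopfAlgebra.antipode k c) x) =
        f (YDStruct.act a v ⊗ₜ YDStruct.act a' (YDStruct.act (HopfAlgebra.antipode k c) x))
      rw [IsModuleComodule.mul_act]
  have e' : δ ⋄ δ ⋄ ↓2(o11 (HopfAlgebra.antipode k)) ⋄ ↓1 μ ⋄ g = ↓1 η ⋄ g := by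
    rw [comul_comul, wh32 hopf_antipode_right, comul_counit']
  rw [e] at e'
  refine Eq.trans ?_ (ev_congr e' b).symm
  have : f (YDStruct.act (k := k) b v ⊗ₜ x) =
      f (YDStruct.act (k := k) b v ⊗ₜ YDStruct.act (k := k) (1 : B) x) := by
    rw [IsModuleComodule.one_act]
  exact this

end Shift

section Cancel

variable {V : Type*} [AddCommMonoid V] [Module k V] [YDStruct k B V] [IsModuleComodule k B V]
  {Z : Tgt k}

/-- The map `b ⊗ v ↦ ∑ b s(v₍₋₁₎) ⊗ v₍₀₎`. -/
noncomputable def coactMul (s : B →ₗ[k] B) (V : Type*) [AddCommMonoid V] [Module k V]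
    [YDStruct k B V] : B ⊗[k] V →ₗ[k] B ⊗[k] V :=
  (LinearMap.mul' k B).rTensor V ∘ₗ (TensorProduct.assoc k B B V).symm.toLinearMap ∘ₗ
    (s.rTensor V ∘ₗ ydCoact k B V).lTensor B

theorem coactMul_word (s : B →ₗ[k] B) (γ : (hom B (hom V Z)).carrier) :
    o22 (coactMul s V) ⋄ γ = ↓1 κ ⋄ ↓1(o11 s) ⋄ μ ⋄ γ :=
  hom_ext fun b => hom_ext fun v => by
    simp only [coactMul, LinearMap.comp_apply, LinearMap.lTensor_tmul, o12_apply, o22_apply,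
      wh_apply]
    induction ydCoact k B V v with
    | zero => simp
    | add s t hs ht => simp only [map_add, TensorProduct.tmul_add, hs, ht]
    | tmul x y => simp

/-- The maps for `s = S` and `s = 1` are inverse to each other. -/
theorem coactMul_antipode (t : B ⊗[k] V) :
    coactMul .id V (coactMul (HopfAlgebra.antipode k) V t) = t := by
  have h : ∀ γ : (hom B (hom V (Tgt.of k (B ⊗[k] V)))).carrier,
      o22 (coactMul (HopfAlgebra.antipode k) V) ⋄ o22 (coactMul .id V) ⋄ γ = γ := fun γ => calc
    _ = ↓1 κ ⋄ ↓1(o11 (HopfAlgebra.antipode k)) ⋄ μ ⋄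
        ↓1 κ ⋄ μ ⋄ γ := by
      rw [coactMul_word, coactMul_word]; rfl
    _ = ↓1 κ ⋄ ↓2 κ ⋄ ↓1(o11 (HopfAlgebra.antipode k)) ⋄
        μ ⋄ μ ⋄ γ := by simp
    _ = ↓1 κ ⋄ ↓1 ε ⋄ ↓1 η ⋄
        μ ⋄ γ := by
      rw [mul_mul, ← wh22 coact_comul, wh32 hopf_antipode_left]
    _ = _ := by
      rw [mul_one_word, wh20 coact_counit]
  induction t with
  | zero => simp
  | add s t hs ht => simp only [map_add, hs, ht]
  | tmul b v =>
    have := ev_congr (ev_congr (h (pair k B V)) b) v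
    rw [o22_apply, uncur_o22, uncur_pair] at this
    exact this

end Cancel

/-! ### The faithful representation of `H # F` on `H` -/

section Lambda

variable {H F : Type*} [Ring H] [Algebra k H] [Coalgebra k H] [YDModule k B H]
  [BraidedHopfAlgebra k B H]
  [Ring F] [Algebra k F] [Coalgebra k F] [YDModule k B F] [BraidedHopfAlgebra k B F] {Z : Tgt k}

local notation "ς" => o21 (LinearMap.id (M := H ⊗[k] F))

/-- The map `x ↦ ∑ C(S⁻¹(x₁) ⊗ x₂)`. -/
noncomputable def flipInv (hS : Function.Bijective (braidedAntipode k B H)) : H →ₗ[k] H ⊗[k] H :=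
  ydBraiding k B H H ∘ₗ (antipodeInv k B H hS).rTensor H ∘ₗ Coalgebra.comul

theorem flipInv_word (hS : Function.Bijective (braidedAntipode k B H))
    (γ : (hom H (hom H Z)).carrier) :
    o12 (flipInv hS) ⋄ γ = δ ⋄ o11 (antipodeInv k B H hS) ⋄ χ ⋄ γ := hom_ext fun x => by
  rw [o12_apply, o12_apply, uncur_rTensor₁, uncur_o22]; rfl

theorem isYDHom_flipInv (hS : Function.Bijective (braidedAntipode k B H)) :
    IsYDHom k B (flipInv (B := B) hS) :=
  isYDHom_braiding.comp ((isYDHom_antipodeInv k B H hS).rTensor.comp (isYDHom_comul k B H))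

/-- The defining property of `flipInv`: with `∑ y ⊗ z = C(S⁻¹(x₁) ⊗ x₂)`, the element
`∑ y₂ ⊗ y₁ z`, suitably braided, is `x ⊗ 1`. -/
theorem flipInv_comul (hs : ydBraiding k B H H ∘ₗ ydBraiding k B H H = LinearMap.id)
    (hS : Function.Bijective (braidedAntipode k B H)) (γ : (hom H (hom H Z)).carrier) :
    o12 (flipInv hS) ⋄ δ ⋄ χ ⋄ ↓1 μ ⋄ γ = ↓1 η ⋄ γ := calc
  _ = δ ⋄ ↓1 δ ⋄ o11 (antipodeInv k B H hS) ⋄ χ ⋄ ↓1 χ ⋄ χ ⋄ ↓1 μ ⋄ γ := by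
    rw [flipInv_word, braid_o12 (isYDHom_comul k B H)]; simp
  _ = δ ⋄ δ ⋄ o11 (antipodeInv k B H hS) ⋄ χ ⋄ μ ⋄ χ ⋄ γ := by
    rw [comul_comul, o21_braid (isYDHom_mul k B H)]
  _ = δ ⋄ ε ⋄ η ⋄ χ ⋄ γ := by
    congr 1
    exact antipodeInv_left B hs hS _
  _ = _ := by
    rw [comul_counit, o01_braid (isYDHom_one k B H)]

variable (B) in
/-- The representation `(h ⊗ f) ⊗ x ↦ h (f ⇀ x)` of `H # F` on `H`. -/
noncomputable def lamAct (p : F ⊗[k] H →ₗ[k] k) : (H ⊗[k] F) ⊗[k] H →ₗ[k] H :=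
  smashAct (LinearMap.mul' k H) (dualAct B p)

theorem lamMap_apply (p : F ⊗[k] H →ₗ[k] k) (d : H ⊗[k] F) (x : H) :
    lamMap B p d x = lamAct B p (d ⊗ₜ x) := rfl

variable {p : F ⊗[k] H →ₗ[k] k}

theorem lamAct_word (γ : (hom H Z).carrier) :
    ς ⋄ o21 (lamAct B p) ⋄ γ = ↓1(o21 (dualAct B p)) ⋄ μ ⋄ γ := rfl

theorem isYDHom_lamAct (hp : IsYDHom k B p) : IsYDHom k B (lamAct B p) :=
  (isYDHom_mul k B H).comp ((isYDHom_dualAct hp).lTensor.comp isYDHom_assoc)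

theorem lamAct_mul (hp : IsQuasiDual B p) (s t : H ⊗[k] F) (x : H) :
    lamAct B p (smashMul B (LinearMap.mul' k H) (dualAct B p) (s ⊗ₜ t) ⊗ₜ x) =
      lamAct B p (s ⊗ₜ lamAct B p (t ⊗ₜ x)) :=
  smashAct_smashMul (isYDModuleAlgebra_dualAct hp) s t x

/-- The map `(h ⊗ f) ⊗ x ↦ ⟨f, x⟩ h`. -/
noncomputable def pairAct (p : F ⊗[k] H →ₗ[k] k) : (H ⊗[k] F) ⊗[k] H →ₗ[k] H :=
  (TensorProduct.rid k H).toLinearMap ∘ₗ p.lTensor H ∘ₗ (TensorProduct.assoc k H F H).toLinearMap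

/-- The evaluation `⟨f, x⟩ h` is obtained from the operators of `h ⊗ f` in the representation
`lamAct`: it is `∑ λ(h ⊗ f)(y) z` where `∑ y ⊗ z` is `flipInv x`. -/
theorem pairAct_word (hp : IsQuasiDual B p)
    (hs : ydBraiding k B H H ∘ₗ ydBraiding k B H H = LinearMap.id)
    (hS : Function.Bijective (braidedAntipode k B H)) (γ : (hom H Z).carrier) :
    o21 (pairAct p) ⋄ γ = ↓1(o12 (flipInv hS)) ⋄ o21 (lamAct B p) ⋄ μ ⋄ γ := by
  refine split_injective (k := k) ?_
  calc
  _ = ↓1(o20 p) ⋄ γ := hom_ext fun h => hom_ext fun f => hom_ext fun x => by simp [pairAct]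
  _ = ↓2(o12 (flipInv hS)) ⋄ ↓2 δ ⋄ ↓2 χ ⋄ ↓3 μ ⋄ ↓1(o20 p) ⋄ μ ⋄ γ := by
    rw [wh41 (wh41 (flipInv_comul hs hS)), ← o20_wh_1, mul_one_word]
  _ = ↓2(o12 (flipInv hS)) ⋄ ↓2 δ ⋄ ↓1 χ ⋄ ↓2(o20 p) ⋄ μ ⋄ μ ⋄ γ := by
    rw [wh22 (braid_pair hp.isYDHom hs), mul_mul]; simp
  _ = ↓2(o12 (flipInv hS)) ⋄ ↓1(o21 (dualAct B p)) ⋄ μ ⋄ μ ⋄ γ := by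
    rw [wh13 dualAct_word]
  _ = _ := by
    rw [← lamAct_word]; simp

/-- The representation `λ` is faithful, since it determines the evaluations `⟨f, x⟩ h`, and the
pairing is left faithful. -/
theorem lamAct_faithful (hp : IsQuasiDual B p) (hf : IsLeftFaithful p)
    (hs : ydBraiding k B H H ∘ₗ ydBraiding k B H H = LinearMap.id)
    (hS : Function.Bijective (braidedAntipode k B H)) (d : H ⊗[k] F)
    (hd : ∀ x, lamAct B p (d ⊗ₜ x) = 0) : d = 0 := by
  refine eq_zero_of_lTensor (TensorProduct.curry p) hf d fun x => ?_
  let γ : (hom H (Tgt.of k H)).carrier := LinearMap.id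
  have h₁ : pairAct p (d ⊗ₜ x) = 0 := by
    have h₂ : ev (o21 (lamAct B p) ⋄ μ ⋄ γ) d = 0 := hom_ext fun y => by
      rw [o21_apply, hd]; simp
    have := ev_congr (ev_congr (pairAct_word hp hs hS γ) d) x
    rw [wh_apply, h₂, map_zero] at this
    exact this
  apply (TensorProduct.rid k H).injective
  rw [map_zero, ← h₁]
  generalize d = d
  induction d with
  | zero => simp
  | add s t hs ht => simp only [map_add, TensorProduct.add_tmul, hs, ht]
  | tmul h f => rfl

end Lambda

/-! ### Lifting families of operators to `H # F` -/

section Lift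

variable {H F : Type*} [Ring H] [Algebra k H] [Coalgebra k H] [YDModule k B H]
  [BraidedHopfAlgebra k B H]
  [Ring F] [Algebra k F] [Coalgebra k F] [YDModule k B F] [BraidedHopfAlgebra k B F] {Z : Tgt k}
  {p : F ⊗[k] H →ₗ[k] k}

theorem pairAct_eq_lift (hp : IsQuasiDual B p)
    (hs : ydBraiding k B H H ∘ₗ ydBraiding k B H H = LinearMap.id)
    (hS : Function.Bijective (braidedAntipode k B H)) (d : H ⊗[k] F) (x : H) :
    pairAct p (d ⊗ₜ x) = TensorProduct.lift ((LinearMap.mul k H) ∘ₗ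
      TensorProduct.curry (lamAct B p) d) (flipInv (B := B) hS x) := by
  let γ : (hom H (Tgt.of k H)).carrier := LinearMap.id
  exact ev_congr (ev_congr (pairAct_word hp hs hS γ) d) x

/-- The shift along `pairAct` is composed of shifts along `lamAct` and the product, since `flipInv`
is colinear. -/
theorem coactShift_pairAct (hp : IsQuasiDual B p)
    (hs : ydBraiding k B H H ∘ₗ ydBraiding k B H H = LinearMap.id)
    (hS : Function.Bijective (braidedAntipode k B H)) (x : H) (t : B ⊗[k] (H ⊗[k] F)) :
    coactShift B (pairAct p) x t = TensorProduct.lift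
      (LinearMap.compl₁₂ (LinearMap.llcomp k (B ⊗[k] (H ⊗[k] F)) (B ⊗[k] H) (B ⊗[k] H)).flip
        (coactShift B (lamAct B p)) (coactShift B (LinearMap.mul' k H)))
      (flipInv (B := B) hS x) t := by
  induction t with
  | zero => simp
  | add s t hs ht => simp only [map_add, hs, ht]
  | tmul b d =>
    let G : B ⊗[k] (H ⊗[k] H) →ₗ[k] B ⊗[k] H := TensorProduct.map (LinearMap.mulLeft k b)
      (TensorProduct.lift (LinearMap.mul k H ∘ₗ TensorProduct.curry (lamAct B p) d))
    have h₁ : coactShift B (pairAct p) x (b ⊗ₜ d) =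
        G ((flipInv (B := B) hS).lTensor B (ydCoact k B H x)) := by
      rw [coactShift, LinearMap.comp_apply]
      induction ydCoact k B H x with
      | zero => simp
      | add s t hs ht => simp only [map_add, LinearMap.add_apply, hs, ht]
      | tmul c x =>
        rw [LinearMap.lTensor_tmul, TensorProduct.map_tmul, ← pairAct_eq_lift hp hs hS]
        rfl
    rw [h₁, ← (isYDHom_flipInv hS).map_coact]
    induction flipInv (B := B) hS x with
    | zero => simp
    | add s t hs ht => simp only [map_add, LinearMap.add_apply, hs, ht]
    | tmul y z =>
      rw [coact_tensor, TensorProduct.lift.tmul]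
      change _ = coactShift B (LinearMap.mul' k H) z (coactShift B (lamAct B p) y (b ⊗ₜ d))
      simp only [coactShift, LinearMap.comp_apply]
      induction ydCoact k B H y with
      | zero => simp
      | add s t hs ht =>
        simp only [map_add, LinearMap.add_apply, TensorProduct.add_tmul, hs, ht]
      | tmul c y =>
        induction ydCoact k B H z with
        | zero => simp
        | add s t hs ht =>
          simp only [map_add, LinearMap.add_apply, TensorProduct.tmul_add, hs, ht]
        | tmul c' z => simp [G, mul_assoc]

/-- For `T = ∑ b ⊗ (h ⊗ f)`, the shift of `T` along `pairAct` depends on `x` only through the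
elements `∑ b S(f₍₋₁₎) ⟨f₍₀₎, x⟩ ⊗ h`. -/
theorem coactShift_pairAct_eq (hc : IsCompatiblePairing B p) (x : H) (t : B ⊗[k] (H ⊗[k] F)) :
    coactShift B (pairAct p) x t = TensorProduct.comm k H B
      (((TensorProduct.rid k B).toLinearMap ∘ₗ ((TensorProduct.curry p).flip x).lTensor B).lTensor H
        ((coactMul (HopfAlgebra.antipode k) F).lTensor H (TensorProduct.leftComm k B H F t))) := by
  induction t with
  | zero => simp
  | add s t hs ht => simp only [map_add, hs, ht]
  | tmul b t =>
    induction t with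
    | zero => simp
    | add s t hs ht => simp only [map_add, TensorProduct.tmul_add, hs, ht]
    | tmul h f =>
      have h₁ : coactShift B (pairAct p) x (b ⊗ₜ (h ⊗ₜ f)) =
          (b * TensorProduct.rid k B ((p ∘ₗ TensorProduct.mk k F H f).lTensor B
            (ydCoact k B H x))) ⊗ₜ h := by
        rw [coactShift, LinearMap.comp_apply]
        induction ydCoact k B H x with
        | zero => simp
        | add s t hs ht =>
          simp only [map_add, LinearMap.add_apply, hs, ht, mul_add, TensorProduct.add_tmul]
        | tmul c x => simp [pairAct, TensorProduct.smul_tmul']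
      have h₂ : TensorProduct.rid k B (((TensorProduct.curry p).flip x).lTensor B
          (coactMul (HopfAlgebra.antipode k) F (b ⊗ₜ f))) = b * HopfAlgebra.antipode k
            (TensorProduct.rid k B ((p ∘ₗ (TensorProduct.mk k F H).flip x).lTensor B
              (ydCoact k B F f))) := by
        simp only [coactMul, LinearMap.comp_apply, LinearMap.lTensor_tmul]
        induction ydCoact k B F f with
        | zero => simp
        | add s t hs ht => simp only [map_add, TensorProduct.tmul_add, hs, ht, mul_add]
        | tmul c f => simp
      rw [h₁, ← hc.coact, ← h₂]
      simp

/-- An element `T` of `B ⊗ (H ⊗ F)` is determined by its shifts along `lamAct`. -/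
theorem eq_of_coactShift_lamAct (hp : IsQuasiDual B p) (hc : IsCompatiblePairing B p)
    (hf : IsLeftFaithful p) (hs : ydBraiding k B H H ∘ₗ ydBraiding k B H H = LinearMap.id)
    (hS : Function.Bijective (braidedAntipode k B H)) {s t : B ⊗[k] (H ⊗[k] F)}
    (h : ∀ x, coactShift B (lamAct B p) x s = coactShift B (lamAct B p) x t) : s = t := by
  have h₁ : ∀ x, coactShift B (pairAct p) x s = coactShift B (pairAct p) x t := fun x => by
    rw [coactShift_pairAct hp hs hS, coactShift_pairAct hp hs hS]
    induction flipInv (B := B) hS x with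
    | zero => simp
    | add s t hs ht => simp only [map_add, LinearMap.add_apply, hs, ht]
    | tmul y z => simp [h]
  have h₂ : (coactMul (HopfAlgebra.antipode k) F).lTensor H (TensorProduct.leftComm k B H F s) =
      (coactMul (HopfAlgebra.antipode k) F).lTensor H (TensorProduct.leftComm k B H F t) := by
    let ℓ : B ⊗[k] F →ₗ[k] H →ₗ[k] B := LinearMap.flip
      (LinearMap.llcomp k (B ⊗[k] F) (B ⊗[k] k) B (TensorProduct.rid k B).toLinearMap ∘ₗ
        LinearMap.lTensorHom B ∘ₗ (TensorProduct.curry p).flip)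
    refine eq_of_lTensor ℓ (fun d hd => eq_zero_of_lTensor (TensorProduct.curry p) hf d fun x =>
      (TensorProduct.rid k B).injective ((hd x).trans (map_zero _).symm)) fun x => ?_
    refine (TensorProduct.comm k H B).injective ?_
    have := h₁ x
    rw [coactShift_pairAct_eq hc, coactShift_pairAct_eq hc] at this
    exact this
  have h₃ : ∀ t : H ⊗[k] (B ⊗[k] F), (coactMul .id F).lTensor H
      ((coactMul (HopfAlgebra.antipode k) F).lTensor H t) = t := fun t => by
    induction t with
    | zero => simp
    | add s t hs ht => simp only [map_add, hs, ht]
    | tmul h t => simp [coactMul_antipode]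
  refine (TensorProduct.leftComm k B H F).injective ?_
  rw [← h₃ (TensorProduct.leftComm k B H F s), h₂, h₃]

/-- A family of operators on `H` which is a morphism and consists of operators `lamAct d` comes
from a morphism to `H ⊗ F`. -/
theorem exists_lift_lamAct (hp : IsQuasiDual B p) (hc : IsCompatiblePairing B p)
    (hf : IsLeftFaithful p) (hs : ydBraiding k B H H ∘ₗ ydBraiding k B H H = LinearMap.id)
    (hS : Function.Bijective (braidedAntipode k B H)) {V : Type*} [AddCommGroup V] [Module k V]
    [YDStruct k B V] {r : V ⊗[k] H →ₗ[k] H} (hr : IsYDHom k B r)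
    (h : ∀ v, ∃ d, ∀ x, lamAct B p (d ⊗ₜ x) = r (v ⊗ₜ x)) :
    ∃ w : V →ₗ[k] H ⊗[k] F, IsYDHom k B w ∧ ∀ v x, lamAct B p (w v ⊗ₜ x) = r (v ⊗ₜ x) := by
  have hinj : Function.Injective (lamMap B p) := (injective_iff_map_eq_zero _).2 fun d hd =>
    lamAct_faithful hp hf hs hS d fun x => DFunLike.congr_fun hd x
  let e := LinearEquiv.ofInjective (lamMap B p) hinj
  let w : V →ₗ[k] H ⊗[k] F :=
    e.symm.toLinearMap ∘ₗ (TensorProduct.curry r).codRestrict _ fun v => by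
      obtain ⟨d, hd⟩ := h v
      exact ⟨d, LinearMap.ext hd⟩
  have hw : ∀ v x, lamAct B p (w v ⊗ₜ x) = r (v ⊗ₜ x) := fun v x => by
    rw [← lamMap_apply, ← LinearEquiv.ofInjective_apply (h := hinj)]
    change (e (e.symm _)).1 x = _
    rw [e.apply_symm_apply]; rfl
  refine ⟨w, isYDHom_of (fun b v => ?_) (fun v => ?_), hw⟩
  · refine hinj (LinearMap.ext fun x => ?_)
    rw [lamMap_apply, lamMap_apply, hw, act_left hr, act_left (isYDHom_lamAct hp.isYDHom)]
    congr 2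
    refine LinearMap.ext₂ fun a c => ?_
    simp [hw]
  · refine eq_of_coactShift_lamAct hp hc hf hs hS fun x => ?_
    have e : lamAct B p ∘ₗ w.rTensor H = r := TensorProduct.ext' fun v x => hw v x
    rw [coactShift_coact (isYDHom_lamAct hp.isYDHom), coactShift_lTensor, hw,
      ← coactShift_coact hr, e]

end Lift

/-! ### Maps along a coaction -/

section CoactMap

variable {F R X X' X'' : Type*} [AddCommMonoid F] [Module k F]
  [AddCommMonoid R] [Module k R] [AddCommMonoid X] [Module k X] [AddCommMonoid X'] [Module k X']
  [AddCommMonoid X''] [Module k X''] {Z : Tgt k}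

/-- For a coaction `ψ` and `l : F ⊗ X → X'`, the map `r ⊗ x ↦ ∑ r₍₀₎ ⊗ l(r₍₁₎ ⊗ x)`. -/
noncomputable def coactMap (ψ : R →ₗ[k] R ⊗[k] F) (l : F ⊗[k] X →ₗ[k] X') :
    R ⊗[k] X →ₗ[k] R ⊗[k] X' :=
  l.lTensor R ∘ₗ (TensorProduct.assoc k R F X).toLinearMap ∘ₗ ψ.rTensor X

theorem coactMap_word (ψ : R →ₗ[k] R ⊗[k] F) (l : F ⊗[k] X →ₗ[k] X')
    (γ : (hom R (hom X' Z)).carrier) :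
    o22 (coactMap ψ l) ⋄ γ = o12 ψ ⋄ ↓1(o21 l) ⋄ γ :=
  hom_ext fun r => hom_ext fun x => by
    simp only [coactMap, LinearMap.comp_apply, LinearMap.rTensor_tmul, o12_apply, o22_apply]
    induction ψ r with
    | zero => simp
    | add s t hs ht => simp only [map_add, TensorProduct.add_tmul, add_ev, hs, ht]
    | tmul x y => simp

theorem _root_.IsYDHom.coactMap {B : Type*} [Ring B] [HopfAlgebra k B] [YDStruct k B F]
    [YDStruct k B R] [YDStruct k B X] [YDStruct k B X'] {ψ : R →ₗ[k] R ⊗[k] F}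
    {l : F ⊗[k] X →ₗ[k] X'} (hψ : IsYDHom k B ψ) (hl : IsYDHom k B l) :
    IsYDHom k B (coactMap ψ l) :=
  hl.lTensor.comp (isYDHom_assoc.comp hψ.rTensor)

end CoactMap

/-! ### The intertwining relation -/

section Intertwining

variable {H F R : Type*} [Ring H] [Algebra k H] [Coalgebra k H] [YDModule k B H]
  [BraidedHopfAlgebra k B H]
  [Ring F] [Algebra k F] [Coalgebra k F] [YDModule k B F] [BraidedHopfAlgebra k B F]
  [Ring R] [Algebra k R] [YDModule k B R] {Z : Tgt k}
  {p : F ⊗[k] H →ₗ[k] k} {ψ : R →ₗ[k] R ⊗[k] F}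

local notation "ς" => o21 (LinearMap.id (M := H ⊗[k] F))

/-- If `l` and `l'` are convolution inverse to each other, then the maps along the coaction compose
to the identity. -/
theorem coactMap_comp (hψ : IsYDComoduleAlgebra B ψ) {X : Type*} [AddCommMonoid X] [Module k X]
    {l l' : F ⊗[k] X →ₗ[k] X}
    (h : ∀ γ : (hom X (Tgt.of k (R ⊗[k] X))).carrier, δ ⋄ ↓1(o21 l) ⋄ o21 l' ⋄ γ = ε ⋄ γ)
    (t : R ⊗[k] X) : coactMap ψ l' (coactMap ψ l t) = t := by
  have e : o22 (coactMap ψ l) ⋄ o22 (coactMap ψ l') ⋄ pair k R X = pair k R X := calc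
    _ = o12 ψ ⋄ o12 ψ ⋄ ↓2(o21 l) ⋄ ↓1(o21 l') ⋄ pair k R X := by
      rw [coactMap_word, coactMap_word]; simp
    _ = o12 ψ ⋄ ↓1 ε ⋄ pair k R X := by
      rw [comodule_coassoc hψ, wh31 h]
    _ = _ := comodule_counit hψ _
  have := uncur_o22 (coactMap ψ l) (o22 (coactMap ψ l') ⋄ pair k R X) t
  rw [e, uncur_o22, uncur_pair, uncur_pair] at this
  exact this.symm

/-- The map `r ⊗ x ↦ ∑ r₍₀₎ ⊗ ρ_{r₍₁₎}(x)` commutes with the action of `F` on `R # H`. -/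
theorem coact_braid_word (hα : IsYDHom k B ψ) (hp : IsQuasiDual B p)
    (γ : (hom R (hom H Z)).carrier) :
    χ ⋄ ↓1(o21 (dualAct B p)) ⋄ o12 ψ ⋄ ↓1(o21 (rightAct p)) ⋄ γ =
      ↓1(o12 ψ) ⋄ ↓2(o21 (rightAct p)) ⋄ χ ⋄ ↓1(o21 (dualAct B p)) ⋄ γ := calc
  _ = ↓1(o12 ψ) ⋄ χ ⋄ ↓1 χ ⋄ ↓2(o21 (dualAct B p)) ⋄ ↓1(o21 (rightAct p)) ⋄ γ := by
    rw [← braid_o12 hα]; simp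
  _ = _ := by
    rw [← wh23 (rightAct_dualAct hp)]; simp

/-- The twist of `R # H` in terms of the operators `ρ`. -/
theorem smashTwist_coactToAct_word (hα : IsYDHom k B ψ) (γ : (hom R (hom H Z)).carrier) :
    o22 (smashTwist B (coactToAct B p ψ)) ⋄ γ =
      ↓1(o12 ψ) ⋄ χ ⋄ ↓1 χ ⋄ ↓1(o21 (rightAct p)) ⋄ γ := calc
  _ = δ ⋄ ↓1 χ ⋄ ↓1(o12 ψ) ⋄ χ ⋄ ↓1 χ ⋄ ↓1(o20 p) ⋄ γ := by
    rw [smashTwist_word, coactToAct_word]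
  _ = ↓1(o12 ψ) ⋄ δ ⋄ ↓1 χ ⋄ χ ⋄ ↓2 χ ⋄ ↓1 χ ⋄ ↓1(o20 p) ⋄ γ := by
    rw [wh23 (braid_o12 hα)]; simp
  _ = ↓1(o12 ψ) ⋄ χ ⋄ ↓1 χ ⋄ ↓2 δ ⋄ ↓1(o20 p) ⋄ γ := by
    rw [o12_braid (isYDHom_comul k B H), wh32 (o12_braid (isYDHom_comul k B H))]
  _ = _ := by
    rw [wh12 rightAct_word]

/-- The map `r ⊗ x ↦ ∑ r₍₀₎ ⊗ ρ_{r₍₁₎}(x)` turns multiplication by `1 ⊗ h` for the braided tensor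
product `R ⊗ H` into multiplication by `1 # h` in `R # H`. -/
theorem braid_mul_coact_word (hψ : IsYDComoduleAlgebra B ψ) (hp : IsQuasiDual B p)
    (hf : IsLeftFaithful p) (hs : ydBraiding k B H H ∘ₗ ydBraiding k B H H = LinearMap.id)
    (γ : (hom R (hom H Z)).carrier) :
    χ ⋄ ↓1 μ ⋄ o12 ψ ⋄ ↓1(o21 (rightAct p)) ⋄ γ =
      ↓1(o12 ψ) ⋄ ↓2(o21 (rightAct p)) ⋄ o22 (smashTwist B (coactToAct B p ψ)) ⋄ ↓1 μ ⋄ γ := calc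
  _ = ↓1(o12 ψ) ⋄ χ ⋄ ↓1 χ ⋄ ↓2 μ ⋄ ↓1(o21 (rightAct p)) ⋄ γ := by
    rw [← braid_o12 hψ.isYDHom]; simp
  _ = ↓1(o12 ψ) ⋄ χ ⋄ ↓1 χ ⋄ ↓1 δ ⋄ ↓2 χ ⋄ ↓1(o21 (rightAct p)) ⋄ ↓2(o21 (rightAct p)) ⋄ ↓1 μ ⋄
        γ := by
    rw [wh25 (mul_rightAct' hp hs)]
  _ = ↓1(o12 ψ) ⋄ χ ⋄ ↓2 δ ⋄ ↓1 χ ⋄ ↓1(o21 (rightAct p)) ⋄ ↓2(o21 (rightAct p)) ⋄ ↓1 μ ⋄ γ := by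
    rw [wh23 (braid_o12 (isYDHom_comul k B F)), wh20 (wh20 (symm_left hp.isYDHom hf hs))]
  _ = ↓1(o12 ψ) ⋄ ↓1(o12 ψ) ⋄ ↓3(o21 (rightAct p)) ⋄ χ ⋄ ↓1 χ ⋄ ↓1(o21 (rightAct p)) ⋄ ↓1 μ ⋄
        γ := by
    rw [wh22 (comodule_coassoc hψ)]; simp
  _ = _ := by
    rw [smashTwist_coactToAct_word hψ.isYDHom]; simp

/-- The map `r ⊗ x ↦ ∑ r₍₀₎ ⊗ ρ_{r₍₁₎}(x)` turns multiplication by `r`, twisted by the inverses of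
the operators `ρ`, into multiplication by `r # 1`. -/
theorem coact_mul_coact_word (hp : IsQuasiDual B p) (hf : IsLeftFaithful p)
    (hs : ydBraiding k B H H ∘ₗ ydBraiding k B H H = LinearMap.id)
    (hS : Function.Bijective (braidedAntipode k B H)) (hψ : IsYDComoduleAlgebra B ψ)
    (γ : (hom R (hom H Z)).carrier) :
    o12 ψ ⋄ ↓1 χ ⋄ ↓2(o21 (rightAct (pairInv p hS))) ⋄ μ ⋄ o12 ψ ⋄ ↓1(o21 (rightAct p)) ⋄ γ =
      ↓1(o12 ψ) ⋄ ↓2(o21 (rightAct p)) ⋄ μ ⋄ γ := calc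
  _ = o12 ψ ⋄ ↓1 χ ⋄ ↓2(o21 (rightAct (pairInv p hS))) ⋄ o12 ψ ⋄ ↓2(o12 ψ) ⋄ ↓1 χ ⋄ ↓2 μ ⋄
        ↓2(o21 (rightAct p)) ⋄ μ ⋄ γ := by
    rw [comodule_mul hψ]; simp
  _ = o12 ψ ⋄ ↓1 χ ⋄ ↓2(o21 (rightAct (pairInv p hS))) ⋄ o12 ψ ⋄ ↓2(o12 ψ) ⋄ ↓1 χ ⋄ ↓2 χ ⋄
        ↓3(o21 (rightAct p)) ⋄ ↓2(o21 (rightAct p)) ⋄ μ ⋄ γ := by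
    rw [wh23 (wh23 (rightAct_mul hp hf hs))]
  _ = o12 ψ ⋄ o12 ψ ⋄ ↓2 χ ⋄ ↓1 χ ⋄ ↓3(o21 (rightAct (pairInv p hS))) ⋄ ↓2(o21 (rightAct p)) ⋄
        ↓1(o12 ψ) ⋄ ↓2(o21 (rightAct p)) ⋄ μ ⋄ γ := by
    rw [← wh23 (braid_o12 hψ.isYDHom)]; simp
  _ = o12 ψ ⋄ ↓1 χ ⋄ ↓2 δ ⋄ ↓3(o21 (rightAct (pairInv p hS))) ⋄ ↓2(o21 (rightAct p)) ⋄
        ↓1(o12 ψ) ⋄ ↓2(o21 (rightAct p)) ⋄ μ ⋄ γ := by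
    rw [comodule_coassoc hψ, wh32 (o12_braid (isYDHom_comul k B F))]
  _ = o12 ψ ⋄ ↓1 ε ⋄ ↓1(o12 ψ) ⋄ ↓2(o21 (rightAct p)) ⋄ μ ⋄ γ := by
    rw [wh31 (wh31 (rightAct_inv_right hp hs hS)), ← wh12 (o10_braid (isYDHom_counit k B F))]
  _ = _ := comodule_counit hψ _

variable (B) in
/-- The representation of `R ⊗ (H # F)` on `R ⊗ H`. -/
noncomputable def tensorRep (R : Type*) [Ring R] [Algebra k R] [YDModule k B R]
    (p : F ⊗[k] H →ₗ[k] k) : (R ⊗[k] (H ⊗[k] F)) ⊗[k] (R ⊗[k] H) →ₗ[k] R ⊗[k] H :=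
  twistedAct (LinearMap.mul' k R) (lamAct B p) (ydBraiding k B (H ⊗[k] F) R)

variable (B) in
/-- The representation of `(R # H) # F` on `R # H`. -/
noncomputable def smashRep (p : F ⊗[k] H →ₗ[k] k) (ψ : R →ₗ[k] R ⊗[k] F) :
    ((R ⊗[k] H) ⊗[k] F) ⊗[k] (R ⊗[k] H) →ₗ[k] R ⊗[k] H :=
  smashAct (smashOneMul B p ψ) (dualActSmash B R p)

/-- The representation of `(R # H) # F` on `R # H`, as a word. -/
theorem smashRep_apply (r : R) (h : H) (f : F) (t : R ⊗[k] H) (γ : (hom R (hom H Z)).carrier) :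
    uncur γ (smashRep B p ψ (((r ⊗ₜ h) ⊗ₜ f) ⊗ₜ t)) =
      uncur ((↓2 χ ⋄ ↓3(o21 (dualAct B p)) ⋄ ↓1(o22 (smashTwist B (coactToAct B p ψ))) ⋄ μ ⋄
        ↓1 μ ⋄ γ) r h f) t := by
  induction t with
  | zero => simp
  | add s t hs ht => simp only [map_add, TensorProduct.tmul_add, hs, ht]
  | tmul s x =>
    rw [smashRep, smashAct_tmul, smashOneMul, smashMul_eq, twistedMul_eq, twistedAct_right]
    let β : (hom R (hom H Z)).carrier :=
      (↓1(o22 (smashTwist B (coactToAct B p ψ))) ⋄ μ ⋄ ↓1 μ ⋄ γ) r h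
    let β' : (hom (R ⊗[k] H) Z).carrier := uncur β
    exact ev_congr (ev_congr (ev_congr (trivialAct_word (A := R) (α := dualAct B p) β') f) s) x

variable (B) in
/-- Left multiplication by `w u` on `H # F`. -/
noncomputable def liftMul (p : F ⊗[k] H →ₗ[k] k) (w : F →ₗ[k] H ⊗[k] F) :
    F ⊗[k] (H ⊗[k] F) →ₗ[k] H ⊗[k] F :=
  smashMul B (LinearMap.mul' k H) (dualAct B p) ∘ₗ w.rTensor (H ⊗[k] F)

/-- In the representation `λ`, left multiplication by `w u` is the operator of `rightAct` that `w`
lifts. -/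
theorem liftMul_lamAct (hp : IsQuasiDual B p) {q : F ⊗[k] H →ₗ[k] k} {w : F →ₗ[k] H ⊗[k] F}
    (hw : ∀ u x, lamAct B p (w u ⊗ₜ x) = rightAct q (u ⊗ₜ x)) (γ : (hom H Z).carrier) :
    o21 (liftMul B p w) ⋄ o21 (lamAct B p) ⋄ γ = ↓1(o21 (lamAct B p)) ⋄ o21 (rightAct q) ⋄ γ :=
  hom_ext fun u => hom_ext fun d => hom_ext fun x => by
    simp [liftMul, lamAct_mul hp, hw]

theorem isYDHom_liftMul (hp : IsQuasiDual B p) {w : F →ₗ[k] H ⊗[k] F} (hw : IsYDHom k B w) :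
    IsYDHom k B (liftMul B p w) :=
  (isYDAlgebra_smashDual hp).isYDHom_mul.comp hw.rTensor

/-- The left-hand side of `coactMap_tensorRep`, as a word. -/
theorem tensorRep_apply (r : R) (h : H) (f s : _) (x : H) (w : F →ₗ[k] H ⊗[k] F)
    (γ : (hom R (hom H Z)).carrier) :
    uncur γ (coactMap ψ (rightAct p) (tensorRep B R p
      (coactMap ψ (liftMul B p w) (r ⊗ₜ (h ⊗ₜ f)) ⊗ₜ (s ⊗ₜ x)))) =
      (↓1 ς ⋄ o12 ψ ⋄ ↓1(o21 (liftMul B p w)) ⋄ ↓1 χ ⋄ μ ⋄ ↓1(o21 (lamAct B p)) ⋄ o12 ψ ⋄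
        ↓1(o21 (rightAct p)) ⋄ γ) r h f s x := by
  rw [← uncur_o22, tensorRep, twistedAct_left, ← uncur_o22, coactMap_word, coactMap_word]
  rfl

/-- The intertwining relation of `coactMap_tensorRep`, as an identity of words: it combines the
three relations for multiplication by `r`, by `h`, and for the action of `f`. -/
theorem intertwining (hp : IsQuasiDual B p) (hf : IsLeftFaithful p)
    (hs : ydBraiding k B H H ∘ₗ ydBraiding k B H H = LinearMap.id)
    (hS : Function.Bijective (braidedAntipode k B H)) (hψ : IsYDComoduleAlgebra B ψ)
    {w : F →ₗ[k] H ⊗[k] F} (hw : IsYDHom k B w)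
    (hw' : ∀ u x, lamAct B p (w u ⊗ₜ x) = rightAct (pairInv p hS) (u ⊗ₜ x))
    (γ : (hom R (hom H Z)).carrier) :
    ↓1 ς ⋄ o12 ψ ⋄ ↓1(o21 (liftMul B p w)) ⋄ ↓1 χ ⋄ μ ⋄ ↓1(o21 (lamAct B p)) ⋄ o12 ψ ⋄
        ↓1(o21 (rightAct p)) ⋄ γ =
      ↓3(o22 (coactMap ψ (rightAct p))) ⋄ ↓2 χ ⋄ ↓3(o21 (dualAct B p)) ⋄
        ↓1(o22 (smashTwist B (coactToAct B p ψ))) ⋄ μ ⋄ ↓1 μ ⋄ γ := calc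
  _ = ↓1 ς ⋄ o12 ψ ⋄ ↓2 χ ⋄ ↓1 χ ⋄ ↓2(o21 (liftMul B p w)) ⋄ ↓2(o21 (lamAct B p)) ⋄ μ ⋄ o12 ψ ⋄
        ↓1(o21 (rightAct p)) ⋄ γ := by
    rw [wh23 (o21_braid (isYDHom_liftMul hp hw))]; simp
  _ = ↓1 ς ⋄ o12 ψ ⋄ ↓2 χ ⋄ ↓1 χ ⋄ ↓3(o21 (lamAct B p)) ⋄ ↓2(o21 (rightAct (pairInv p hS))) ⋄
        μ ⋄ o12 ψ ⋄ ↓1(o21 (rightAct p)) ⋄ γ := by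
    rw [wh22 (wh22 (liftMul_lamAct hp hw'))]
  _ = o12 ψ ⋄ ↓2 ς ⋄ ↓2 χ ⋄ ↓3(o21 (lamAct B p)) ⋄ ↓1 χ ⋄ ↓2(o21 (rightAct (pairInv p hS))) ⋄
        μ ⋄ o12 ψ ⋄ ↓1(o21 (rightAct p)) ⋄ γ := by
    simp
  _ = o12 ψ ⋄ ↓3 χ ⋄ ↓2 χ ⋄ ↓3 ς ⋄ ↓3(o21 (lamAct B p)) ⋄ ↓1 χ ⋄
        ↓2(o21 (rightAct (pairInv p hS))) ⋄ μ ⋄ o12 ψ ⋄ ↓1(o21 (rightAct p)) ⋄ γ := by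
    rw [wh23 (wh23 (o21_braid IsYDHom.id))]
  _ = o12 ψ ⋄ ↓3 χ ⋄ ↓2 χ ⋄ ↓4(o21 (dualAct B p)) ⋄ ↓3 μ ⋄ ↓1 χ ⋄
        ↓2(o21 (rightAct (pairInv p hS))) ⋄ μ ⋄ o12 ψ ⋄ ↓1(o21 (rightAct p)) ⋄ γ := by
    rw [wh22 (wh22 (wh22 lamAct_word))]
  _ = ↓2 χ ⋄ ↓3(o21 (dualAct B p)) ⋄ ↓1 χ ⋄ ↓2 μ ⋄ o12 ψ ⋄ ↓1 χ ⋄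
        ↓2(o21 (rightAct (pairInv p hS))) ⋄ μ ⋄ o12 ψ ⋄ ↓1(o21 (rightAct p)) ⋄ γ := by
    simp
  _ = ↓2 χ ⋄ ↓3(o21 (dualAct B p)) ⋄ ↓1 χ ⋄ ↓2 μ ⋄ ↓1(o12 ψ) ⋄ ↓2(o21 (rightAct p)) ⋄ μ ⋄ γ := by
    rw [coact_mul_coact_word hp hf hs hS hψ]
  _ = ↓2 χ ⋄ ↓3(o21 (dualAct B p)) ⋄ ↓2(o12 ψ) ⋄ ↓3(o21 (rightAct p)) ⋄
        ↓1(o22 (smashTwist B (coactToAct B p ψ))) ⋄ ↓2 μ ⋄ μ ⋄ γ := by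
    rw [wh44 (braid_mul_coact_word hψ hp hf hs)]
  _ = ↓3(o12 ψ) ⋄ ↓4(o21 (rightAct p)) ⋄ ↓2 χ ⋄ ↓3(o21 (dualAct B p)) ⋄
        ↓1(o22 (smashTwist B (coactToAct B p ψ))) ⋄ ↓2 μ ⋄ μ ⋄ γ := by
    rw [wh44 (wh44 (coact_braid_word hψ.isYDHom hp))]
  _ = _ := by
    rw [wh12 (wh12 (wh12 (coactMap_word ψ (rightAct p))))]; simp

end Intertwining

/-! ### The isomorphism -/

section Isomorphism

variable {H F R : Type*} [Ring H] [Algebra k H] [Coalgebra k H] [YDModule k B H]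
  [BraidedHopfAlgebra k B H]
  [Ring F] [Algebra k F] [Coalgebra k F] [YDModule k B F] [BraidedHopfAlgebra k B F]
  [Ring R] [Algebra k R] [YDModule k B R] {Z : Tgt k}
  {p : F ⊗[k] H →ₗ[k] k} {ψ : R →ₗ[k] R ⊗[k] F}

/-- The representation of `R ⊗ (H # F)` is multiplicative. -/
theorem tensorRep_mul (hp : IsQuasiDual B p) (hR : IsYDAlgebra B (LinearMap.mul' k R) 1)
    (s t : R ⊗[k] (H ⊗[k] F)) (z : R ⊗[k] H) :
    tensorRep B R p (tensorSmashMul B R p (s ⊗ₜ t) ⊗ₜ z) =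
      tensorRep B R p (s ⊗ₜ tensorRep B R p (t ⊗ₜ z)) :=
  twistedAct_assoc hR.assoc (lamAct_mul hp)
    (isTwisting_braiding hR.isYDHom_mul (isYDAlgebra_smashDual hp).isYDHom_mul) s t z

/-- The representation of `(R # H) # F` is multiplicative. -/
theorem smashRep_mul (hp : IsQuasiDual B p)
    (hR : IsYDModuleAlgebra B (LinearMap.mul' k R) 1 (coactToAct B p ψ))
    (s t : (R ⊗[k] H) ⊗[k] F) (z : R ⊗[k] H) :
    smashRep B p ψ (smashTwoMul B p ψ (s ⊗ₜ t) ⊗ₜ z) =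
      smashRep B p ψ (s ⊗ₜ smashRep B p ψ (t ⊗ₜ z)) :=
  smashAct_smashMul (isYDModuleAlgebra_dualActSmash hp hR) s t z

theorem eq_of_lamAct (hp : IsQuasiDual B p) (hf : IsLeftFaithful p)
    (hs : ydBraiding k B H H ∘ₗ ydBraiding k B H H = LinearMap.id)
    (hS : Function.Bijective (braidedAntipode k B H)) {s t : H ⊗[k] F}
    (h : ∀ x, lamAct B p (s ⊗ₜ x) = lamAct B p (t ⊗ₜ x)) : s = t :=
  sub_eq_zero.1 (lamAct_faithful hp hf hs hS _ fun x => by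
    rw [TensorProduct.sub_tmul, map_sub, h, sub_self])

/-- The representation of `R ⊗ (H # F)` on `R ⊗ H` is faithful, already on the elements `1 ⊗ x`. -/
theorem tensorRep_faithful (hp : IsQuasiDual B p) (hf : IsLeftFaithful p)
    (hs : ydBraiding k B H H ∘ₗ ydBraiding k B H H = LinearMap.id)
    (hS : Function.Bijective (braidedAntipode k B H))
    (hR : IsYDAlgebra B (LinearMap.mul' k R) 1) {s t : R ⊗[k] (H ⊗[k] F)}
    (h : ∀ z, tensorRep B R p (s ⊗ₜ z) = tensorRep B R p (t ⊗ₜ z)) : s = t := by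
  have e : ∀ (x : H) (s : R ⊗[k] (H ⊗[k] F)), tensorRep B R p (s ⊗ₜ (1 ⊗ₜ x)) =
      ((TensorProduct.curry (lamAct B p)).flip x).lTensor R s := fun x s => by
    induction s with
    | zero => simp
    | add s t hs ht => simp only [map_add, TensorProduct.add_tmul, hs, ht]
    | tmul r d =>
      exact twistedAct_tmul_one hR.mul_one (fun d => eq_of_uncur fun γ =>
        ev_congr (braid_o01 hR.isYDHom_unit γ) d) r d x
  refine eq_of_lTensor (TensorProduct.curry (lamAct B p))
    (lamAct_faithful hp hf hs hS) fun x => ?_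
  rw [← e, ← e, h]

theorem liftMul_liftMul_apply (w w' : F →ₗ[k] H ⊗[k] F) (γ : (hom (H ⊗[k] F) Z).carrier) (u : F)
    (d : H ⊗[k] F) :
    (δ ⋄ ↓1(o21 (liftMul B p w)) ⋄ o21 (liftMul B p w') ⋄ γ) u d =
      γ ((δ ⋄ ↓1(o21 (liftMul B p w)) ⋄ o21 (liftMul B p w') ⋄
        (show (hom (H ⊗[k] F) (Tgt.of k (H ⊗[k] F))).carrier from LinearMap.id)) u d) := by
  let g : Mor (Tgt.of k (H ⊗[k] F)) Z := γ
  let i : (hom (H ⊗[k] F) (Tgt.of k (H ⊗[k] F))).carrier := LinearMap.id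
  change (δ ⋄ ↓1(o21 (liftMul B p w)) ⋄ o21 (liftMul B p w') ⋄ ↓1 g ⋄ i) u d = _
  rw [o21_wh, o21_wh_1, o12_wh]
  rfl

/-- Convolution inverse families of operators on `H` have convolution inverse lifts to `H # F`,
since `λ` is faithful. -/
theorem liftMul_cancel (hp : IsQuasiDual B p) (hf : IsLeftFaithful p)
    (hs : ydBraiding k B H H ∘ₗ ydBraiding k B H H = LinearMap.id)
    (hS : Function.Bijective (braidedAntipode k B H)) {q q' : F ⊗[k] H →ₗ[k] k}
    {w w' : F →ₗ[k] H ⊗[k] F} (hw : ∀ u x, lamAct B p (w u ⊗ₜ x) = rightAct q (u ⊗ₜ x))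
    (hw' : ∀ u x, lamAct B p (w' u ⊗ₜ x) = rightAct q' (u ⊗ₜ x))
    (hq : ∀ γ : (hom H (Tgt.of k H)).carrier,
      δ ⋄ ↓1(o21 (rightAct q)) ⋄ o21 (rightAct q') ⋄ γ = ε ⋄ γ)
    (γ : (hom (H ⊗[k] F) Z).carrier) :
    δ ⋄ ↓1(o21 (liftMul B p w)) ⋄ o21 (liftMul B p w') ⋄ γ = ε ⋄ γ := by
  let i : (hom (H ⊗[k] F) (Tgt.of k (H ⊗[k] F))).carrier := LinearMap.id
  let j : (hom H (Tgt.of k H)).carrier := LinearMap.id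
  have key : ∀ u d, (δ ⋄ ↓1(o21 (liftMul B p w)) ⋄ o21 (liftMul B p w') ⋄ i) u d =
      Coalgebra.counit (R := k) u • d := fun u d => by
    refine eq_of_lamAct hp hf hs hS fun x => ?_
    rw [← TensorProduct.smul_tmul', map_smul]
    have h : δ ⋄ ↓1(o21 (liftMul B p w)) ⋄ o21 (liftMul B p w') ⋄ o21 (lamAct B p) ⋄ j =
        ε ⋄ o21 (lamAct B p) ⋄ j := by
      rw [liftMul_lamAct hp hw', wh22 (liftMul_lamAct hp hw), o12_wh, hq, o10_wh]
    exact (ev_congr (liftMul_liftMul_apply w w' (o21 (lamAct B p) ⋄ j) u d) x).symm.trans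
      (ev_congr (ev_congr (ev_congr h u) d) x)
  exact hom_ext fun u => hom_ext fun d => by
    rw [liftMul_liftMul_apply, key, ev_smul]; rfl

/-- The map `r ⊗ x ↦ ∑ r₍₀₎ ⊗ ρ_{r₍₁₎}(x)` intertwines the representations of the two algebras along
`(r ⊗ h) ⊗ f ↦ ∑ r₍₀₎ ⊗ w(r₍₁₎) (h ⊗ f)`. -/
theorem coactMap_tensorRep (hp : IsQuasiDual B p) (hf : IsLeftFaithful p)
    (hs : ydBraiding k B H H ∘ₗ ydBraiding k B H H = LinearMap.id)
    (hS : Function.Bijective (braidedAntipode k B H)) (hψ : IsYDComoduleAlgebra B ψ)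
    {w : F →ₗ[k] H ⊗[k] F} (hw : IsYDHom k B w)
    (hw' : ∀ u x, lamAct B p (w u ⊗ₜ x) = rightAct (pairInv p hS) (u ⊗ₜ x))
    (a : (R ⊗[k] H) ⊗[k] F) (z : R ⊗[k] H) :
    coactMap ψ (rightAct p) (tensorRep B R p
      (coactMap ψ (liftMul B p w) (TensorProduct.assoc k R H F a) ⊗ₜ z)) =
      smashRep B p ψ (a ⊗ₜ coactMap ψ (rightAct p) z) := by
  induction a with
  | zero => simp
  | add s t hs ht => simp only [map_add, TensorProduct.add_tmul, hs, ht]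
  | tmul a f =>
    induction a with
    | zero => simp
    | add s t hs ht => simp only [map_add, TensorProduct.add_tmul, hs, ht]
    | tmul r h =>
      induction z with
      | zero => simp
      | add s t hs ht => simp only [map_add, TensorProduct.tmul_add, hs, ht]
      | tmul s x =>
        refine eq_of_uncur fun γ => ?_
        have := ev_congr (ev_congr (ev_congr (ev_congr (ev_congr
          (intertwining hp hf hs hS hψ hw hw' γ) r) h) f) s) x
        rw [smashRep_apply, TensorProduct.assoc_tmul, tensorRep_apply, this, ← uncur_o22]
        rfl

/-- The isomorphism `(r ⊗ h) ⊗ f ↦ ∑ r₍₀₎ ⊗ w(r₍₁₎) (h ⊗ f)`, where `w` lifts the inverses of the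
operators `ρ` to `H # F`. -/
theorem exists_algebra_iso (hp : IsQuasiDual B p) (hc : IsCompatiblePairing B p)
    (hf : IsLeftFaithful p) (hs : ydBraiding k B H H ∘ₗ ydBraiding k B H H = LinearMap.id)
    (hRL : RLCondition B p) (hS : Function.Bijective (braidedAntipode k B H))
    (hS' : Function.Surjective (braidedAntipode k B F)) (hψ : IsYDComoduleAlgebra B ψ)
    (hR : IsYDModuleAlgebra B (LinearMap.mul' k R) 1 (coactToAct B p ψ)) :
    ∃ Φ : (R ⊗[k] H) ⊗[k] F ≃ₗ[k] R ⊗[k] (H ⊗[k] F),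
      IsYDHom k B Φ.toLinearMap ∧
      ∀ x y, Φ (smashTwoMul B p ψ (x ⊗ₜ y)) = tensorSmashMul B R p (Φ x ⊗ₜ Φ y) := by
  -- The `RL`-condition puts `ρ_u` and its convolution inverse into the image of `λ`.
  have hρ : ∀ u, ∃ d, ∀ x, lamAct B p (d ⊗ₜ x) = rightAct p (u ⊗ₜ x) := fun u => by
    obtain ⟨d, hd⟩ := hRL u
    exact ⟨d, fun x => by rw [← rhoMap_one (B := B), ← hd]; rfl⟩
  have hρ' : ∀ u, ∃ d, ∀ x, lamAct B p (d ⊗ₜ x) = rightAct (pairInv p hS) (u ⊗ₜ x) := fun u => by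
    obtain ⟨v, rfl⟩ := hS' u
    obtain ⟨d, hd⟩ := hρ v
    refine ⟨d, fun x => (hd x).trans ?_⟩
    let j : (hom H (Tgt.of k H)).carrier := LinearMap.id
    have : o21 (rightAct p) ⋄ j =
        o11 (braidedAntipode k B F) ⋄ o21 (rightAct (pairInv p hS)) ⋄ j := calc
      _ = ↓1 δ ⋄ ↓1(o11 (antipodeInv k B H hS)) ⋄ ↓1(o11 (braidedAntipode k B H)) ⋄ o20 p ⋄ j := by
        rw [wh20 (inv_antipode_word B hS), rightAct_word]
      _ = ↓1 δ ⋄ ↓1(o11 (antipodeInv k B H hS)) ⋄ o11 (braidedAntipode k B F) ⋄ o20 p ⋄ j := by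
        rw [antipode_pair hp]
      _ = _ := by rw [rightAct_word, pairInv_word]; simp
    exact ev_congr (ev_congr this v) x
  obtain ⟨w, hw, hwl⟩ := exists_lift_lamAct hp hc hf hs hS (isYDHom_rightAct hp.isYDHom) hρ
  obtain ⟨w', hw', hwl'⟩ := exists_lift_lamAct hp hc hf hs hS
    (isYDHom_rightAct (isYDHom_pairInv hp.isYDHom hS)) hρ'
  let e : R ⊗[k] (H ⊗[k] F) ≃ₗ[k] R ⊗[k] (H ⊗[k] F) :=
    LinearEquiv.ofLinearMap (coactMap ψ (liftMul B p w')) (coactMap ψ (liftMul B p w))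
      (LinearMap.ext fun t => coactMap_comp hψ (fun γ => liftMul_cancel hp hf hs hS hwl hwl'
        (rightAct_inv_left hp hs hS) γ) t)
      (LinearMap.ext fun t => coactMap_comp hψ (fun γ => liftMul_cancel hp hf hs hS hwl' hwl
        (rightAct_inv_right hp hs hS) γ) t)
  let Φ := (TensorProduct.assoc k R H F).trans e
  let Θ := coactMap ψ (rightAct p)
  have hΘ : Function.Injective Θ := Function.LeftInverse.injective
    (g := coactMap ψ (rightAct (pairInv p hS))) fun t =>
      coactMap_comp hψ (fun γ => rightAct_inv_left hp hs hS γ) t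
  have inter : ∀ a z, Θ (tensorRep B R p (Φ a ⊗ₜ z)) = smashRep B p ψ (a ⊗ₜ Θ z) :=
    coactMap_tensorRep hp hf hs hS hψ hw' hwl'
  refine ⟨Φ, ?_, fun x y => ?_⟩
  · exact (hψ.isYDHom.coactMap (isYDHom_liftMul hp hw')).comp isYDHom_assoc
  -- Both sides act on `R ⊗ H` by the same operator, by the intertwining relation.
  · refine tensorRep_faithful hp hf hs hS hψ.isYDAlgebra fun z => hΘ ?_
    rw [inter, smashRep_mul hp hR, ← inter, ← inter, tensorRep_mul hp hψ.isYDAlgebra]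

end Isomorphism

end Calculus

end YD

theorem theorem2p4 {k B H H' R : Type*} [Field k]
    [Ring B] [HopfAlgebra k B] [FiniteDimensional k B]
    [Ring H] [Algebra k H] [Coalgebra k H] [YDModule k B H] [BraidedHopfAlgebra k B H]
    [Ring H'] [Algebra k H'] [Coalgebra k H'] [YDModule k B H'] [BraidedHopfAlgebra k B H']
    [Ring R] [Algebra k R] [YDModule k B R]
    (p : H' ⊗[k] H →ₗ[k] k)
    (hp : IsQuasiDual B p) (hcompat : IsCompatiblePairing B p) (hfaith : IsLeftFaithful p)
    (hsymm : ydBraiding k B H H ∘ₗ ydBraiding k B H H = LinearMap.id)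
    (hRL : RLCondition B p)
    (hS : Function.Bijective (braidedAntipode k B H))
    (hS' : Function.Bijective (braidedAntipode k B H'))
    (ψ : R →ₗ[k] R ⊗[k] H') (hψ : IsYDComoduleAlgebra B ψ) :
    IsYDModuleAlgebra B (LinearMap.mul' k R) 1 (coactToAct B p ψ) ∧
    IsYDModuleAlgebra B (LinearMap.mul' k H) 1 (dualAct B p) ∧
    IsYDModuleAlgebra B (smashOneMul B p ψ) (1 ⊗ₜ 1) (dualActSmash B R p) ∧
    IsYDAlgebra B (smashTwoMul B p ψ) ((1 ⊗ₜ 1) ⊗ₜ 1) ∧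
    IsYDAlgebra B (tensorSmashMul B R p) (1 ⊗ₜ (1 ⊗ₜ 1)) ∧
    ∃ Φ : (R ⊗[k] H) ⊗[k] H' ≃ₗ[k] R ⊗[k] (H ⊗[k] H'),
      Φ ((1 ⊗ₜ 1) ⊗ₜ 1) = 1 ⊗ₜ (1 ⊗ₜ 1) ∧
      (∀ x y : (R ⊗[k] H) ⊗[k] H',
        Φ (smashTwoMul B p ψ (x ⊗ₜ y)) = tensorSmashMul B R p (Φ x ⊗ₜ Φ y)) ∧
      ((∀ a b : B, a * b = b * a) → Coalgebra.IsCocomm k B →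
        IsYDHom k B Φ.toLinearMap) := by
  have hR := YD.isYDModuleAlgebra_coactToAct hp hfaith hsymm hψ
  have h₁ := YD.isYDAlgebra_smashTwoMul hp hR
  have h₂ := YD.isYDAlgebra_tensorSmashMul hp hψ.isYDAlgebra
  obtain ⟨Φ, hΦ, hmul⟩ :=
    YD.exists_algebra_iso hp hcompat hfaith hsymm hRL hS hS'.surjective hψ hR
  refine ⟨hR, YD.isYDModuleAlgebra_dualAct hp, YD.isYDModuleAlgebra_dualActSmash hp hR, h₁, h₂, Φ,
    ?_, hmul, fun _ _ => hΦ⟩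
  -- `Φ 1` is a left unit of the target, because `Φ` is multiplicative and surjective.
  rw [← h₂.mul_one (Φ ((1 ⊗ₜ 1) ⊗ₜ 1))]
  obtain ⟨x, hx⟩ := Φ.surjective (1 ⊗ₜ (1 ⊗ₜ 1))
  rw [← hx, ← hmul, h₁.one_mul]
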